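/- Let $\Bbbk$ be a field, $q\in\Bbbk^\times$, let $l_1,\dots,l_d\ge 0$ be integers, $n=l_1+\dots+l_d$, $\ell=\mathfrak{gl}_{l_1}\oplus\dots\oplus\mathfrak{gl}_{l_d}\subseteq\mathfrak{gl}_n$, and let $u_1,\dots,u_d\in\Bbbk^\times$. Let $\mathbf{AWeb}_q$ be the $\Bbbk$-linear category of annular exterior $\mathfrak{gl}_n$-webs. Its objects are words in $\{\pm k: k\ge 1\}$ (oriented strands with a thickness). Its morphisms are generated by planar exterior $\mathfrak{gl}_n$-webs (merges, splits, caps, cups) and by the invertible coils $\rho_{x,K}\colon xK\to Kx$ (the first strand $x$ winds around the annulus). The relations are those of planar exterior webs (zigzags, rotation of trivalent vertices, circles equal to quantum binomials, vanishing of strands thicker than $n$, associativity, coassociativity, digon removal, the dumbbell–crossing relations, braid relations, invertibility of the mates of crossings), together with isotopies: generating webs slide along coils, and webs move past coils of other strands. The annular product $f\circ^{A}g$ puts the diagram $f$ below and in front of the diagram $g$, so that a strand winding in $f$ passes in front of the strands of $g$, and a strand winding in $g$ passes behind the strands of $f$. Let $\mathbf{Fund}_q[\ell]$ be the category of representations of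 $U_q(\ell)$ on tensor products of the quantum exterior powers $\Lambda_q^k V$ of the vector representation $V$ (basis $v_{i,j}$, $1\le i\le d$, $1\le j\le l_i$) and their duals, with the Hopf-algebraic tensor product and the standard pivotal structure inherited from $U_q(\mathfrak{gl}_n)$. Let $A\Psi_q\colon\mathbf{AWeb}_q\to\mathbf{Fund}_q[\ell]$ be the $\Bbbk$-linear functor which sends the letter $k$ to $\Lambda^k_qV$, $-k$ to its dual, and a word to the tensor product; which is the usual functor to $U_q(\mathfrak{gl}_n)$-representations on planar webs; and which sends the coil of a thickness-one upward strand to $v_{i,j}\otimes w\mapsto u_i\,\beta^{\ell}(v_{i,j}\otimes w)$, where $\beta^{\ell}$ is the braiding of $U_q(\ell)$-representations (the braiding of $\mathfrak{gl}_{l_i}$ inside the $i$th block, and a swap for different blocks). Assume that $A\Psi_q$ is well-defined, i.e. that there is such a functor. Then: (a) If $q=1$ and $\operatorname{char}\Bbbk=0$, then $A\Psi_1$ is pivotal: $A\Psi_1(f\circ^{A}g)=A\Psi_1(f)\otimes A\Psi_1(g)$ for all annular web diagrams $f,g$, and $A\Psi_1$ sends the left and right evaluations and coevaluations (nested caps and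 cups) of every word to those of its image. (b) If $q$ is not a root of unity and $n\ge 1$, then $A\Psi_q$ is not monoidal, and hence not pivotal. It is not strictly monoidal, and there is not even a family of invertible linear maps $J_{K,K'}$ of the spaces attached to the words $KK'$ with $A\Psi_q(f\circ^{A}g)\,J_{K,K'}=J_{L,L'}\,(A\Psi_q(f)\otimes A\Psi_q(g))$ for all $f\colon K\to L$ and $g\colon K'\to L'$. Explicitly, let $\rho\colon(1)\to(1)$ be the coil and $\mathrm{id}$ the identity of the word $(1)$. Then $A\Psi_q(\mathrm{id}\circ^{A}\rho)\ne A\Psi_q(\mathrm{id})\otimes A\Psi_q(\rho)$ and, if at least two of the $l_i$ are nonzero, also $A\Psi_q(\rho\circ^{A}\mathrm{id})\ne A\Psi_q(\rho)\otimes A\Psi_q(\mathrm{id})$. -/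

import Mathlib

open CategoryTheory

namespace AnnularWebs

universe u

/-! ## Objects -/

/-- An oriented strand of thickness `k ≥ 1`: the integer `k` is `up k`, the integer `-k` is `dn k`.
Strands of thickness `0` are omitted. -/
inductive Label : Type
  | up (k : ℕ+) : Label
  | dn (k : ℕ+) : Label

namespace Label

/-- The dual label (opposite orientation). -/
def star : Label → Label
  | up k => dn k
  | dn k => up k

/-- The thickness of a strand. -/
def thick : Label → ℕ
  | up k => k
  | dn k => k

end Label

/-- Objects of the web categories: words in the labels. -/
abbrev Word : Type := List Label

/-- The dual word: reversed order, opposite orientations. -/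
def Word.dual : Word → Word
  | [] => []
  | x :: K => Word.dual K ++ [x.star]

/-- The upward strand of thickness `k`, omitted when `k = 0`. -/
def upw (k : ℕ) : Word := if h : 0 < k then [Label.up ⟨k, h⟩] else []

theorem upw_pos {k : ℕ} (h : 0 < k) : upw k = [Label.up ⟨k, h⟩] := dif_pos h

theorem upw_pnat (k : ℕ+) : upw (k : ℕ) = [Label.up k] := upw_pos k.pos

theorem upw_not_pos {k : ℕ} (h : ¬ 0 < k) : upw k = [] := dif_neg h

theorem upw_add {k l : ℕ} (hk : 0 < k) (hl : 0 < l) :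
    upw (k + l) = [Label.up (⟨k, hk⟩ + ⟨l, hl⟩)] := upw_pos (by omega)

theorem upw_append_of_not_pos_right {k l : ℕ} (hl : ¬ 0 < l) :
    upw (k + l) = upw k ++ upw l := by
  obtain rfl : l = 0 := by omega
  simp [upw_not_pos (k := 0) (by omega)]

theorem upw_append_of_not_pos_left {k l : ℕ} (hk : ¬ 0 < k) :
    upw (k + l) = upw k ++ upw l := by
  obtain rfl : k = 0 := by omega
  simp [upw_not_pos (k := 0) (by omega)]

/-! ## Quantum numbers -/

section Quantum

variable {𝕜 : Type u} [Field 𝕜]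

/-- The power `q ^ z` as an element of the field. -/
def qpow (q : 𝕜ˣ) (z : ℤ) : 𝕜 := ((q ^ z : 𝕜ˣ) : 𝕜)

/-- The quantum number `[a] = q^(a-1) + q^(a-3) + ... + q^(1-a)`. -/
def qint (q : 𝕜ˣ) (a : ℕ) : 𝕜 :=
  ∑ i ∈ Finset.range a, qpow q ((a : ℤ) - 1 - 2 * i)

/-- The quantum number of an integer, `[-a] = -[a]`. -/
def qintZ (q : 𝕜ˣ) (z : ℤ) : 𝕜 := (z.sign : 𝕜) * qint q z.natAbs

/-- The quantum factorial `[b]!`. -/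
def qfac (q : 𝕜ˣ) (b : ℕ) : 𝕜 := ∏ i ∈ Finset.range b, qint q (i + 1)

/-- The quantum binomial `[a][a-1]...[a-b+1]/[b]!`. -/
def qbinom (q : 𝕜ˣ) (a b : ℕ) : 𝕜 :=
  (∏ i ∈ Finset.range b, qintZ q ((a : ℤ) - i)) / qfac q b

end Quantum

/-! ## Planar web diagrams

Diagrams are read from bottom (source) to top (target). -/

/-- Generating planar webs: merges and splits (upward and downward), caps and cups. -/
inductive PGen : Word → Word → Type
  | merge (k l : ℕ+) : PGen [.up k, .up l] [.up (k + l)]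
  | split (k l : ℕ+) : PGen [.up (k + l)] [.up k, .up l]
  | mergeDn (k l : ℕ+) : PGen [.dn k, .dn l] [.dn (k + l)]
  | splitDn (k l : ℕ+) : PGen [.dn (k + l)] [.dn k, .dn l]
  | capL (k : ℕ+) : PGen [.dn k, .up k] []
  | capR (k : ℕ+) : PGen [.up k, .dn k] []
  | cupL (k : ℕ+) : PGen [] [.up k, .dn k]
  | cupR (k : ℕ+) : PGen [] [.dn k, .up k]

/-- Formal linear combinations of planar diagrams. `comp f g` is `f` at the bottom and `g` on top,
`tensor f g` is horizontal juxtaposition. -/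
inductive PDiag (𝕜 : Type u) : Word → Word → Type u
  | wid (K : Word) : PDiag 𝕜 K K
  | comp {K L M : Word} (f : PDiag 𝕜 K L) (g : PDiag 𝕜 L M) : PDiag 𝕜 K M
  | tensor {K L K' L' : Word} (f : PDiag 𝕜 K L) (g : PDiag 𝕜 K' L') :
      PDiag 𝕜 (K ++ K') (L ++ L')
  | gen {K L : Word} (g : PGen K L) : PDiag 𝕜 K L
  | zero (K L : Word) : PDiag 𝕜 K L
  | add {K L : Word} (f g : PDiag 𝕜 K L) : PDiag 𝕜 K L
  | smul {K L : Word} (c : 𝕜) (f : PDiag 𝕜 K L) : PDiag 𝕜 K L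

namespace PDiag

variable {𝕜 : Type u}

/-- Transport along equalities of words (strict associativity and unit). -/
def cast {K K' L L' : Word} (hK : K = K') (hL : L = L') (f : PDiag 𝕜 K L) : PDiag 𝕜 K' L' :=
  match hK, hL with
  | rfl, rfl => f

/-- The sum of `f 0, ..., f (N - 1)`. -/
def sum {K L : Word} : (N : ℕ) → (ℕ → PDiag 𝕜 K L) → PDiag 𝕜 K L
  | 0, _ => zero K L
  | N + 1, f => add (sum N f) (f N)

/-- The upward merge, with edges of thickness `0` omitted. -/
def mergeN (k l : ℕ) : PDiag 𝕜 (upw k ++ upw l) (upw (k + l)) :=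
  if hk : 0 < k then
    if hl : 0 < l then
      (gen (PGen.merge ⟨k, hk⟩ ⟨l, hl⟩)).cast
        (by rw [upw_pos hk, upw_pos hl]; rfl) (upw_add hk hl).symm
    else (wid (upw (k + l))).cast (upw_append_of_not_pos_right hl) rfl
  else (wid (upw (k + l))).cast (upw_append_of_not_pos_left hk) rfl

/-- The upward split, with edges of thickness `0` omitted. -/
def splitN (k l : ℕ) : PDiag 𝕜 (upw (k + l)) (upw k ++ upw l) :=
  if hk : 0 < k then
    if hl : 0 < l then
      (gen (PGen.split ⟨k, hk⟩ ⟨l, hl⟩)).cast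
        (upw_add hk hl).symm (by rw [upw_pos hk, upw_pos hl]; rfl)
    else (wid (upw (k + l))).cast rfl (upw_append_of_not_pos_right hl)
  else (wid (upw (k + l))).cast rfl (upw_append_of_not_pos_left hk)

/-- The ladder on two upward strands of thickness `c + b` and `c + a`: first a rung of thickness `b`
from the left to the right strand, then a rung of thickness `a` from right to left. -/
def ladder (c b a : ℕ) :
    PDiag 𝕜 (upw (c + b) ++ upw (c + a)) (upw (c + a) ++ upw (c + b)) :=
  ((splitN c b).tensor (wid (upw (c + a)))).comp
    ((((wid (upw c)).tensor (mergeN b (c + a))).cast (List.append_assoc _ _ _).symm rfl).comp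
      (((wid (upw c)).tensor
        ((splitN a (c + b)).cast (congrArg upw (by omega)) rfl)).comp
        (((mergeN c a).tensor (wid (upw (c + b)))).cast (List.append_assoc _ _ _) rfl)))

variable [Field 𝕜]

/-- The `(k,l)`-crossing of upward strands, as a combination of ladders. For `front = true` the
strand of thickness `k` (from bottom left to top right) is in front, otherwise it is behind. -/
def crossN (q : 𝕜ˣ) (front : Bool) (k l : ℕ) :
    PDiag 𝕜 (upw k ++ upw l) (upw l ++ upw k) :=
  smul ((-1) ^ (k * l)) (sum (k + 1) fun c =>
    if h : c ≤ k ∧ c ≤ l then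
      smul (qpow (-q) (if front then (c : ℤ) else -(c : ℤ)))
        ((ladder c (k - c) (l - c)).cast
          (by rw [Nat.add_sub_cancel' h.1, Nat.add_sub_cancel' h.2])
          (by rw [Nat.add_sub_cancel' h.1, Nat.add_sub_cancel' h.2]))
    else zero _ _)

/-- The `(k,l)`-crossing between upward labels. -/
def crossUU (q : 𝕜ˣ) (front : Bool) (k l : ℕ+) : PDiag 𝕜 [.up k, .up l] [.up l, .up k] :=
  (crossN q front k l).cast
    (by rw [upw_pnat, upw_pnat]; rfl) (by rw [upw_pnat, upw_pnat]; rfl)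

/-- Left mate: bend the strand `k` of a morphism `y ⊗ k → k ⊗ y` to get `k* ⊗ y → y ⊗ k*`. -/
def mateL (k : ℕ+) (y : Label) (X : PDiag 𝕜 [y, .up k] [.up k, y]) :
    PDiag 𝕜 [.dn k, y] [y, .dn k] :=
  ((wid [.dn k, y]).tensor (gen (.cupL k))).comp
    ((((wid [.dn k]).tensor X).tensor (wid [.dn k])).comp
      ((gen (.capL k)).tensor (wid [y, .dn k])))

/-- Right mate: bend the strand `l` of a morphism `l ⊗ x → x ⊗ l` to get `x ⊗ l* → l* ⊗ x`. -/
def mateR (x : Label) (l : ℕ+) (X : PDiag 𝕜 [.up l, x] [x, .up l]) :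
    PDiag 𝕜 [x, .dn l] [.dn l, x] :=
  ((gen (.cupR l)).tensor (wid [x, .dn l])).comp
    ((((wid [.dn l]).tensor X).tensor (wid [.dn l])).comp
      ((wid [.dn l, x]).tensor (gen (.capR l))))

/-- The mates of a crossing, for all orientations. The strand `x` runs from bottom left to top right,
the strand `y` from bottom right to top left; `x` is in front for `front = true`, and `y` is in front
for `front = false`. -/
def cross (q : 𝕜ˣ) (front : Bool) : (x y : Label) → PDiag 𝕜 [x, y] [y, x]
  | .up k, .up l => crossUU q front k l
  | .up k, .dn l => mateR (.up k) l (crossUU q (!front) l k)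
  | .dn k, .up l => mateL k (.up l) (crossUU q (!front) l k)
  | .dn k, .dn l => mateL k (.dn l) (mateL l (.up k) (crossUU q front k l))

/-- One summand of the dumbbell-crossing relation: both strands split (into `c + a` and `b + e`),
the two inner strands cross, and the strands merge again (to `c + b` and `a + e`). -/
def dumbbellTerm (q : 𝕜ˣ) (front : Bool) (c a b e : ℕ) :
    PDiag 𝕜 (upw (c + a) ++ upw (b + e)) (upw (c + b) ++ upw (a + e)) :=
  ((splitN c a).tensor (splitN b e)).comp
    (((((wid (upw c)).tensor (crossN q front a b)).tensor (wid (upw e))).cast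
        (by simp only [List.append_assoc]) (by simp only [List.append_assoc])).comp
      ((mergeN c b).tensor (mergeN a e)))

/-- The right-hand side of the dumbbell-crossing relation for `k ⊗ l → r ⊗ s`, `k + l = r + s`.
The sum runs over `a`, and `b = r + a - k`. -/
def dumbbell (q : 𝕜ˣ) (front : Bool) (k l r s : ℕ) (h : k + l = r + s) :
    PDiag 𝕜 (upw k ++ upw l) (upw r ++ upw s) :=
  sum (k + 1) fun a =>
    if ha : a ≤ k ∧ k ≤ r + a ∧ r + a - k ≤ l then
      smul ((-1) ^ (a * (r + a - k)) *
          qpow q (if front then ((k - a) * (l - (r + a - k)) : ℕ)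
            else -((k - a) * (l - (r + a - k)) : ℕ)))
        ((dumbbellTerm q front (k - a) a (r + a - k) (l - (r + a - k))).cast
          (by
            have h1 : k - a + a = k := by omega
            have h2 : r + a - k + (l - (r + a - k)) = l := by omega
            rw [h1, h2])
          (by
            have h1 : k - a + (r + a - k) = r := by omega
            have h2 : a + (l - (r + a - k)) = s := by omega
            rw [h1, h2]))
    else zero _ _

end PDiag

/-! ## The relations of the planar web category -/

section PlanarRelations

variable {𝕜 : Type u} [Field 𝕜]

open PDiag in
/-- The relations of the exterior `gl_n` web category with `v` specialized to `q`: the axioms of a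
strict monoidal `𝕜`-linear category, isotopies (zigzags, and downward trivalent vertices being both
the left and the right mates of the upward ones), circle evaluation, the exterior relation,
associativity, coassociativity, digon removal, the dumbbell-crossing relations, the braid relations,
and invertibility of the left mates of the overcrossings. -/
inductive PRel (n : ℕ) (q : 𝕜ˣ) : {K L : Word} → PDiag 𝕜 K L → PDiag 𝕜 K L → Prop
  -- congruence
  | refl {K L} (f : PDiag 𝕜 K L) : PRel n q f f
  | symm {K L} {f g : PDiag 𝕜 K L} : PRel n q f g → PRel n q g f
  | trans {K L} {f g h : PDiag 𝕜 K L} : PRel n q f g → PRel n q g h → PRel n q f h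
  | comp_congr {K L M} {f f' : PDiag 𝕜 K L} {g g' : PDiag 𝕜 L M} :
      PRel n q f f' → PRel n q g g' → PRel n q (f.comp g) (f'.comp g')
  | tensor_congr {K L K' L'} {f f' : PDiag 𝕜 K L} {g g' : PDiag 𝕜 K' L'} :
      PRel n q f f' → PRel n q g g' → PRel n q (f.tensor g) (f'.tensor g')
  | add_congr {K L} {f f' g g' : PDiag 𝕜 K L} :
      PRel n q f f' → PRel n q g g' → PRel n q (f.add g) (f'.add g')
  | smul_congr {K L} (c : 𝕜) {f f' : PDiag 𝕜 K L} :
      PRel n q f f' → PRel n q (f.smul c) (f'.smul c)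
  -- linear structure
  | add_comm {K L} (f g : PDiag 𝕜 K L) : PRel n q (f.add g) (g.add f)
  | add_assoc {K L} (f g h : PDiag 𝕜 K L) : PRel n q ((f.add g).add h) (f.add (g.add h))
  | zero_add {K L} (f : PDiag 𝕜 K L) : PRel n q ((zero K L).add f) f
  | smul_add {K L} (c : 𝕜) (f g : PDiag 𝕜 K L) :
      PRel n q ((f.add g).smul c) ((f.smul c).add (g.smul c))
  | add_smul {K L} (c e : 𝕜) (f : PDiag 𝕜 K L) :
      PRel n q (f.smul (c + e)) ((f.smul c).add (f.smul e))
  | mul_smul {K L} (c e : 𝕜) (f : PDiag 𝕜 K L) : PRel n q (f.smul (c * e)) ((f.smul e).smul c)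
  | one_smul {K L} (f : PDiag 𝕜 K L) : PRel n q (f.smul 1) f
  | zero_smul {K L} (f : PDiag 𝕜 K L) : PRel n q (f.smul 0) (zero K L)
  | comp_add {K L M} (f : PDiag 𝕜 K L) (g g' : PDiag 𝕜 L M) :
      PRel n q (f.comp (g.add g')) ((f.comp g).add (f.comp g'))
  | add_comp {K L M} (f f' : PDiag 𝕜 K L) (g : PDiag 𝕜 L M) :
      PRel n q ((f.add f').comp g) ((f.comp g).add (f'.comp g))
  | comp_smul {K L M} (c : 𝕜) (f : PDiag 𝕜 K L) (g : PDiag 𝕜 L M) :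
      PRel n q (f.comp (g.smul c)) ((f.comp g).smul c)
  | smul_comp {K L M} (c : 𝕜) (f : PDiag 𝕜 K L) (g : PDiag 𝕜 L M) :
      PRel n q ((f.smul c).comp g) ((f.comp g).smul c)
  | tensor_add {K L K' L'} (f : PDiag 𝕜 K L) (g g' : PDiag 𝕜 K' L') :
      PRel n q (f.tensor (g.add g')) ((f.tensor g).add (f.tensor g'))
  | add_tensor {K L K' L'} (f f' : PDiag 𝕜 K L) (g : PDiag 𝕜 K' L') :
      PRel n q ((f.add f').tensor g) ((f.tensor g).add (f'.tensor g))
  | tensor_smul {K L K' L'} (c : 𝕜) (f : PDiag 𝕜 K L) (g : PDiag 𝕜 K' L') :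
      PRel n q (f.tensor (g.smul c)) ((f.tensor g).smul c)
  | smul_tensor {K L K' L'} (c : 𝕜) (f : PDiag 𝕜 K L) (g : PDiag 𝕜 K' L') :
      PRel n q ((f.smul c).tensor g) ((f.tensor g).smul c)
  -- strict monoidal category
  | id_comp {K L} (f : PDiag 𝕜 K L) : PRel n q ((wid K).comp f) f
  | comp_id {K L} (f : PDiag 𝕜 K L) : PRel n q (f.comp (wid L)) f
  | assoc {K L M N} (f : PDiag 𝕜 K L) (g : PDiag 𝕜 L M) (h : PDiag 𝕜 M N) :
      PRel n q ((f.comp g).comp h) (f.comp (g.comp h))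
  | tensor_id (K L : Word) : PRel n q ((wid K).tensor (wid L)) (wid (K ++ L))
  | interchange {K L M K' L' M'} (f : PDiag 𝕜 K L) (g : PDiag 𝕜 L M)
      (f' : PDiag 𝕜 K' L') (g' : PDiag 𝕜 L' M') :
      PRel n q ((f.comp g).tensor (f'.comp g')) ((f.tensor f').comp (g.tensor g'))
  | tensor_assoc {K L K' L' K'' L''} (f : PDiag 𝕜 K L) (g : PDiag 𝕜 K' L') (h : PDiag 𝕜 K'' L'') :
      PRel n q (((f.tensor g).tensor h).cast (List.append_assoc _ _ _) (List.append_assoc _ _ _))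
        (f.tensor (g.tensor h))
  | empty_tensor {K L} (f : PDiag 𝕜 K L) : PRel n q ((wid []).tensor f) f
  | tensor_empty {K L} (f : PDiag 𝕜 K L) :
      PRel n q ((f.tensor (wid [])).cast (List.append_nil _) (List.append_nil _)) f
  -- zigzags
  | zigzag_up_left (k : ℕ+) :
      PRel n q (((gen (.cupL k)).tensor (wid [.up k])).comp ((wid [.up k]).tensor (gen (.capL k))))
        (wid [.up k])
  | zigzag_up_right (k : ℕ+) :
      PRel n q (((wid [.up k]).tensor (gen (.cupR k))).comp ((gen (.capR k)).tensor (wid [.up k])))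
        (wid [.up k])
  | zigzag_dn_left (k : ℕ+) :
      PRel n q (((wid [.dn k]).tensor (gen (.cupL k))).comp ((gen (.capL k)).tensor (wid [.dn k])))
        (wid [.dn k])
  | zigzag_dn_right (k : ℕ+) :
      PRel n q (((gen (.cupR k)).tensor (wid [.dn k])).comp ((wid [.dn k]).tensor (gen (.capR k))))
        (wid [.dn k])
  -- trivalent vertices can be rotated
  | mergeDn_left (k l : ℕ+) :
      PRel n q (gen (.mergeDn k l))
        (((wid [.dn k, .dn l]).tensor (gen (.cupL (l + k)))).comp
          ((((wid [.dn k, .dn l]).tensor (gen (.split l k))).tensor (wid [.dn (l + k)])).comp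
            ((((wid [.dn k]).tensor (gen (.capL l))).tensor (wid [.up k, .dn (l + k)])).comp
              (((gen (.capL k)).tensor (wid [.dn (l + k)])).cast rfl (by rw [_root_.add_comm l k]; rfl)))))
  | mergeDn_right (k l : ℕ+) :
      PRel n q (gen (.mergeDn k l))
        (((gen (.cupR (l + k))).tensor (wid [.dn k, .dn l])).comp
          ((((wid [.dn (l + k)]).tensor (gen (.split l k))).tensor (wid [.dn k, .dn l])).comp
            ((((wid [.dn (l + k), .up l]).tensor (gen (.capR k))).tensor (wid [.dn l])).comp
              (((wid [.dn (l + k)]).tensor (gen (.capR l))).cast rfl (by rw [_root_.add_comm l k]; rfl)))))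
  | splitDn_left (k l : ℕ+) :
      PRel n q (gen (.splitDn k l))
        ((((wid [.dn (l + k)]).tensor (gen (.cupL l))).cast (by rw [_root_.add_comm l k]; rfl) rfl).comp
          ((((wid [.dn (l + k), .up l]).tensor (gen (.cupL k))).tensor (wid [.dn l])).comp
            ((((wid [.dn (l + k)]).tensor (gen (.merge l k))).tensor (wid [.dn k, .dn l])).comp
              ((gen (.capL (l + k))).tensor (wid [.dn k, .dn l])))))
  | splitDn_right (k l : ℕ+) :
      PRel n q (gen (.splitDn k l))
        ((((gen (.cupR k)).tensor (wid [.dn (l + k)])).cast (by rw [_root_.add_comm l k]; rfl) rfl).comp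
          ((((wid [.dn k]).tensor (gen (.cupR l))).tensor (wid [.up k, .dn (l + k)])).comp
            ((((wid [.dn k, .dn l]).tensor (gen (.merge l k))).tensor (wid [.dn (l + k)])).comp
              ((wid [.dn k, .dn l]).tensor (gen (.capR (l + k)))))))
  -- circles
  | circle_right (k : ℕ+) :
      PRel n q ((gen (.cupL k)).comp (gen (.capR k))) ((wid []).smul (qbinom q n k))
  | circle_left (k : ℕ+) :
      PRel n q ((gen (.cupR k)).comp (gen (.capL k))) ((wid []).smul (qbinom q n k))
  -- exterior relation
  | exterior (k : ℕ+) (hk : n < k) : PRel n q (wid [.up k]) (zero _ _)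
  -- associativity, coassociativity, digon removal
  | merge_assoc (k l m : ℕ+) :
      PRel n q (((gen (.merge k l)).tensor (wid [.up m])).comp (gen (.merge (k + l) m)))
        ((((wid [.up k]).tensor (gen (.merge l m))).comp (gen (.merge k (l + m)))).cast rfl
          (by rw [_root_.add_assoc]))
  | split_coassoc (k l m : ℕ+) :
      PRel n q ((gen (.split (k + l) m)).comp ((gen (.split k l)).tensor (wid [.up m])))
        (((gen (.split k (l + m))).comp ((wid [.up k]).tensor (gen (.split l m)))).cast
          (by rw [_root_.add_assoc]) rfl)
  | digon (k l : ℕ+) :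
      PRel n q ((gen (.split k l)).comp (gen (.merge k l)))
        ((wid [.up (k + l)]).smul (qbinom q (k + l : ℕ+) k))
  -- dumbbell-crossing relations
  | dumbbell_cross (front : Bool) (k l r s : ℕ) (h : k + l = r + s) :
      PRel n q ((mergeN k l).comp ((splitN r s).cast (congrArg upw h.symm) rfl))
        (dumbbell q front k l r s h)
  -- braid relations
  | cross_inv (front : Bool) (k l : ℕ+) :
      PRel n q ((crossUU q front k l).comp (crossUU q (!front) l k)) (wid [.up k, .up l])
  | braid (k l m : ℕ+) :
      PRel n q
        (((crossUU q true k l).tensor (wid [.up m])).comp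
          (((wid [.up l]).tensor (crossUU q true k m)).comp
            ((crossUU q true l m).tensor (wid [.up k]))))
        (((wid [.up k]).tensor (crossUU q true l m)).comp
          (((crossUU q true k m).tensor (wid [.up l])).comp
            ((wid [.up m]).tensor (crossUU q true k l))))
  -- the left mate of the overcrossing is invertible, with the rotated undercrossing as inverse
  | mate_inv_left (k l : ℕ+) :
      PRel n q ((mateL l (.up k) (crossUU q true k l)).comp (mateR (.up k) l (crossUU q false l k)))
        (wid [.dn l, .up k])
  | mate_inv_right (k l : ℕ+) :
      PRel n q ((mateR (.up k) l (crossUU q false l k)).comp (mateL l (.up k) (crossUU q true k l)))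
        (wid [.up k, .dn l])

end PlanarRelations

/-! ## Strands passing in front of and behind words -/

namespace PDiag

variable {𝕜 : Type u} [Field 𝕜]

/-- The strand `x` runs from left to right in front of `L`. -/
def pushFront (q : 𝕜ˣ) (x : Label) : (L : Word) → PDiag 𝕜 (x :: L) (L ++ [x])
  | [] => wid [x]
  | y :: L => ((cross q true x y).tensor (wid L)).comp ((wid [y]).tensor (pushFront q x L))

/-- The strand `x` runs from left to right behind `L`. -/
def pushBack (q : 𝕜ˣ) (x : Label) : (L : Word) → PDiag 𝕜 (x :: L) (L ++ [x])
  | [] => wid [x]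
  | y :: L => ((cross q false x y).tensor (wid L)).comp ((wid [y]).tensor (pushBack q x L))

/-- The strand `x` runs from right to left in front of `L`. -/
def pullFront (q : 𝕜ˣ) (x : Label) : (L : Word) → PDiag 𝕜 (L ++ [x]) (x :: L)
  | [] => wid [x]
  | y :: L => ((wid [y]).tensor (pullFront q x L)).comp ((cross q false y x).tensor (wid L))

/-- The strand `x` runs from right to left behind `L`. -/
def pullBack (q : 𝕜ˣ) (x : Label) : (L : Word) → PDiag 𝕜 (L ++ [x]) (x :: L)
  | [] => wid [x]
  | y :: L => ((wid [y]).tensor (pullBack q x L)).comp ((cross q true y x).tensor (wid L))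

end PDiag

/-! ## Annular web diagrams -/

/-- Formal linear combinations of annular diagrams: planar diagrams and coils, composed vertically.
In `coil x K` the first strand `x` leaves the picture on the left and reenters on the right, and
`K` is shifted to the left; `coilInv x K` is its mirror image in a horizontal line. -/
inductive ADiag (𝕜 : Type u) : Word → Word → Type u
  | planar {K L : Word} (p : PDiag 𝕜 K L) : ADiag 𝕜 K L
  | coil (x : Label) (K : Word) : ADiag 𝕜 (x :: K) (K ++ [x])
  | coilInv (x : Label) (K : Word) : ADiag 𝕜 (K ++ [x]) (x :: K)
  | comp {K L M : Word} (f : ADiag 𝕜 K L) (g : ADiag 𝕜 L M) : ADiag 𝕜 K M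
  | zero (K L : Word) : ADiag 𝕜 K L
  | add {K L : Word} (f g : ADiag 𝕜 K L) : ADiag 𝕜 K L
  | smul {K L : Word} (c : 𝕜) (f : ADiag 𝕜 K L) : ADiag 𝕜 K L

namespace ADiag

variable {𝕜 : Type u}

/-- The identity diagram. -/
def wid (K : Word) : ADiag 𝕜 K K := planar (PDiag.wid K)

/-- Transport along equalities of words (strict associativity and unit). -/
def cast {K K' L L' : Word} (hK : K = K') (hL : L = L') (f : ADiag 𝕜 K L) : ADiag 𝕜 K' L' :=
  match hK, hL with
  | rfl, rfl => f

/-- The strands of `X`, from the first to the last, successively wind around the annulus. -/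
def coils : (X K : Word) → ADiag 𝕜 (X ++ K) (K ++ X)
  | [], K => (wid K).cast rfl (List.append_nil K).symm
  | x :: X, K =>
      ((coil x (X ++ K)).cast rfl (List.append_assoc X K [x])).comp
        ((coils X (K ++ [x])).cast rfl (by rw [List.append_assoc]; rfl))

variable [Field 𝕜]

/-- The annular product `f ∘ id_L`: the diagram `f` is in front of the strands of `L`. -/
def whiskerRight (q : 𝕜ˣ) (L : Word) : {K K' : Word} → ADiag 𝕜 K K' → ADiag 𝕜 (K ++ L) (K' ++ L)
  | _, _, planar p => planar (p.tensor (PDiag.wid L))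
  | _, _, coil x K =>
      ((coil x (K ++ L)).cast rfl (List.append_assoc K L [x])).comp
        (planar (((PDiag.wid K).tensor (PDiag.pullFront q x L)).cast rfl
          (List.append_assoc K [x] L).symm))
  | _, _, coilInv x K =>
      (planar (((PDiag.wid K).tensor (PDiag.pushFront q x L)).cast
          (List.append_assoc K [x] L).symm rfl)).comp
        ((coilInv x (K ++ L)).cast (List.append_assoc K L [x]) rfl)
  | _, _, comp f g => (whiskerRight q L f).comp (whiskerRight q L g)
  | _, _, zero K K' => zero (K ++ L) (K' ++ L)
  | _, _, add f g => (whiskerRight q L f).add (whiskerRight q L g)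
  | _, _, smul c f => (whiskerRight q L f).smul c

/-- The annular product `id_L ∘ f`: the strands of `L` are in front of the diagram `f`. -/
def whiskerLeft (q : 𝕜ˣ) (L : Word) : {K K' : Word} → ADiag 𝕜 K K' → ADiag 𝕜 (L ++ K) (L ++ K')
  | _, _, planar p => planar ((PDiag.wid L).tensor p)
  | _, _, coil x K =>
      (planar (((PDiag.pullBack q x L).tensor (PDiag.wid K)).cast
          (List.append_assoc L [x] K) rfl)).comp
        ((coil x (L ++ K)).cast rfl (List.append_assoc L K [x]))
  | _, _, coilInv x K =>
      ((coilInv x (L ++ K)).cast (List.append_assoc L K [x]) rfl).comp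
        (planar (((PDiag.pushBack q x L).tensor (PDiag.wid K)).cast rfl
          (List.append_assoc L [x] K)))
  | _, _, comp f g => (whiskerLeft q L f).comp (whiskerLeft q L g)
  | _, _, zero K K' => zero (L ++ K) (L ++ K')
  | _, _, add f g => (whiskerLeft q L f).add (whiskerLeft q L g)
  | _, _, smul c f => (whiskerLeft q L f).smul c

/-- The annular (skein-theoretic) product of `f` and `g`: `f` is at the bottom and in front, `g` is
on top and behind. -/
def annTensor (q : 𝕜ˣ) {K L K' L' : Word} (f : ADiag 𝕜 K L) (g : ADiag 𝕜 K' L') :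
    ADiag 𝕜 (K ++ K') (L ++ L') :=
  (whiskerRight q K' f).comp (whiskerLeft q L g)

end ADiag

/-! ## The annular web category -/

section AnnularRelations

variable {𝕜 : Type u} [Field 𝕜]

open ADiag in
/-- The relations of the annular web category: those of the planar web category, the axioms of a
`𝕜`-linear category, coils being mutually inverse, generating webs sliding around the annulus along
coils (merges, splits, caps and cups, with all orientations), and the planar isotopies which move a
web past a coil of the first strand. -/
inductive ARel (n : ℕ) (q : 𝕜ˣ) : {K L : Word} → ADiag 𝕜 K L → ADiag 𝕜 K L → Prop
  -- congruence
  | refl {K L} (f : ADiag 𝕜 K L) : ARel n q f f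
  | symm {K L} {f g : ADiag 𝕜 K L} : ARel n q f g → ARel n q g f
  | trans {K L} {f g h : ADiag 𝕜 K L} : ARel n q f g → ARel n q g h → ARel n q f h
  | comp_congr {K L M} {f f' : ADiag 𝕜 K L} {g g' : ADiag 𝕜 L M} :
      ARel n q f f' → ARel n q g g' → ARel n q (f.comp g) (f'.comp g')
  | add_congr {K L} {f f' g g' : ADiag 𝕜 K L} :
      ARel n q f f' → ARel n q g g' → ARel n q (f.add g) (f'.add g')
  | smul_congr {K L} (c : 𝕜) {f f' : ADiag 𝕜 K L} :
      ARel n q f f' → ARel n q (f.smul c) (f'.smul c)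
  -- linear structure
  | add_comm {K L} (f g : ADiag 𝕜 K L) : ARel n q (f.add g) (g.add f)
  | add_assoc {K L} (f g h : ADiag 𝕜 K L) : ARel n q ((f.add g).add h) (f.add (g.add h))
  | zero_add {K L} (f : ADiag 𝕜 K L) : ARel n q ((zero K L).add f) f
  | smul_add {K L} (c : 𝕜) (f g : ADiag 𝕜 K L) :
      ARel n q ((f.add g).smul c) ((f.smul c).add (g.smul c))
  | add_smul {K L} (c e : 𝕜) (f : ADiag 𝕜 K L) :
      ARel n q (f.smul (c + e)) ((f.smul c).add (f.smul e))
  | mul_smul {K L} (c e : 𝕜) (f : ADiag 𝕜 K L) : ARel n q (f.smul (c * e)) ((f.smul e).smul c)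
  | one_smul {K L} (f : ADiag 𝕜 K L) : ARel n q (f.smul 1) f
  | zero_smul {K L} (f : ADiag 𝕜 K L) : ARel n q (f.smul 0) (zero K L)
  | comp_add {K L M} (f : ADiag 𝕜 K L) (g g' : ADiag 𝕜 L M) :
      ARel n q (f.comp (g.add g')) ((f.comp g).add (f.comp g'))
  | add_comp {K L M} (f f' : ADiag 𝕜 K L) (g : ADiag 𝕜 L M) :
      ARel n q ((f.add f').comp g) ((f.comp g).add (f'.comp g))
  | comp_smul {K L M} (c : 𝕜) (f : ADiag 𝕜 K L) (g : ADiag 𝕜 L M) :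
      ARel n q (f.comp (g.smul c)) ((f.comp g).smul c)
  | smul_comp {K L M} (c : 𝕜) (f : ADiag 𝕜 K L) (g : ADiag 𝕜 L M) :
      ARel n q ((f.smul c).comp g) ((f.comp g).smul c)
  -- category
  | id_comp {K L} (f : ADiag 𝕜 K L) : ARel n q ((wid K).comp f) f
  | comp_id {K L} (f : ADiag 𝕜 K L) : ARel n q (f.comp (wid L)) f
  | assoc {K L M N} (f : ADiag 𝕜 K L) (g : ADiag 𝕜 L M) (h : ADiag 𝕜 M N) :
      ARel n q ((f.comp g).comp h) (f.comp (g.comp h))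
  -- planar webs
  | planar_rel {K L} {f g : PDiag 𝕜 K L} : PRel n q f g → ARel n q (planar f) (planar g)
  | planar_comp {K L M} (f : PDiag 𝕜 K L) (g : PDiag 𝕜 L M) :
      ARel n q (planar (f.comp g)) ((planar f).comp (planar g))
  | planar_add {K L} (f g : PDiag 𝕜 K L) :
      ARel n q (planar (f.add g)) ((planar f).add (planar g))
  | planar_smul {K L} (c : 𝕜) (f : PDiag 𝕜 K L) :
      ARel n q (planar (f.smul c)) ((planar f).smul c)
  -- coils are mutually inverse
  | coil_coilInv (x : Label) (K : Word) :
      ARel n q ((coil x K).comp (coilInv x K)) (wid (x :: K))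
  | coilInv_coil (x : Label) (K : Word) :
      ARel n q ((coilInv x K).comp (coil x K)) (wid (K ++ [x]))
  -- generating webs slide around the annulus
  | slide {X Y : Word} (g : PGen X Y) (K : Word) :
      ARel n q ((planar ((PDiag.gen g).tensor (PDiag.wid K))).comp (coils Y K))
        ((coils X K).comp (planar ((PDiag.wid K).tensor (PDiag.gen g))))
  -- planar isotopy past a coil
  | far (x : Label) {K L : Word} (p : PDiag 𝕜 K L) :
      ARel n q ((planar ((PDiag.wid [x]).tensor p)).comp (coil x L))
        ((coil x K).comp (planar (p.tensor (PDiag.wid [x]))))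

/-- The setoid of annular diagrams from `K` to `L` modulo the relations. -/
def ASetoid (n : ℕ) (q : 𝕜ˣ) (K L : Word) : Setoid (ADiag 𝕜 K L) where
  r := ARel n q
  iseqv := ⟨ARel.refl, ARel.symm, ARel.trans⟩

/-- The morphisms of the annular web category. -/
def AHom (n : ℕ) (q : 𝕜ˣ) (K L : Word) : Type u := Quotient (ASetoid n q K L)

namespace AHom

variable {n : ℕ} {q : 𝕜ˣ}

/-- The class of a diagram. -/
def mk (n : ℕ) (q : 𝕜ˣ) {K L : Word} (f : ADiag 𝕜 K L) : AHom n q K L := Quotient.mk _ f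

theorem sound {K L : Word} {f g : ADiag 𝕜 K L} (h : ARel n q f g) : mk n q f = mk n q g :=
  Quotient.sound h

/-- Vertical composition (`f` first, then `g`). -/
def comp {K L M : Word} (f : AHom n q K L) (g : AHom n q L M) : AHom n q K M :=
  Quotient.map₂ ADiag.comp (fun _ _ h _ _ h' => ARel.comp_congr h h') f g

instance (K L : Word) : Add (AHom n q K L) :=
  ⟨Quotient.map₂ ADiag.add (fun _ _ h _ _ h' => ARel.add_congr h h')⟩

instance (K L : Word) : SMul 𝕜 (AHom n q K L) :=
  ⟨fun c => Quotient.map (ADiag.smul c) (fun _ _ h => ARel.smul_congr c h)⟩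

instance (K L : Word) : Zero (AHom n q K L) := ⟨mk n q (ADiag.zero K L)⟩

instance (K L : Word) : Neg (AHom n q K L) := ⟨fun f => (-1 : 𝕜) • f⟩

theorem mk_comp {K L M : Word} (f : ADiag 𝕜 K L) (g : ADiag 𝕜 L M) :
    mk n q (f.comp g) = comp (mk n q f) (mk n q g) := rfl

theorem mk_add {K L : Word} (f g : ADiag 𝕜 K L) : mk n q (f.add g) = mk n q f + mk n q g := rfl

theorem mk_smul {K L : Word} (c : 𝕜) (f : ADiag 𝕜 K L) :
    mk n q (f.smul c) = c • mk n q f := rfl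

theorem zero_add' {K L : Word} (f : AHom n q K L) : 0 + f = f := by
  induction f using Quotient.inductionOn
  exact sound (ARel.zero_add _)

theorem add_comm' {K L : Word} (f g : AHom n q K L) : f + g = g + f := by
  induction f, g using Quotient.inductionOn₂
  exact sound (ARel.add_comm _ _)

theorem zero_smul' {K L : Word} (f : AHom n q K L) : (0 : 𝕜) • f = 0 := by
  induction f using Quotient.inductionOn
  exact sound (ARel.zero_smul _)

theorem one_smul' {K L : Word} (f : AHom n q K L) : (1 : 𝕜) • f = f := by
  induction f using Quotient.inductionOn
  exact sound (ARel.one_smul _)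

theorem add_smul' {K L : Word} (c e : 𝕜) (f : AHom n q K L) : (c + e) • f = c • f + e • f := by
  induction f using Quotient.inductionOn
  exact sound (ARel.add_smul _ _ _)

theorem mul_smul' {K L : Word} (c e : 𝕜) (f : AHom n q K L) : (c * e) • f = c • e • f := by
  induction f using Quotient.inductionOn
  exact sound (ARel.mul_smul _ _ _)

instance (K L : Word) : AddCommGroup (AHom n q K L) where
  add_assoc f g h := by
    induction f, g, h using Quotient.inductionOn₃
    exact sound (ARel.add_assoc _ _ _)
  zero_add := zero_add'
  add_zero f := by rw [add_comm', zero_add']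
  add_comm := add_comm'
  nsmul := nsmulRec
  zsmul := zsmulRec
  neg_add_cancel f := by
    change (-1 : 𝕜) • f + f = 0
    conv_lhs => rw [← one_smul' f, ← mul_smul', ← add_smul']
    simp [zero_smul']

instance (K L : Word) : Module 𝕜 (AHom n q K L) where
  one_smul := one_smul'
  mul_smul := mul_smul'
  smul_zero c := by
    rw [← zero_smul' (0 : AHom n q K L), ← mul_smul', mul_zero]
  smul_add c f g := by
    induction f, g using Quotient.inductionOn₂
    exact sound (ARel.smul_add _ _ _)
  add_smul := add_smul'
  zero_smul := zero_smul'

end AHom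

/-- The annular web category: objects are words in the labels. -/
structure AWeb (n : ℕ) (q : 𝕜ˣ) where
  /-- the underlying word -/
  word : Word

variable {n : ℕ} {q : 𝕜ˣ}

instance : Category.{u} (AWeb n q) where
  Hom X Y := AHom n q X.word Y.word
  id X := AHom.mk n q (ADiag.wid X.word)
  comp f g := AHom.comp f g
  id_comp f := by
    induction f using Quotient.inductionOn
    exact AHom.sound (ARel.id_comp _)
  comp_id f := by
    induction f using Quotient.inductionOn
    exact AHom.sound (ARel.comp_id _)
  assoc f g h := by
    induction f, g, h using Quotient.inductionOn₃
    exact AHom.sound (ARel.assoc _ _ _)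

instance : Preadditive (AWeb n q) where
  homGroup X Y := inferInstanceAs (AddCommGroup (AHom n q X.word Y.word))
  add_comp _ _ _ f f' g := by
    induction f, f', g using Quotient.inductionOn₃
    exact AHom.sound (ARel.add_comp _ _ _)
  comp_add _ _ _ f g g' := by
    induction f, g, g' using Quotient.inductionOn₃
    exact AHom.sound (ARel.comp_add _ _ _)

instance : Linear 𝕜 (AWeb n q) where
  homModule X Y := inferInstanceAs (Module 𝕜 (AHom n q X.word Y.word))
  smul_comp _ _ _ c f g := by
    induction f, g using Quotient.inductionOn₂
    exact AHom.sound (ARel.smul_comp _ _ _)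
  comp_smul _ _ _ f c g := by
    induction f, g using Quotient.inductionOn₂
    exact AHom.sound (ARel.comp_smul _ _ _)

/-- The morphism of the annular web category represented by a diagram. -/
def AWeb.of (n : ℕ) (q : 𝕜ˣ) {K L : Word} (f : ADiag 𝕜 K L) :
    (AWeb.mk K : AWeb n q) ⟶ (AWeb.mk L : AWeb n q) :=
  AHom.mk n q f

end AnnularRelations

/-! ## Quantum exterior powers

`l : Fin d → ℕ` are the block sizes of the Levi subalgebra `gl_(l 0) ⊕ ... ⊕ gl_(l (d-1))` of `gl_n`,
where `n = ∑ i, l i`. The `k`th quantum exterior power of the vector representation is the vector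
space with basis `v_S`, where `S` runs over the `k`-element subsets of the index set; the dual space
has the dual basis. Linear maps are written as matrices in these bases. -/

/-- The indices `(i, j)` of the basis vectors `v_(i,j)` of the vector representation, in
lexicographic order. -/
abbrev Idx {d : ℕ} (l : Fin d → ℕ) : Type := Σₗ i : Fin d, Fin (l i)

section Basis

variable {d : ℕ} {l : Fin d → ℕ}

/-- The index `(i, j)`. -/
def Idx.mk (i : Fin d) (j : Fin (l i)) : Idx l := toLex ⟨i, j⟩

/-- The block `i` of an index `(i, j)`. -/
def Idx.block (a : Idx l) : Fin d := (ofLex a).1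

/-- The standard basis of the tensor product of exterior powers (and duals) attached to a word. -/
def BasisIdx (l : Fin d → ℕ) : Word → Type
  | [] => PUnit
  | x :: K => {S : Finset (Idx l) // S.card = x.thick} × BasisIdx l K

instance instFintypeBasisIdx : (K : Word) → Fintype (BasisIdx l K)
  | [] => inferInstanceAs (Fintype PUnit)
  | x :: K =>
    letI := instFintypeBasisIdx K
    inferInstanceAs (Fintype ({S : Finset (Idx l) // S.card = x.thick} × BasisIdx l K))

instance instDecidableEqBasisIdx : (K : Word) → DecidableEq (BasisIdx l K)
  | [] => inferInstanceAs (DecidableEq PUnit)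
  | x :: K =>
    letI := instDecidableEqBasisIdx K
    inferInstanceAs (DecidableEq ({S : Finset (Idx l) // S.card = x.thick} × BasisIdx l K))

/-- The first part of a basis element of a tensor product. -/
def BasisIdx.fst : (K : Word) → {L : Word} → BasisIdx l (K ++ L) → BasisIdx l K
  | [], _, _ => PUnit.unit
  | _ :: K, _, s => (s.1, BasisIdx.fst K s.2)

/-- The second part of a basis element of a tensor product. -/
def BasisIdx.snd : (K : Word) → {L : Word} → BasisIdx l (K ++ L) → BasisIdx l L
  | [], _, s => s
  | _ :: K, _, s => BasisIdx.snd K s.2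

/-- Basis elements of a tensor product are pairs of basis elements. -/
def BasisIdx.splitEquiv : (K L : Word) → BasisIdx l (K ++ L) ≃ BasisIdx l K × BasisIdx l L
  | [], _ => (Equiv.punitProd _).symm
  | _ :: K, L => (Equiv.prodCongr (Equiv.refl _) (splitEquiv K L)).trans (Equiv.prodAssoc _ _ _).symm

theorem BasisIdx.splitEquiv_apply : (K L : Word) → (s : BasisIdx l (K ++ L)) →
    BasisIdx.splitEquiv K L s = (BasisIdx.fst K s, BasisIdx.snd K s)
  | [], _, _ => rfl
  | _ :: K, L, s => by
    change (((s.1, (splitEquiv K L s.2).1), (splitEquiv K L s.2).2) : _ × _) = _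
    rw [splitEquiv_apply K L s.2]
    rfl

/-- The element of a one-element subset. -/
noncomputable def elt (S : {S : Finset (Idx l) // S.card = 1}) : Idx l :=
  (Finset.card_eq_one.mp S.2).choose

theorem elt_spec (S : {S : Finset (Idx l) // S.card = 1}) : S.1 = {elt S} :=
  (Finset.card_eq_one.mp S.2).choose_spec

/-- The number `|S < T|` of pairs `(s, t)` in `S × T` with `s < t`. -/
def ltCount (S T : Finset (Idx l)) : ℕ := ((S ×ˢ T).filter fun p => p.1 < p.2).card

/-- The number `|S < N| - |N < S|`, where `N` is the set of all indices. -/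
def pivExp (S : Finset (Idx l)) : ℤ := (ltCount S Finset.univ : ℤ) - ltCount Finset.univ S

end Basis

section Maps

variable {d : ℕ} {l : Fin d → ℕ} {𝕜 : Type u} [Field 𝕜]

/-- Linear maps between the spaces attached to two words, in the standard bases. -/
abbrev Mat (l : Fin d → ℕ) (𝕜 : Type u) (K L : Word) : Type u :=
  Matrix (BasisIdx l L) (BasisIdx l K) 𝕜

/-- The identity map. -/
abbrev idMat (l : Fin d → ℕ) (𝕜 : Type u) [Field 𝕜] (K : Word) : Mat l 𝕜 K K := 1

/-- The tensor product of linear maps. -/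
def tensorMat {K L K' L' : Word} (M : Mat l 𝕜 K L) (N : Mat l 𝕜 K' L') :
    Mat l 𝕜 (K ++ K') (L ++ L') :=
  Matrix.of fun t s => M (BasisIdx.fst L t) (BasisIdx.fst K s) *
    N (BasisIdx.snd L t) (BasisIdx.snd K s)

/-- The coefficient of `v_U` in the product of `v_S` and `v_T` in the quantum exterior algebra. -/
def mergeCoeff (q : 𝕜ˣ) (S T U : Finset (Idx l)) : 𝕜 :=
  if Disjoint S T ∧ U = S ∪ T then qpow (-q) (-(ltCount T S : ℤ)) else 0

/-- The coefficient of `v_S ⊗ v_T` in the image of `v_U` under the split. -/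
def splitCoeff (q : 𝕜ˣ) (S T U : Finset (Idx l)) : 𝕜 :=
  if Disjoint S T ∧ U = S ∪ T then (-1) ^ (S.card * T.card) * qpow (-q) (ltCount S T) else 0

/-- The linear maps attached to the generating webs. The maps for the downward merges and splits
are the transposes (mates) of those for the upward splits and merges. -/
def evalGen (l : Fin d → ℕ) (q : 𝕜ˣ) : {K L : Word} → PGen K L → Mat l 𝕜 K L
  | _, _, .merge _ _ => Matrix.of fun t s => mergeCoeff q s.1.1 s.2.1.1 t.1.1
  | _, _, .split _ _ => Matrix.of fun t s => splitCoeff q t.1.1 t.2.1.1 s.1.1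
  | _, _, .mergeDn _ _ => Matrix.of fun t s => splitCoeff q s.2.1.1 s.1.1 t.1.1
  | _, _, .splitDn _ _ => Matrix.of fun t s => mergeCoeff q t.2.1.1 t.1.1 s.1.1
  | _, _, .capL _ => Matrix.of fun _ s => if s.1.1 = s.2.1.1 then 1 else 0
  | _, _, .capR _ => Matrix.of fun _ s => if s.1.1 = s.2.1.1 then qpow q (pivExp s.1.1) else 0
  | _, _, .cupL _ => Matrix.of fun t _ => if t.1.1 = t.2.1.1 then 1 else 0
  | _, _, .cupR _ => Matrix.of fun t _ => if t.1.1 = t.2.1.1 then qpow q (-pivExp t.1.1) else 0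

/-- The linear map attached to a planar diagram. -/
def evalP (l : Fin d → ℕ) (q : 𝕜ˣ) : {K L : Word} → PDiag 𝕜 K L → Mat l 𝕜 K L
  | _, _, .wid K => idMat l 𝕜 K
  | _, _, .comp f g => evalP l q g * evalP l q f
  | _, _, .tensor f g => tensorMat (evalP l q f) (evalP l q g)
  | _, _, .gen g => evalGen l q g
  | _, _, .zero _ _ => 0
  | _, _, .add f g => evalP l q f + evalP l q g
  | _, _, .smul c f => c • evalP l q f

/-! ## Levi crossings and coil maps -/

/-- Composition of linear maps (`f` first, then `g`). -/
def compMat (K L M : Word) (f : Mat l 𝕜 K L) (g : Mat l 𝕜 L M) : Mat l 𝕜 K M := g * f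

/-- The word consisting of `m` upward strands of thickness `1`. -/
abbrev ones (m : ℕ) : Word := List.replicate m (Label.up 1)

/-- Full explosion of an upward strand of thickness `k`. -/
def explode (𝕜 : Type u) : (k : ℕ) → PDiag 𝕜 (upw k) (ones k)
  | 0 => (PDiag.wid []).cast (upw_not_pos (by omega)).symm rfl
  | k + 1 => ((PDiag.splitN 1 k).cast (congrArg upw (Nat.add_comm 1 k)) rfl).comp
      (((PDiag.wid (upw 1)).tensor (explode 𝕜 k)).cast rfl (by rw [upw_pos Nat.one_pos]; rfl))

/-- The full merge of `k` upward strands of thickness `1`. -/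
def implode (𝕜 : Type u) : (k : ℕ) → PDiag 𝕜 (ones k) (upw k)
  | 0 => (PDiag.wid []).cast rfl (upw_not_pos (by omega)).symm
  | k + 1 => (((PDiag.wid (upw 1)).tensor (implode 𝕜 k)).cast
        (by rw [upw_pos Nat.one_pos]; rfl) rfl).comp
      ((PDiag.mergeN 1 k).cast rfl (congrArg upw (Nat.add_comm 1 k)))

/-- The coefficient of `v_c ⊗ v_e` in the image of `v_a ⊗ v_b` under the Levi `(1,1)`-overcrossing
(`pos = true`) or its inverse (`pos = false`): the braiding of `gl_(l i)` inside the block `i`, and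
the swap for different blocks. -/
def leviCoeff (q : 𝕜ˣ) (pos : Bool) (a b c e : Idx l) : 𝕜 :=
  if a.block = b.block then
    if a = b then
      if c = a ∧ e = a then qpow q (if pos then 1 else -1) else 0
    else
      (if c = b ∧ e = a then 1 else 0) +
      (if c = a ∧ e = b then
        (if pos then (if b < a then qpow q 1 - qpow q (-1) else 0)
          else (if a < b then qpow q (-1) - qpow q 1 else 0))
       else 0)
  else if c = b ∧ e = a then 1 else 0

/-- The Levi `(1,1)`-crossings. -/
noncomputable def leviThin (l : Fin d → ℕ) (q : 𝕜ˣ) (pos : Bool) :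
    Mat l 𝕜 [.up 1, .up 1] [.up 1, .up 1] :=
  Matrix.of fun t s => leviCoeff q pos (elt s.1) (elt s.2.1) (elt t.1) (elt t.2.1)

/-- The Levi overcrossing of one thin strand with `m` thin strands. -/
noncomputable def thinPast (l : Fin d → ℕ) (q : 𝕜ˣ) :
    (m : ℕ) → Mat l 𝕜 (.up 1 :: ones m) (ones m ++ [.up 1])
  | 0 => idMat l 𝕜 [.up 1]
  | m + 1 =>
    compMat (.up 1 :: .up 1 :: ones m) (.up 1 :: .up 1 :: ones m) (.up 1 :: (ones m ++ [Label.up 1]))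
      (tensorMat (leviThin l q true) (idMat l 𝕜 (ones m)))
      (tensorMat (idMat l 𝕜 [.up 1]) (thinPast l q m))

/-- The inverse of the Levi overcrossing of one thin strand with `m` thin strands. -/
noncomputable def thinBack (l : Fin d → ℕ) (q : 𝕜ˣ) :
    (m : ℕ) → Mat l 𝕜 (ones m ++ [.up 1]) (.up 1 :: ones m)
  | 0 => idMat l 𝕜 [.up 1]
  | m + 1 =>
    compMat (.up 1 :: (ones m ++ [Label.up 1])) (.up 1 :: .up 1 :: ones m) (.up 1 :: .up 1 :: ones m)
      (tensorMat (idMat l 𝕜 [.up 1]) (thinBack l q m))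
      (tensorMat (leviThin l q false) (idMat l 𝕜 (ones m)))

/-- The Levi `(1,k)`-overcrossing: explode the strand `k`, cross, and merge again. -/
noncomputable def leviUp (l : Fin d → ℕ) (q : 𝕜ˣ) (k : ℕ+) :
    Mat l 𝕜 [.up 1, .up k] [.up k, .up 1] :=
  (qfac q k)⁻¹ •
    compMat [.up 1, .up k] (.up 1 :: ones k) [.up k, .up 1]
      (tensorMat (idMat l 𝕜 [.up 1]) (evalP l q ((explode 𝕜 k).cast (upw_pnat k) rfl)))
      (compMat (.up 1 :: ones k) (ones k ++ [.up 1]) [.up k, .up 1]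
        (thinPast l q k)
        (tensorMat (evalP l q ((implode 𝕜 k).cast rfl (upw_pnat k))) (idMat l 𝕜 [.up 1])))

/-- The inverse of the Levi `(1,k)`-overcrossing. -/
noncomputable def leviUpInv (l : Fin d → ℕ) (q : 𝕜ˣ) (k : ℕ+) :
    Mat l 𝕜 [.up k, .up 1] [.up 1, .up k] :=
  (qfac q k)⁻¹ •
    compMat [.up k, .up 1] (ones k ++ [.up 1]) [.up 1, .up k]
      (tensorMat (evalP l q ((explode 𝕜 k).cast (upw_pnat k) rfl)) (idMat l 𝕜 [.up 1]))
      (compMat (ones k ++ [.up 1]) (.up 1 :: ones k) [.up 1, .up k]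
        (thinBack l q k)
        (tensorMat (idMat l 𝕜 [.up 1]) (evalP l q ((implode 𝕜 k).cast rfl (upw_pnat k)))))

/-- The Levi crossing of an upward thin strand in front of a downward strand of thickness `k`: a
mate of the inverse of the Levi `(1,k)`-overcrossing. -/
noncomputable def leviDn (l : Fin d → ℕ) (q : 𝕜ˣ) (k : ℕ+) :
    Mat l 𝕜 [.up 1, .dn k] [.dn k, .up 1] :=
  compMat [.up 1, .dn k] [.dn k, .up k, .up 1, .dn k] [.dn k, .up 1]
    (tensorMat (evalGen l q (.cupR k)) (idMat l 𝕜 [.up 1, .dn k]))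
    (compMat [.dn k, .up k, .up 1, .dn k] [.dn k, .up 1, .up k, .dn k] [.dn k, .up 1]
      (tensorMat (tensorMat (idMat l 𝕜 [.dn k]) (leviUpInv l q k)) (idMat l 𝕜 [.dn k]))
      (tensorMat (idMat l 𝕜 [.dn k, .up 1]) (evalGen l q (.capR k))))

/-- The inverse of the previous crossing: a mate of the Levi `(1,k)`-overcrossing. -/
noncomputable def leviDnInv (l : Fin d → ℕ) (q : 𝕜ˣ) (k : ℕ+) :
    Mat l 𝕜 [.dn k, .up 1] [.up 1, .dn k] :=
  compMat [.dn k, .up 1] [.dn k, .up 1, .up k, .dn k] [.up 1, .dn k]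
    (tensorMat (idMat l 𝕜 [.dn k, .up 1]) (evalGen l q (.cupL k)))
    (compMat [.dn k, .up 1, .up k, .dn k] [.dn k, .up k, .up 1, .dn k] [.up 1, .dn k]
      (tensorMat (tensorMat (idMat l 𝕜 [.dn k]) (leviUp l q k)) (idMat l 𝕜 [.dn k]))
      (tensorMat (evalGen l q (.capL k)) (idMat l 𝕜 [.up 1, .dn k])))

/-- The Levi crossing of an upward thin strand in front of a strand `y`. -/
noncomputable def leviCross (l : Fin d → ℕ) (q : 𝕜ˣ) :
    (y : Label) → Mat l 𝕜 [.up 1, y] [y, .up 1]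
  | .up k => leviUp l q k
  | .dn k => leviDn l q k

/-- The inverse of the Levi crossing of an upward thin strand in front of a strand `y`. -/
noncomputable def leviCrossInv (l : Fin d → ℕ) (q : 𝕜ˣ) :
    (y : Label) → Mat l 𝕜 [y, .up 1] [.up 1, y]
  | .up k => leviUpInv l q k
  | .dn k => leviDnInv l q k

/-- The Levi crossing of an upward thin strand in front of a word. -/
noncomputable def leviPast (l : Fin d → ℕ) (q : 𝕜ˣ) :
    (K : Word) → Mat l 𝕜 (.up 1 :: K) (K ++ [.up 1])
  | [] => idMat l 𝕜 [.up 1]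
  | y :: K =>
    compMat (.up 1 :: y :: K) (y :: .up 1 :: K) (y :: (K ++ [Label.up 1]))
      (tensorMat (leviCross l q y) (idMat l 𝕜 K))
      (tensorMat (idMat l 𝕜 [y]) (leviPast l q K))

/-- The inverse of the Levi crossing of an upward thin strand in front of a word. -/
noncomputable def leviBack (l : Fin d → ℕ) (q : 𝕜ˣ) :
    (K : Word) → Mat l 𝕜 (K ++ [.up 1]) (.up 1 :: K)
  | [] => idMat l 𝕜 [.up 1]
  | y :: K =>
    compMat (y :: (K ++ [Label.up 1])) (y :: .up 1 :: K) (.up 1 :: y :: K)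
      (tensorMat (idMat l 𝕜 [y]) (leviBack l q K))
      (tensorMat (leviCrossInv l q y) (idMat l 𝕜 K))

/-- Multiplication of `v_(i,j)` by `u i`. -/
noncomputable def blockScale (u : Fin d → 𝕜ˣ) : Mat l 𝕜 [.up 1] [.up 1] :=
  Matrix.diagonal fun s => (u (elt s.1).block : 𝕜)

/-- The coil map `v_(i,j) ⊗ w ↦ u i • levi crossing (v_(i,j) ⊗ w)`. -/
noncomputable def coilMap (l : Fin d → ℕ) (q : 𝕜ˣ) (u : Fin d → 𝕜ˣ) (K : Word) :
    Mat l 𝕜 (.up 1 :: K) (K ++ [.up 1]) :=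
  compMat (.up 1 :: K) (.up 1 :: K) (K ++ [.up 1])
    (tensorMat (blockScale u) (idMat l 𝕜 K)) (leviPast l q K)

/-- The inverse coil map: the inverse Levi crossing, followed by the multiplication of
`v_(i,j) ⊗ w` by the inverse of `u i`. -/
noncomputable def coilInvMap (l : Fin d → ℕ) (q : 𝕜ˣ) (u : Fin d → 𝕜ˣ) (K : Word) :
    Mat l 𝕜 (K ++ [.up 1]) (.up 1 :: K) :=
  compMat (K ++ [.up 1]) (.up 1 :: K) (.up 1 :: K)
    (leviBack l q K) (tensorMat (blockScale u⁻¹) (idMat l 𝕜 K))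

end Maps

/-! ## The action of the quantum group of the Levi subalgebra -/

section Action

variable {d : ℕ} {l : Fin d → ℕ} {𝕜 : Type u} [Field 𝕜]

/-- The weight of a basis element with respect to `L_a`. -/
def wt (a : Idx l) : (K : Word) → BasisIdx l K → ℤ
  | [], _ => 0
  | .up _ :: K, s => (if a ∈ s.1.1 then 1 else 0) + wt a K s.2
  | .dn _ :: K, s => -(if a ∈ s.1.1 then 1 else 0) + wt a K s.2

/-- The coefficient of `v_T` in `X v_S` where `X` sends `v_b` to `v_a` for neighbors `a`, `b` and
kills the other basis vectors of the vector representation. -/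
def moveCoeff (𝕜 : Type u) [Field 𝕜] (a b : Idx l) (T S : Finset (Idx l)) : 𝕜 :=
  if b ∈ S ∧ a ∉ S ∧ T = insert a (S.erase b) then 1 else 0

/-- The action of `E` (with `E v_b = v_a`) on one tensor factor; on a dual space it is the transpose
of the action of the antipode `S(E) = - E (L_a L_b⁻¹)⁻¹`. -/
def letterE (q : 𝕜ˣ) (a b : Idx l) : (x : Label) → Mat l 𝕜 [x] [x]
  | .up _ => Matrix.of fun t s => moveCoeff 𝕜 a b t.1.1 s.1.1
  | .dn k => Matrix.of fun t s =>
      -(moveCoeff 𝕜 a b s.1.1 t.1.1 * qpow q (-(wt a [.up k] t - wt b [.up k] t)))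

/-- The action of `F` (with `F v_a = v_b`) on one tensor factor; on a dual space it is the transpose
of the action of the antipode `S(F) = - (L_a L_b⁻¹) F`. -/
def letterF (q : 𝕜ˣ) (a b : Idx l) : (x : Label) → Mat l 𝕜 [x] [x]
  | .up _ => Matrix.of fun t s => moveCoeff 𝕜 b a t.1.1 s.1.1
  | .dn k => Matrix.of fun t s =>
      -(qpow q (wt a [.up k] s - wt b [.up k] s) * moveCoeff 𝕜 b a s.1.1 t.1.1)

/-- The action of `E` on tensor products, through `Δ(E) = E ⊗ L_a L_b⁻¹ + 1 ⊗ E`. -/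
def actE (q : 𝕜ˣ) (a b : Idx l) : (K : Word) → Mat l 𝕜 K K
  | [] => 0
  | x :: K =>
    (tensorMat (letterE q a b x) (Matrix.diagonal fun s => qpow q (wt a K s - wt b K s)) +
      tensorMat (idMat l 𝕜 [x]) (actE q a b K) : Mat l 𝕜 ([x] ++ K) ([x] ++ K))

/-- The action of `F` on tensor products, through `Δ(F) = F ⊗ 1 + L_a⁻¹ L_b ⊗ F`. -/
def actF (q : 𝕜ˣ) (a b : Idx l) : (K : Word) → Mat l 𝕜 K K
  | [] => 0
  | x :: K =>
    (tensorMat (letterF q a b x) (idMat l 𝕜 K) +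
      tensorMat (Matrix.diagonal fun s => qpow q (-(wt a [x] s - wt b [x] s))) (actF q a b K) :
      Mat l 𝕜 ([x] ++ K) ([x] ++ K))

/-- Generators of the quantum group of the Levi subalgebra: the group-like `L_a`, the elements
`H_a = (L_a - L_a⁻¹)/(q - q⁻¹)` of the divided power form, and `E_(i,j)`, `F_(i,j)`. (For `q = 1` the
elements `L_a` act by `1` on representations of type `1`, and the torus acts through `H_a`.) -/
inductive LeviGen (l : Fin d → ℕ) : Type
  | L (a : Idx l) : LeviGen l
  | H (a : Idx l) : LeviGen l
  | E (i : Fin d) (j : ℕ) (h : j + 1 < l i) : LeviGen l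
  | F (i : Fin d) (j : ℕ) (h : j + 1 < l i) : LeviGen l

/-- The action of the generators on the representation attached to a word. -/
def act (q : 𝕜ˣ) (g : LeviGen l) (K : Word) : Mat l 𝕜 K K :=
  match g with
  | .L a => Matrix.diagonal fun s => qpow q (wt a K s)
  | .H a => Matrix.diagonal fun s => qintZ q (wt a K s)
  | .E i j h => actE q (Idx.mk i ⟨j, by omega⟩) (Idx.mk i ⟨j + 1, h⟩) K
  | .F i j h => actF q (Idx.mk i ⟨j, by omega⟩) (Idx.mk i ⟨j + 1, h⟩) K

/-- The equivariant linear maps between the representations attached to two words. -/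
def FundHom (l : Fin d → ℕ) (q : 𝕜ˣ) (K L : Word) : Submodule 𝕜 (Mat l 𝕜 K L) where
  carrier := {M | ∀ g : LeviGen l, M * act q g K = act q g L * M}
  add_mem' hM hN g := by
    rw [Matrix.add_mul, Matrix.mul_add, hM g, hN g]
  zero_mem' g := by simp
  smul_mem' c M hM g := by
    rw [Matrix.smul_mul, Matrix.mul_smul, hM g]

/-- The fundamental category: the full subcategory of the representations of the quantum group of
the Levi subalgebra on tensor products of exterior powers of the vector representation and their
duals. -/
structure Fund (l : Fin d → ℕ) (q : 𝕜ˣ) where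
  /-- the underlying word -/
  word : Word

variable {q : 𝕜ˣ}

instance : Category.{u} (Fund l q) where
  Hom X Y := FundHom l q X.word Y.word
  id X := ⟨1, fun g => by simp⟩
  comp {X Y Z} f g := ⟨g.1 * f.1, fun a => by
    rw [Matrix.mul_assoc, f.2 a, ← Matrix.mul_assoc, g.2 a, Matrix.mul_assoc]⟩
  id_comp f := Subtype.ext (Matrix.mul_one _)
  comp_id f := Subtype.ext (Matrix.one_mul _)
  assoc f g h := Subtype.ext (Matrix.mul_assoc _ _ _).symm

instance : Preadditive (Fund l q) where
  homGroup X Y := inferInstanceAs (AddCommGroup (FundHom l q X.word Y.word))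
  add_comp _ _ _ _ _ _ := Subtype.ext (Matrix.mul_add _ _ _)
  comp_add _ _ _ _ _ _ := Subtype.ext (Matrix.add_mul _ _ _)

instance : Linear 𝕜 (Fund l q) where
  homModule X Y := inferInstanceAs (Module 𝕜 (FundHom l q X.word Y.word))
  smul_comp _ _ _ _ _ _ := Subtype.ext (Matrix.mul_smul _ _ _)
  comp_smul _ _ _ _ _ _ := Subtype.ext (Matrix.smul_mul _ _ _)

/-- The linear map underlying a morphism of the fundamental category. -/
def Fund.mat {X Y : Fund l q} (f : X ⟶ Y) : Mat l 𝕜 X.word Y.word := Subtype.val f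

end Action

/-! ## Duality -/

section Duality

namespace PDiag

variable (𝕜 : Type u)

/-- The left evaluation of a letter. -/
def evL : (x : Label) → PDiag 𝕜 [x.star, x] []
  | .up k => gen (.capL k)
  | .dn k => gen (.capR k)

/-- The right evaluation of a letter. -/
def evR : (x : Label) → PDiag 𝕜 [x, x.star] []
  | .up k => gen (.capR k)
  | .dn k => gen (.capL k)

/-- The left coevaluation of a letter. -/
def coevL : (x : Label) → PDiag 𝕜 [] [x, x.star]
  | .up k => gen (.cupL k)
  | .dn k => gen (.cupR k)

/-- The right coevaluation of a letter. -/
def coevR : (x : Label) → PDiag 𝕜 [] [x.star, x]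
  | .up k => gen (.cupR k)
  | .dn k => gen (.cupL k)

/-- The left evaluation of a word: nested caps. -/
def leftEv : (K : Word) → PDiag 𝕜 (Word.dual K ++ K) []
  | [] => wid []
  | x :: K =>
    (((wid (Word.dual K)).tensor ((evL 𝕜 x).tensor (wid K))).cast
      (List.append_assoc (Word.dual K) [x.star] (x :: K)).symm rfl).comp (leftEv K)

/-- The right evaluation of a word: nested caps. -/
def rightEv : (K : Word) → PDiag 𝕜 (K ++ Word.dual K) []
  | [] => wid []
  | x :: K =>
    (((wid [x]).tensor ((rightEv K).tensor (wid [x.star]))).cast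
      (congrArg (x :: ·) (List.append_assoc K (Word.dual K) [x.star])) rfl).comp (evR 𝕜 x)

/-- The left coevaluation of a word: nested cups. -/
def leftCoev : (K : Word) → PDiag 𝕜 [] (K ++ Word.dual K)
  | [] => wid []
  | x :: K =>
    (coevL 𝕜 x).comp (((wid [x]).tensor ((leftCoev K).tensor (wid [x.star]))).cast rfl
      (congrArg (x :: ·) (List.append_assoc K (Word.dual K) [x.star])))

/-- The right coevaluation of a word: nested cups. -/
def rightCoev : (K : Word) → PDiag 𝕜 [] (Word.dual K ++ K)
  | [] => wid []
  | x :: K =>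
    (rightCoev K).comp (((wid (Word.dual K)).tensor ((coevR 𝕜 x).tensor (wid K))).cast rfl
      (List.append_assoc (Word.dual K) [x.star] (x :: K)).symm)

end PDiag

variable {d : ℕ} {l : Fin d → ℕ} {𝕜 : Type u} [Field 𝕜]

/-- Juxtaposition of basis elements. -/
def BasisIdx.append : (K : Word) → {L : Word} → BasisIdx l K → BasisIdx l L → BasisIdx l (K ++ L)
  | [], _, _, t => t
  | _ :: K, _, s, t => (s.1, BasisIdx.append K s.2 t)

/-- The dual basis element: `v_S ⊗ ... ⊗ v_T` is sent to `v_T* ⊗ ... ⊗ v_S*`. -/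
def BasisIdx.dual : (K : Word) → BasisIdx l K → BasisIdx l (Word.dual K)
  | [], _ => PUnit.unit
  | .up _ :: K, s => BasisIdx.append (Word.dual K) (BasisIdx.dual K s.2) (s.1, PUnit.unit)
  | .dn _ :: K, s => BasisIdx.append (Word.dual K) (BasisIdx.dual K s.2) (s.1, PUnit.unit)

/-- The exponent of the pivotal element on the downward letters. -/
def pivDn : (K : Word) → BasisIdx l K → ℤ
  | [], _ => 0
  | .up _ :: K, s => pivDn K s.2
  | .dn _ :: K, s => pivExp s.1.1 + pivDn K s.2

/-- The exponent of the pivotal element on the upward letters. -/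
def pivUp : (K : Word) → BasisIdx l K → ℤ
  | [], _ => 0
  | .up _ :: K, s => pivExp s.1.1 + pivUp K s.2
  | .dn _ :: K, s => pivUp K s.2

/-- The left evaluation on the representation attached to a word. -/
def leftEvMat (l : Fin d → ℕ) (q : 𝕜ˣ) (K : Word) : Mat l 𝕜 (Word.dual K ++ K) [] :=
  Matrix.of fun _ s =>
    if BasisIdx.fst (Word.dual K) s = BasisIdx.dual K (BasisIdx.snd (Word.dual K) s) then
      qpow q (pivDn K (BasisIdx.snd (Word.dual K) s)) else 0

/-- The right evaluation on the representation attached to a word. -/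
def rightEvMat (l : Fin d → ℕ) (q : 𝕜ˣ) (K : Word) : Mat l 𝕜 (K ++ Word.dual K) [] :=
  Matrix.of fun _ s =>
    if BasisIdx.snd K s = BasisIdx.dual K (BasisIdx.fst K s) then
      qpow q (pivUp K (BasisIdx.fst K s)) else 0

/-- The left coevaluation on the representation attached to a word. -/
def leftCoevMat (l : Fin d → ℕ) (q : 𝕜ˣ) (K : Word) : Mat l 𝕜 [] (K ++ Word.dual K) :=
  Matrix.of fun t _ =>
    if BasisIdx.snd K t = BasisIdx.dual K (BasisIdx.fst K t) then
      qpow q (-pivDn K (BasisIdx.fst K t)) else 0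

/-- The right coevaluation on the representation attached to a word. -/
def rightCoevMat (l : Fin d → ℕ) (q : 𝕜ˣ) (K : Word) : Mat l 𝕜 [] (Word.dual K ++ K) :=
  Matrix.of fun t _ =>
    if BasisIdx.fst (Word.dual K) t = BasisIdx.dual K (BasisIdx.snd (Word.dual K) t) then
      qpow q (-pivUp K (BasisIdx.snd (Word.dual K) t)) else 0

end Duality

/-! ## The functor from annular webs to representations -/

section Functor

variable {d : ℕ} {𝕜 : Type u} [Field 𝕜]

/-- A `𝕜`-linear functor from the annular web category to the fundamental category which sends a word
to the representation attached to it, a planar web to the linear map attached to it, and a coil of a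
thin upward strand (and its inverse) to the coil map (and its inverse). The functor is well-defined
when there is such a functor; it is then unique, as these values determine it. -/
structure AnnularFunctor (l : Fin d → ℕ) (q : 𝕜ˣ) (u : Fin d → 𝕜ˣ) where
  /-- the action on morphisms -/
  map (K L : Word) : ((AWeb.mk K : AWeb (∑ i, l i) q) ⟶ AWeb.mk L) →ₗ[𝕜]
    ((Fund.mk K : Fund l q) ⟶ Fund.mk L)
  map_id (K : Word) : map K K (𝟙 _) = 𝟙 _
  map_comp {K L M : Word} (f : (AWeb.mk K : AWeb (∑ i, l i) q) ⟶ AWeb.mk L)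
    (g : (AWeb.mk L : AWeb (∑ i, l i) q) ⟶ AWeb.mk M) :
    map K M (f ≫ g) = map K L f ≫ map L M g
  map_planar {K L : Word} (p : PDiag 𝕜 K L) :
    Fund.mat (map K L (AWeb.of _ q (.planar p))) = evalP l q p
  map_coil (K : Word) :
    Fund.mat (map (.up 1 :: K) (K ++ [.up 1]) (AWeb.of _ q (.coil (.up 1) K))) = coilMap l q u K
  map_coilInv (K : Word) :
    Fund.mat (map (K ++ [.up 1]) (.up 1 :: K) (AWeb.of _ q (.coilInv (.up 1) K))) =
      coilInvMap l q u K

namespace AnnularFunctor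

variable {l : Fin d → ℕ} {q : 𝕜ˣ} {u : Fin d → 𝕜ˣ}

/-- The underlying functor. -/
def toFunctor (F : AnnularFunctor l q u) : AWeb (∑ i, l i) q ⥤ Fund l q where
  obj X := ⟨X.word⟩
  map {X Y} f := F.map X.word Y.word f
  map_id X := F.map_id X.word
  map_comp f g := F.map_comp f g

/-- The linear map which the functor attaches to (the class of) an annular diagram. -/
def mat (F : AnnularFunctor l q u) {K L : Word} (f : ADiag 𝕜 K L) : Mat l 𝕜 K L :=
  Fund.mat (F.map K L (AWeb.of _ q f))

/-- The functor is (strictly) monoidal: it sends the annular product to the tensor product. -/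
def IsStrictMonoidal (F : AnnularFunctor l q u) : Prop :=
  ∀ {K L K' L' : Word} (f : ADiag 𝕜 K L) (g : ADiag 𝕜 K' L'),
    F.mat (ADiag.annTensor q f g) = tensorMat (F.mat f) (F.mat g)

/-- There are invertible linear maps `J_{K,K'}`, natural with respect to all morphisms, which
intertwine the image of the annular product and the tensor product of the images. This is implied by
every structure of a (not necessarily strict) monoidal functor. -/
def HasTensorIsos (F : AnnularFunctor l q u) : Prop :=
  ∃ J : ∀ K K' : Word, (Mat l 𝕜 (K ++ K') (K ++ K'))ˣ,
    ∀ {K L K' L' : Word} (f : ADiag 𝕜 K L) (g : ADiag 𝕜 K' L'),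
      F.mat (ADiag.annTensor q f g) * (J K K').1 = (J L L').1 * tensorMat (F.mat f) (F.mat g)

/-- The functor is pivotal: it is monoidal, and it preserves left and right duals together with the
evaluations and coevaluations. -/
structure IsPivotal (F : AnnularFunctor l q u) : Prop where
  monoidal : F.IsStrictMonoidal
  leftEv (K : Word) : F.mat (.planar (PDiag.leftEv 𝕜 K)) = leftEvMat l q K
  rightEv (K : Word) : F.mat (.planar (PDiag.rightEv 𝕜 K)) = rightEvMat l q K
  leftCoev (K : Word) : F.mat (.planar (PDiag.leftCoev 𝕜 K)) = leftCoevMat l q K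
  rightCoev (K : Word) : F.mat (.planar (PDiag.rightCoev 𝕜 K)) = rightCoevMat l q K

end AnnularFunctor

end Functor

end AnnularWebs

/-!
The annular product of `f` and `g` only differs from a juxtaposition where a coil of one diagram
winds around the strands of the other one: there the coil of `f` or `g` is precomposed or
postcomposed with planar crossings, which are sent to the braiding of `gl_n`, while the coil itself
is sent to the braiding of the Levi subalgebra.

At `q = 1` both braidings are swaps. For the planar crossings this is `evalP_cross_one`: the
entries of the signed sum of ladders which defines a crossing of thick strands are alternating sums
over subsets, and the sign-reversing involution which adds or removes a fixed element leaves only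
the swap (`sum_ladderCoeff_one`). Coils are given on thin upward strands only. An upward strand of
thickness `k + 1` is, in characteristic zero, a direct summand of two strands of thickness `1` and
`k`, and splits slide along coils; the coil of a downward strand is the inverse of a bent coil of
the upward strand, because caps slide along coils. Hence the coil of every strand `x` around every
word `K` is a rotation `v ⊗ w ↦ w ⊗ D v`, with `D` depending on `x` only (`coil_eq_rotMat`). So the
crossings cancel the swap in the rotation, annular whiskering becomes the tensor product with an
identity (`mat_whiskerRight`, `mat_whiskerLeft`), and the functor is monoidal. Nested caps and cups
are computed by induction on the word, all powers of `q` being `1`.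

For `q` of infinite order, consider the product of the identity of a thin strand and a coil behind
it. Both the `gl_n`-crossing and the Levi crossing multiply `v_a ⊗ v_a` by `q`, so this vector is
an eigenvector with eigenvalue `q ^ 2 * u i`, where `i` is the block of `a`
(`mat_wid_annTensor_coil_diag`). The tensor product of the images is diagonal with entries among
the `u i`. If the two maps were conjugate, the finite set of the `u i` of nonempty blocks would be
stable under multiplication by `q ^ 2` (`not_hasTensorIsos`). For the product of a coil in front of
a thin strand, take basis vectors from two different blocks: the Levi crossing swaps them, and the
`gl_n`-crossing adds a term with coefficient `q⁻¹ - q ≠ 0` to the swap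
(`mat_coil_annTensor_wid_ne`).
-/

namespace AnnularWebs

universe u

/-! ### Basis elements of tensor products -/

namespace BasisIdx

variable {d : ℕ} {l : Fin d → ℕ}

/-- The basis element `v_S ⊗ s`. -/
def cons {x : Label} {K : Word} (S : {S : Finset (Idx l) // S.card = x.thick}) (s : BasisIdx l K) :
    BasisIdx l (x :: K) := (S, s)

/-- The basis element of the trivial representation. -/
def nil : BasisIdx l [] := PUnit.unit

theorem exists_cons {x : Label} {K : Word} (s : BasisIdx l (x :: K)) :
    ∃ S t, s = cons S t := ⟨s.1, s.2, rfl⟩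

theorem eq_nil (s : BasisIdx l []) : s = nil := rfl

/-- `simp` evaluates sums over the basis of the trivial representation at `default`. -/
@[simp] theorem default_eq (h : Inhabited (BasisIdx l [])) : @default _ h = nil := rfl

instance : Unique (BasisIdx l []) := ⟨⟨nil⟩, fun _ => rfl⟩

section Cons

variable {x : Label} {K : Word} (S S' : {S : Finset (Idx l) // S.card = x.thick})
  (s s' : BasisIdx l K)

@[simp] theorem cons_fst : Prod.fst (cons S s) = S := rfl

@[simp] theorem cons_snd : Prod.snd (cons S s) = s := rfl

@[simp] theorem cons_inj : cons S s = cons S' s' ↔ S = S' ∧ s = s' := Prod.mk_inj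

end Cons

@[simp] theorem fst_nil {L : Word} (s : BasisIdx l ([] ++ L)) : fst [] s = nil := rfl

@[simp] theorem snd_nil {L : Word} (s : BasisIdx l ([] ++ L)) : snd [] s = s := rfl

@[simp] theorem append_nil_left {L : Word} (s : BasisIdx l []) (t : BasisIdx l L) :
    append [] s t = t := rfl

@[simp] theorem fst_cons {x : Label} {K L : Word} (S : {S : Finset (Idx l) // S.card = x.thick})
    (s : BasisIdx l (K ++ L)) : fst (x :: K) (cons S s) = cons S (fst K s) := rfl

@[simp] theorem snd_cons {x : Label} {K L : Word} (S : {S : Finset (Idx l) // S.card = x.thick})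
    (s : BasisIdx l (K ++ L)) : snd (x :: K) (cons S s) = snd K s := rfl

@[simp] theorem append_cons {x : Label} {K L : Word} (S : {S : Finset (Idx l) // S.card = x.thick})
    (s : BasisIdx l K) (t : BasisIdx l L) :
    append (x :: K) (cons S s) t = cons S (append K s t) := rfl

@[simp] theorem fst_append : (K : Word) → {L : Word} → (s : BasisIdx l K) → (t : BasisIdx l L) →
    fst K (append K s t) = s
  | [], _, _, _ => rfl
  | _ :: K, _, s, t => congrArg (cons s.1) (fst_append K s.2 t)

@[simp] theorem snd_append : (K : Word) → {L : Word} → (s : BasisIdx l K) → (t : BasisIdx l L) →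
    snd K (append K s t) = t
  | [], _, _, _ => rfl
  | _ :: K, _, s, t => snd_append K s.2 t

theorem append_fst_snd : (K : Word) → {L : Word} → (s : BasisIdx l (K ++ L)) →
    append K (fst K s) (snd K s) = s
  | [], _, _ => rfl
  | _ :: K, _, s => congrArg (cons s.1) (append_fst_snd K s.2)

theorem exists_append (K : Word) {L : Word} (s : BasisIdx l (K ++ L)) :
    ∃ a b, s = append K a b := ⟨_, _, (append_fst_snd K s).symm⟩

@[simp] theorem append_inj (K : Word) {L : Word} (s s' : BasisIdx l K) (t t' : BasisIdx l L) :
    append K s t = append K s' t' ↔ s = s' ∧ t = t' := by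
  refine ⟨fun h => ⟨?_, ?_⟩, fun h => by rw [h.1, h.2]⟩
  · simpa using congrArg (fst K) h
  · simpa using congrArg (snd K) h

theorem sum_cons {A : Type*} [AddCommMonoid A] {x : Label} {K : Word}
    (f : BasisIdx l (x :: K) → A) : ∑ s, f s = ∑ S, ∑ s, f (cons S s) :=
  Fintype.sum_prod_type (f : {S : Finset (Idx l) // S.card = x.thick} × BasisIdx l K → A)

theorem sum_append {A : Type*} [AddCommMonoid A] (K : Word) {L : Word}
    (f : BasisIdx l (K ++ L) → A) : ∑ s, f s = ∑ a, ∑ b, f (append K a b) := by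
  rw [← Fintype.sum_prod_type' (fun a b => f (append K a b))]
  refine Fintype.sum_equiv (splitEquiv K L) _ _ fun s => ?_
  rw [splitEquiv_apply, append_fst_snd]

/-- Transport of basis elements along an equality of words. -/
def cast {K K' : Word} (h : K = K') (s : BasisIdx l K) : BasisIdx l K' := h ▸ s

@[simp] theorem cast_rfl {K : Word} (h : K = K) (s : BasisIdx l K) : cast h s = s := rfl

@[simp] theorem cast_cast {K K' K'' : Word} (h : K = K') (h' : K' = K'') (s : BasisIdx l K) :
    cast h' (cast h s) = cast (h.trans h') s := by
  subst h h'; rfl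

@[simp] theorem cast_inj {K K' : Word} (h : K = K') (s t : BasisIdx l K) :
    cast h s = cast h t ↔ s = t := by
  subst h; rfl

theorem cast_cons {x : Label} {K K' : Word} (h : K = K') (h' : x :: K = x :: K')
    (S : {S : Finset (Idx l) // S.card = x.thick}) (s : BasisIdx l K) :
    cast h' (cons S s) = cons S (cast h s) := by
  subst h; rfl

@[simp] theorem cast_append_assoc : (K L M : Word) → (h : (K ++ L) ++ M = K ++ (L ++ M)) →
    (a : BasisIdx l K) → (b : BasisIdx l L) → (c : BasisIdx l M) →
    cast h (append (K ++ L) (append K a b) c) = append K a (append L b c)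
  | [], _, _, _, _, _, _ => rfl
  | _ :: K, L, M, h, a, b, c =>
    (cast_cons (List.append_assoc K L M) h a.1 _).trans
      (congrArg (cons a.1) (cast_append_assoc K L M _ a.2 b c))

@[simp] theorem cast_append_assoc_symm (K L M : Word) (h : K ++ (L ++ M) = (K ++ L) ++ M)
    (a : BasisIdx l K) (b : BasisIdx l L) (c : BasisIdx l M) :
    cast h (append K a (append L b c)) = append (K ++ L) (append K a b) c := by
  rw [← cast_append_assoc K L M h.symm, cast_cast, cast_rfl]

@[simp] theorem cast_append_cons {x : Label} (K L : Word) (h : K ++ x :: L = (K ++ [x]) ++ L)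
    (a : BasisIdx l K) (b : {S : Finset (Idx l) // S.card = x.thick}) (c : BasisIdx l L) :
    cast h (append K a (cons b c)) = append (K ++ [x]) (append K a (cons b nil)) c :=
  cast_append_assoc_symm K [x] L h a (cons b nil) c

@[simp] theorem cast_append_nil : (K : Word) → (h : K = K ++ []) →
    (a : BasisIdx l K) → cast h a = append K a nil
  | [], _, _ => rfl
  | _ :: K, h, a =>
    (cast_cons (List.append_nil K).symm h a.1 a.2).trans
      (congrArg (cons a.1) (cast_append_nil K _ a.2))

@[simp] theorem cast_append_nil' (K : Word) (h : K ++ [] = K) (a : BasisIdx l K) (b) :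
    cast h (append K a b) = a := by
  rw [eq_nil b, ← cast_append_nil K h.symm, cast_cast, cast_rfl]

end BasisIdx

/-! ### Tensor products of linear maps -/

section Cast

variable {d : ℕ} {l : Fin d → ℕ} {𝕜 : Type u}

/-- Transport of linear maps along equalities of words. -/
def castMat {K K' L L' : Word} (hK : K = K') (hL : L = L') (M : Mat l 𝕜 K L) : Mat l 𝕜 K' L' :=
  Matrix.of fun t s => M (BasisIdx.cast hL.symm t) (BasisIdx.cast hK.symm s)

theorem castMat_apply {K K' L L' : Word} (hK : K = K') (hL : L = L') (M : Mat l 𝕜 K L) (t s) :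
    castMat hK hL M t s = M (BasisIdx.cast hL.symm t) (BasisIdx.cast hK.symm s) := rfl

end Cast

section Tensor

variable {d : ℕ} {l : Fin d → ℕ} {𝕜 : Type u} [Field 𝕜]

open BasisIdx

theorem tensorMat_apply {K L K' L' : Word} (M : Mat l 𝕜 K L) (N : Mat l 𝕜 K' L') (t s) :
    tensorMat M N t s = M (fst L t) (fst K s) * N (snd L t) (snd K s) := rfl

theorem tensorMat_mul {K L M K' L' M' : Word} (f : Mat l 𝕜 K L) (g : Mat l 𝕜 L M)
    (f' : Mat l 𝕜 K' L') (g' : Mat l 𝕜 L' M') :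
    tensorMat g g' * tensorMat f f' = tensorMat (g * f) (g' * f') := by
  ext t s
  simp only [Matrix.mul_apply, tensorMat_apply, sum_append, fst_append, snd_append,
    Finset.sum_mul_sum]
  exact Finset.sum_congr rfl fun _ _ => Finset.sum_congr rfl fun _ _ => by ring

@[simp] theorem tensorMat_one (K L : Word) : tensorMat (idMat l 𝕜 K) (idMat l 𝕜 L) = 1 := by
  ext t s
  obtain ⟨a, b, rfl⟩ := exists_append K t
  obtain ⟨a', b', rfl⟩ := exists_append K s
  simp only [tensorMat_apply, Matrix.one_apply, fst_append, snd_append, append_inj, ite_and]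
  split_ifs <;> simp

theorem evalP_cast (q : 𝕜ˣ) {K K' L L' : Word} (hK : K = K') (hL : L = L') (p : PDiag 𝕜 K L) :
    evalP l q (p.cast hK hL) = castMat hK hL (evalP l q p) := by
  subst hK hL; rfl

@[simp] theorem qpow_one_unit (z : ℤ) : qpow (1 : 𝕜ˣ) z = 1 := by simp [qpow]

end Tensor

/-! ### Functoriality on annular diagrams -/

namespace AnnularFunctor

variable {d : ℕ} {l : Fin d → ℕ} {𝕜 : Type u} [Field 𝕜] {q : 𝕜ˣ} {u : Fin d → 𝕜ˣ}
  (F : AnnularFunctor l q u)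

theorem mat_comp {K L M : Word} (f : ADiag 𝕜 K L) (g : ADiag 𝕜 L M) :
    F.mat (f.comp g) = F.mat g * F.mat f :=
  congrArg Subtype.val (F.map_comp (AWeb.of _ q f) (AWeb.of _ q g))

theorem mat_add {K L : Word} (f g : ADiag 𝕜 K L) : F.mat (f.add g) = F.mat f + F.mat g :=
  congrArg Subtype.val ((F.map K L).map_add (AWeb.of _ q f) (AWeb.of _ q g))

theorem mat_smul {K L : Word} (c : 𝕜) (f : ADiag 𝕜 K L) : F.mat (f.smul c) = c • F.mat f :=
  congrArg Subtype.val ((F.map K L).map_smul c (AWeb.of _ q f))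

theorem mat_zero (K L : Word) : F.mat (ADiag.zero K L) = 0 :=
  congrArg Subtype.val ((F.map K L).map_zero)

theorem mat_planar {K L : Word} (p : PDiag 𝕜 K L) : F.mat (.planar p) = evalP l q p :=
  F.map_planar p

theorem mat_wid (K : Word) : F.mat (ADiag.wid K) = 1 := F.mat_planar _

theorem mat_cast {K K' L L' : Word} (hK : K = K') (hL : L = L') (f : ADiag 𝕜 K L) :
    F.mat (f.cast hK hL) = castMat hK hL (F.mat f) := by
  subst hK hL; rfl

theorem mat_eq_of_rel {K L : Word} {f g : ADiag 𝕜 K L} (h : ARel (∑ i, l i) q f g) :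
    F.mat f = F.mat g :=
  congrArg (fun x => Fund.mat (F.map K L x)) (AHom.sound h)

theorem evalP_eq_of_rel {K L : Word} {f g : PDiag 𝕜 K L} (h : PRel (∑ i, l i) q f g)
    (F : AnnularFunctor l q u) : evalP l q f = evalP l q g := by
  rw [← F.mat_planar, ← F.mat_planar, F.mat_eq_of_rel (.planar_rel h)]

theorem mat_coil_mul_mat_coilInv (x : Label) (K : Word) :
    F.mat (.coil x K) * F.mat (.coilInv x K) = 1 := by
  rw [← F.mat_comp, F.mat_eq_of_rel (.coilInv_coil x K), F.mat_wid]

theorem mat_coilInv_mul_mat_coil (x : Label) (K : Word) :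
    F.mat (.coilInv x K) * F.mat (.coil x K) = 1 := by
  rw [← F.mat_comp, F.mat_eq_of_rel (.coil_coilInv x K), F.mat_wid]

end AnnularFunctor

/-! ### Rotations -/

section Rotation

variable {d : ℕ} {l : Fin d → ℕ} {𝕜 : Type u} [Field 𝕜]

open BasisIdx

/-- The map `x ⊗ y ↦ y ⊗ C x` on `X ⊗ K`: a map `C` on `X`, followed by the swap of the tensor
factors. For `C = 1` it is the swap. -/
def rotMat (X K : Word) {Y : Word} (C : Mat l 𝕜 X Y) : Mat l 𝕜 (X ++ K) (K ++ Y) :=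
  Matrix.of fun t s => if fst K t = snd X s then C (snd K t) (fst X s) else 0

theorem rotMat_apply (X K : Word) {Y : Word} (C : Mat l 𝕜 X Y) (t s) :
    rotMat X K C t s = if fst K t = snd X s then C (snd K t) (fst X s) else 0 := rfl

theorem rotMat_mul_tensorMat (X K : Word) {Y Z : Word} (C : Mat l 𝕜 Y Z) (M : Mat l 𝕜 X Y) :
    rotMat Y K C * tensorMat M (idMat l 𝕜 K) = rotMat X K (C * M) := by
  ext t s
  simp [Matrix.mul_apply, rotMat_apply, tensorMat_apply, sum_append, Matrix.one_apply]

theorem tensorMat_mul_rotMat (X K : Word) {Y Z : Word} (C : Mat l 𝕜 X Y) (M : Mat l 𝕜 Y Z) :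
    tensorMat (idMat l 𝕜 K) M * rotMat X K C = rotMat X K (M * C) := by
  ext t s
  simp [Matrix.mul_apply, rotMat_apply, tensorMat_apply, sum_append, Matrix.one_apply]

theorem tensorMat_mul_rotMat' (X : Word) {K L Y : Word} (C : Mat l 𝕜 X Y) (M : Mat l 𝕜 K L) :
    tensorMat M (idMat l 𝕜 Y) * rotMat X K C = rotMat X L C * tensorMat (idMat l 𝕜 X) M := by
  ext t s
  simp [Matrix.mul_apply, rotMat_apply, tensorMat_apply, sum_append, Matrix.one_apply]
  exact mul_comm _ _

theorem rotMat_one_mul (X K : Word) :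
    rotMat K X (idMat l 𝕜 K) * rotMat X K (idMat l 𝕜 X) = 1 := by
  ext t s
  obtain ⟨a, b, rfl⟩ := exists_append X t
  obtain ⟨a', b', rfl⟩ := exists_append X s
  simp [Matrix.mul_apply, rotMat_apply, sum_append, Matrix.one_apply, ite_and]

theorem rotMat_nil_right (X : Word) (C : Mat l 𝕜 X X) (t : BasisIdx l X) (s) :
    rotMat X [] C t s = C t (fst X s) := by
  rw [rotMat_apply, if_pos (by rfl)]
  rfl

theorem rotMat_singleton_nil (x : Label) :
    rotMat [x] [] (idMat l 𝕜 [x]) = (1 : Mat l 𝕜 [x] [x]) := by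
  ext t s
  exact rotMat_nil_right [x] _ t s

theorem rotMat_nil_singleton (x : Label) :
    rotMat [] [x] (idMat l 𝕜 []) = (1 : Mat l 𝕜 [x] [x]) := by
  ext t s
  obtain ⟨a, t, rfl⟩ := exists_cons t
  obtain ⟨b, s, rfl⟩ := exists_cons s
  obtain rfl := eq_nil t
  obtain rfl := eq_nil s
  simp [rotMat_apply, Matrix.one_apply]

theorem rotMat_cons (x y : Label) (L : Word) :
    compMat (x :: y :: L) (y :: x :: L) (y :: (L ++ [x]))
      (tensorMat (rotMat [x] [y] (idMat l 𝕜 [x])) (idMat l 𝕜 L))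
      (tensorMat (idMat l 𝕜 [y]) (rotMat [x] L (idMat l 𝕜 [x]))) =
    rotMat [x] (y :: L) (idMat l 𝕜 [x]) := by
  ext t s
  obtain ⟨a, t, rfl⟩ := exists_cons t
  obtain ⟨b, s, rfl⟩ := exists_cons s
  obtain ⟨c, s, rfl⟩ := exists_cons s
  obtain ⟨t, e, rfl⟩ := exists_append L t
  obtain ⟨e, z, rfl⟩ := exists_cons e
  simp [compMat, Matrix.mul_apply, rotMat_apply, tensorMat_apply, sum_cons, Matrix.one_apply,
    ite_and]
  obtain rfl := eq_nil z
  split_ifs <;> rfl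

theorem rotMat_snoc (x y : Label) (L : Word) :
    compMat (y :: (L ++ [x])) (y :: x :: L) (x :: y :: L)
      (tensorMat (idMat l 𝕜 [y]) (rotMat L [x] (idMat l 𝕜 L)))
      (tensorMat (rotMat [y] [x] (idMat l 𝕜 [y])) (idMat l 𝕜 L)) =
    rotMat (y :: L) [x] (idMat l 𝕜 (y :: L)) := by
  ext t s
  obtain ⟨a, t, rfl⟩ := exists_cons t
  obtain ⟨b, t, rfl⟩ := exists_cons t
  obtain ⟨c, s, rfl⟩ := exists_cons s
  obtain ⟨s, e, rfl⟩ := exists_append L s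
  obtain ⟨e, z, rfl⟩ := exists_cons e
  simp [compMat, Matrix.mul_apply, rotMat_apply, tensorMat_apply, sum_cons, Matrix.one_apply,
    ite_and]
  obtain rfl := eq_nil z
  split_ifs <;> rfl

/-- Labels of the same thickness have bases indexed by equal, but syntactically different, types of
subsets; this evaluates sums in which such an index is matched with one of the other type. -/
theorem sum_ite_val_eq {A : Type*} [AddCommMonoid A] {x y : Label} (h : x.thick = y.thick)
    (b : {S : Finset (Idx l) // S.card = y.thick})
    [∀ a : {S : Finset (Idx l) // S.card = x.thick}, Decidable (a.1 = b.1)]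
    (f : {S : Finset (Idx l) // S.card = x.thick} → A) :
    (∑ a, if a.1 = b.1 then f a else 0) = f ⟨b.1, b.2.trans h.symm⟩ := by
  rw [Finset.sum_eq_single ⟨b.1, b.2.trans h.symm⟩]
  · simp
  · intro a _ ha
    rw [if_neg fun e => ha (Subtype.ext e)]
  · simp

theorem sum_ite_eq_val {A : Type*} [AddCommMonoid A] {x y : Label} (h : x.thick = y.thick)
    (b : {S : Finset (Idx l) // S.card = y.thick})
    [∀ a : {S : Finset (Idx l) // S.card = x.thick}, Decidable (b.1 = a.1)]
    (f : {S : Finset (Idx l) // S.card = x.thick} → A) :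
    (∑ a, if b.1 = a.1 then f a else 0) = f ⟨b.1, b.2.trans h.symm⟩ := by
  classical
  rw [← sum_ite_val_eq h b f]
  simp only [eq_comm]

/-- At `q = 1`, the left mate of a swap is a swap. -/
theorem mateL_swap (k : ℕ+) (y : Label) :
    compMat [.dn k, y] [.dn k, y, .up k, .dn k] [y, .dn k]
      (tensorMat (idMat l 𝕜 [.dn k, y]) (evalGen l 1 (.cupL k)))
      (compMat [.dn k, y, .up k, .dn k] [.dn k, .up k, y, .dn k] [y, .dn k]
        (tensorMat (tensorMat (idMat l 𝕜 [.dn k]) (rotMat [y] [.up k] (idMat l 𝕜 [y])))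
          (idMat l 𝕜 [.dn k]))
        (tensorMat (evalGen l 1 (.capL k)) (idMat l 𝕜 [y, .dn k]))) =
    rotMat [.dn k] [y] (idMat l 𝕜 [.dn k]) := by
  ext t s
  obtain ⟨a, t, rfl⟩ := exists_cons t
  obtain ⟨b, t, rfl⟩ := exists_cons t
  obtain ⟨c, s, rfl⟩ := exists_cons s
  obtain ⟨e, s, rfl⟩ := exists_cons s
  obtain rfl := eq_nil t
  obtain rfl := eq_nil s
  simp [compMat, Matrix.mul_apply, rotMat_apply, tensorMat_apply, sum_cons, Matrix.one_apply,
    ite_and, evalGen]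
  simp only [Subtype.ext_iff, sum_ite_eq_val (x := .dn k) (y := .up k) rfl]
  simp only [Finset.sum_ite_irrel, Finset.sum_const_zero, sum_ite_val_eq (x := y) (y := y) rfl,
    sum_ite_val_eq (x := .dn k) (y := .dn k) rfl, sum_ite_eq_val (x := .up k) (y := .dn k) rfl]
  simp [eq_comm]

/-- At `q = 1`, the right mate of a swap is a swap. -/
theorem mateR_swap (k : ℕ+) (x : Label) :
    compMat [x, .dn k] [.dn k, .up k, x, .dn k] [.dn k, x]
      (tensorMat (evalGen l 1 (.cupR k)) (idMat l 𝕜 [x, .dn k]))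
      (compMat [.dn k, .up k, x, .dn k] [.dn k, x, .up k, .dn k] [.dn k, x]
        (tensorMat (tensorMat (idMat l 𝕜 [.dn k]) (rotMat [.up k] [x] (idMat l 𝕜 [.up k])))
          (idMat l 𝕜 [.dn k]))
        (tensorMat (idMat l 𝕜 [.dn k, x]) (evalGen l 1 (.capR k)))) =
    rotMat [x] [.dn k] (idMat l 𝕜 [x]) := by
  ext t s
  obtain ⟨a, t, rfl⟩ := exists_cons t
  obtain ⟨b, t, rfl⟩ := exists_cons t
  obtain ⟨c, s, rfl⟩ := exists_cons s
  obtain ⟨e, s, rfl⟩ := exists_cons s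
  obtain rfl := eq_nil t
  obtain rfl := eq_nil s
  simp [compMat, Matrix.mul_apply, rotMat_apply, tensorMat_apply, sum_cons, Matrix.one_apply,
    ite_and, evalGen]
  simp only [Subtype.ext_iff, sum_ite_eq_val (x := .up k) (y := .dn k) rfl]
  simp only [sum_ite_val_eq (x := .dn k) (y := .dn k) rfl]

end Rotation

/-! ### Merges, splits and ladders in the bases of subsets -/

section Support

variable {d : ℕ} {l : Fin d → ℕ}

namespace BasisIdx

/-- The union of the subsets which label a basis element. -/
def supp : (K : Word) → BasisIdx l K → Finset (Idx l)
  | [], _ => ∅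
  | _ :: K, s => s.1.1 ∪ supp K s.2

@[simp] theorem supp_cast {K K' : Word} (h : K = K') (s : BasisIdx l K) :
    supp K' (cast h s) = supp K s := by
  subst h; rfl

theorem cast_singleton_val {K : Word} {x : Label} (h : K = [x]) (s : BasisIdx l K) :
    (cast h s).1.1 = supp K s := by
  subst h
  exact (Finset.union_empty _).symm

theorem cast_pair_val {K L : Word} {x y : Label} (hK : K = [x]) (hL : L = [y])
    (h : K ++ L = [x, y]) (s : BasisIdx l (K ++ L)) :
    (cast h s).1.1 = supp K (fst K s) ∧ (cast h s).2.1.1 = supp L (snd K s) := by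
  subst hK hL
  exact ⟨(Finset.union_empty _).symm, (Finset.union_empty _).symm⟩

theorem supp_append : (K : Word) → {L : Word} → (s : BasisIdx l K) → (t : BasisIdx l L) →
    supp (K ++ L) (append K s t) = supp K s ∪ supp L t
  | [], _, _, _ => (Finset.empty_union _).symm
  | _ :: K, L, s, t => by
    change s.1.1 ∪ supp (K ++ L) (append K s.2 t) = s.1.1 ∪ supp K s.2 ∪ supp L t
    rw [supp_append K, Finset.union_assoc]

theorem card_supp_upw (k : ℕ) (s : BasisIdx l (upw k)) : (supp (upw k) s).card = k := by
  by_cases hk : 0 < k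
  · rw [← cast_singleton_val (upw_pos hk)]
    exact (cast (upw_pos hk) s).1.2
  · obtain rfl : k = 0 := by omega
    rfl

/-- A basis element of the exterior power attached to `upw k` is determined by its subset, also for
`k = 0`, where the strand is omitted. -/
theorem supp_upw_injective (k : ℕ) :
    Function.Injective (supp (upw k) : BasisIdx l (upw k) → Finset (Idx l)) := by
  intro s t h
  by_cases hk : 0 < k
  · rw [← cast_singleton_val (upw_pos hk), ← cast_singleton_val (upw_pos hk)] at h
    rw [← cast_inj (upw_pos hk)]
    exact (cons_inj _ _ _ _).2 ⟨Subtype.ext h, rfl⟩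
  · obtain rfl : k = 0 := by omega
    rfl

theorem exists_supp_upw {k : ℕ} {S : Finset (Idx l)} (h : S.card = k) :
    ∃ s, supp (upw k) s = S := by
  by_cases hk : 0 < k
  · refine ⟨cast (upw_pos hk).symm (cons ⟨S, h⟩ nil), ?_⟩
    rw [supp_cast]
    exact Finset.union_empty _
  · obtain rfl : k = 0 := by omega
    exact ⟨nil, (Finset.card_eq_zero.1 h).symm⟩

/-- Summing over a basis of an exterior power is summing over the subsets of the right
cardinality. -/
theorem sum_upw {A : Type*} [AddCommMonoid A] (k : ℕ) (f : Finset (Idx l) → A) :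
    ∑ s, f (supp (upw k) s) = ∑ S, if S.card = k then f S else 0 := by
  rw [← Finset.sum_filter]
  refine Finset.sum_bij (fun s _ => supp (upw k) s) ?_ ?_ ?_ ?_
  · simp [card_supp_upw]
  · exact fun _ _ _ _ h => supp_upw_injective k h
  · intro S hS
    obtain ⟨s, hs⟩ := exists_supp_upw (Finset.mem_filter.1 hS).2
    exact ⟨s, Finset.mem_univ _, hs⟩
  · simp

end BasisIdx

theorem ltCount_union_left {S S' : Finset (Idx l)} (h : Disjoint S S') (T : Finset (Idx l)) :
    ltCount (S ∪ S') T = ltCount S T + ltCount S' T := by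
  rw [ltCount, Finset.union_product, Finset.filter_union, Finset.card_union_of_disjoint]
  · rfl
  · exact Finset.disjoint_filter_filter (Finset.disjoint_product.2 (.inl h))

theorem ltCount_union_right {S S' : Finset (Idx l)} (h : Disjoint S S') (T : Finset (Idx l)) :
    ltCount T (S ∪ S') = ltCount T S + ltCount T S' := by
  rw [ltCount, Finset.product_union, Finset.filter_union, Finset.card_union_of_disjoint]
  · rfl
  · exact Finset.disjoint_filter_filter (Finset.disjoint_product.2 (.inr h))

theorem ltCount_add_ltCount {S T : Finset (Idx l)} (h : Disjoint S T) :
    ltCount S T + ltCount T S = S.card * T.card := by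
  rw [← Finset.card_product, ltCount, ltCount,
    ← Finset.card_filter_add_card_filter_not (s := S ×ˢ T) (fun p => p.1 < p.2)]
  congr 1
  refine Finset.card_bij (fun p _ => (p.2, p.1)) ?_ ?_ ?_
  · intro p hp
    simp only [Finset.mem_filter, Finset.mem_product] at hp ⊢
    exact ⟨hp.1.symm, hp.2.not_gt⟩
  · intro p _ p' _ e
    simp only [Prod.mk.injEq] at e
    exact Prod.ext e.2 e.1
  · intro p hp
    simp only [Finset.mem_filter, Finset.mem_product, not_lt] at hp
    refine ⟨(p.2, p.1), ?_, rfl⟩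
    simp only [Finset.mem_filter, Finset.mem_product]
    exact ⟨hp.1.symm, lt_of_le_of_ne hp.2 fun e =>
      Finset.disjoint_left.1 h hp.1.1 (e ▸ hp.1.2)⟩

@[simp] theorem ltCount_empty_left (T : Finset (Idx l)) : ltCount ∅ T = 0 := rfl

@[simp] theorem ltCount_empty_right (T : Finset (Idx l)) : ltCount T ∅ = 0 := by simp [ltCount]

end Support

section Ladder

variable {d : ℕ} {l : Fin d → ℕ} {𝕜 : Type u} [Field 𝕜] (q : 𝕜ˣ)

open BasisIdx

@[simp] theorem qpow_zero : qpow q 0 = 1 := by simp [qpow]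

theorem mergeCoeff_eq_zero {S T U : Finset (Idx l)} (h : ¬ (Disjoint S T ∧ U = S ∪ T)) :
    mergeCoeff q S T U = 0 := if_neg h

theorem splitCoeff_eq_zero {S T U : Finset (Idx l)} (h : ¬ (Disjoint S T ∧ U = S ∪ T)) :
    splitCoeff q S T U = 0 := if_neg h

theorem mergeCoeff_empty_right (S U : Finset (Idx l)) :
    mergeCoeff q S ∅ U = if U = S then 1 else 0 := by
  simp [mergeCoeff]

theorem mergeCoeff_empty_left (S U : Finset (Idx l)) :
    mergeCoeff q ∅ S U = if U = S then 1 else 0 := by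
  simp [mergeCoeff]

theorem splitCoeff_empty_right (S U : Finset (Idx l)) :
    splitCoeff q S ∅ U = if U = S then 1 else 0 := by
  simp [splitCoeff]

theorem splitCoeff_empty_left (S U : Finset (Idx l)) :
    splitCoeff q ∅ S U = if U = S then 1 else 0 := by
  simp [splitCoeff]

theorem supp_eq_empty {k : ℕ} (hk : ¬ 0 < k) (s : BasisIdx l (upw k)) : supp (upw k) s = ∅ := by
  rw [← Finset.card_eq_zero, card_supp_upw]
  omega

theorem evalP_mergeN_apply (k m : ℕ) (t : BasisIdx l (upw (k + m)))
    (s : BasisIdx l (upw k ++ upw m)) :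
    evalP l q (PDiag.mergeN k m) t s =
      mergeCoeff q (supp _ (fst (upw k) s)) (supp _ (snd (upw k) s)) (supp _ t) := by
  unfold PDiag.mergeN
  split_ifs with hk hm
  · rw [evalP_cast, castMat_apply]
    simp only [evalP, evalGen, Matrix.of_apply]
    rw [(cast_pair_val (upw_pos hk) (upw_pos hm) _ s).1,
      (cast_pair_val (upw_pos hk) (upw_pos hm) _ s).2, cast_singleton_val]
  · obtain ⟨a, b, rfl⟩ := exists_append (upw k) s
    rw [evalP_cast, castMat_apply]
    simp only [evalP, Matrix.one_apply, fst_append, snd_append]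
    rw [supp_eq_empty hm, mergeCoeff_empty_right]
    refine if_congr ?_ rfl rfl
    rw [← (supp_upw_injective (k + m)).eq_iff, supp_cast, supp_cast, supp_append, supp_eq_empty hm,
      Finset.union_empty]
  · obtain ⟨a, b, rfl⟩ := exists_append (upw k) s
    rw [evalP_cast, castMat_apply]
    simp only [evalP, Matrix.one_apply, fst_append, snd_append]
    rw [supp_eq_empty hk, mergeCoeff_empty_left]
    refine if_congr ?_ rfl rfl
    rw [← (supp_upw_injective (k + m)).eq_iff, supp_cast, supp_cast, supp_append, supp_eq_empty hk,
      Finset.empty_union]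

theorem evalP_splitN_apply (k m : ℕ) (t : BasisIdx l (upw k ++ upw m))
    (s : BasisIdx l (upw (k + m))) :
    evalP l q (PDiag.splitN k m) t s =
      splitCoeff q (supp _ (fst (upw k) t)) (supp _ (snd (upw k) t)) (supp _ s) := by
  unfold PDiag.splitN
  split_ifs with hk hm
  · rw [evalP_cast, castMat_apply]
    simp only [evalP, evalGen, Matrix.of_apply]
    rw [(cast_pair_val (upw_pos hk) (upw_pos hm) _ t).1,
      (cast_pair_val (upw_pos hk) (upw_pos hm) _ t).2, cast_singleton_val]
  · obtain ⟨a, b, rfl⟩ := exists_append (upw k) t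
    rw [evalP_cast, castMat_apply]
    simp only [evalP, Matrix.one_apply, fst_append, snd_append]
    rw [supp_eq_empty hm, splitCoeff_empty_right]
    refine if_congr ?_ rfl rfl
    rw [← (supp_upw_injective (k + m)).eq_iff, supp_cast, supp_cast, supp_append, supp_eq_empty hm,
      Finset.union_empty, eq_comm]
  · obtain ⟨a, b, rfl⟩ := exists_append (upw k) t
    rw [evalP_cast, castMat_apply]
    simp only [evalP, Matrix.one_apply, fst_append, snd_append]
    rw [supp_eq_empty hk, splitCoeff_empty_left]
    refine if_congr ?_ rfl rfl
    rw [← (supp_upw_injective (k + m)).eq_iff, supp_cast, supp_cast, supp_append, supp_eq_empty hk,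
      Finset.empty_union, eq_comm]

/-- A sum over the right leg of a split has one term, the complement of the left leg. -/
theorem sum_splitCoeff {b : ℕ} {C S : Finset (Idx l)} (h : S.card = C.card + b)
    (f : Finset (Idx l) → 𝕜) :
    ∑ B, splitCoeff q C (supp (upw b) B) S * f (supp (upw b) B) =
      splitCoeff q C (S \ C) S * f (S \ C) := by
  rw [sum_upw b (fun B => splitCoeff q C B S * f B), Finset.sum_eq_single (S \ C)]
  · by_cases hC : C ⊆ S
    · rw [if_pos]
      rw [Finset.card_sdiff_of_subset hC]; omega
    · rw [splitCoeff_eq_zero q fun e => hC (Finset.subset_union_left.trans e.2.ge)]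
      simp
  · intro B _ hB
    rw [splitCoeff_eq_zero q fun e => hB (by rw [e.2, Finset.union_sdiff_cancel_left e.1])]
    simp
  · simp

theorem sum_mergeCoeff_left {a : ℕ} {C V : Finset (Idx l)} (h : V.card = C.card + a)
    (f : Finset (Idx l) → 𝕜) :
    ∑ A, mergeCoeff q C (supp (upw a) A) V * f (supp (upw a) A) =
      mergeCoeff q C (V \ C) V * f (V \ C) := by
  rw [sum_upw a (fun A => mergeCoeff q C A V * f A), Finset.sum_eq_single (V \ C)]
  · by_cases hC : C ⊆ V
    · rw [if_pos]
      rw [Finset.card_sdiff_of_subset hC]; omega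
    · rw [mergeCoeff_eq_zero q fun e => hC (Finset.subset_union_left.trans e.2.ge)]
      simp
  · intro B _ hB
    rw [mergeCoeff_eq_zero q fun e => hB (by rw [e.2, Finset.union_sdiff_cancel_left e.1])]
    simp
  · simp

theorem sum_mergeCoeff {m : ℕ} {B T : Finset (Idx l)} (h : B.card + T.card = m)
    (f : Finset (Idx l) → 𝕜) :
    ∑ U, mergeCoeff q B T (supp (upw m) U) * f (supp (upw m) U) =
      mergeCoeff q B T (B ∪ T) * f (B ∪ T) := by
  rw [sum_upw m (fun U => mergeCoeff q B T U * f U), Finset.sum_eq_single (B ∪ T)]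
  · by_cases hd : Disjoint B T
    · rw [if_pos]
      rw [Finset.card_union_of_disjoint hd]; omega
    · rw [mergeCoeff_eq_zero q fun e => hd e.1]
      simp
  · intro U _ hU
    rw [mergeCoeff_eq_zero q fun e => hU e.2]
    simp
  · simp

/-- The contribution of `C` to the entry of a ladder from `S ⊗ T` to `V ⊗ W`, where `C` is the part
of `S` which stays on the left strand. -/
def ladderCoeff (S T V W C : Finset (Idx l)) : 𝕜 :=
  splitCoeff q C (S \ C) S * (mergeCoeff q (S \ C) T (S \ C ∪ T) *
    (mergeCoeff q C (V \ C) V * splitCoeff q (V \ C) W (S \ C ∪ T)))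

/-- The entries of a ladder in the bases of subsets: given the part `C` of `S` which stays on the
left strand, all other intermediate subsets are determined. -/
theorem evalP_ladder_apply (c b a : ℕ) (s t v w) :
    evalP l q (PDiag.ladder (𝕜 := 𝕜) c b a) (append (upw (c + a)) v w) (append (upw (c + b)) s t) =
      ∑ C : Finset (Idx l), if C.card = c then
        ladderCoeff q (supp _ s) (supp _ t) (supp _ v) (supp _ w) C else 0 := by
  rw [← sum_upw c (fun C => ladderCoeff q (supp _ s) (supp _ t) (supp _ v) (supp _ w) C)]
  simp only [PDiag.ladder, evalP, evalP_cast, Matrix.mul_apply, castMat_apply, tensorMat_apply,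
    sum_append, fst_append, snd_append, cast_append_assoc, cast_append_assoc_symm, Matrix.one_apply,
    evalP_mergeN_apply, evalP_splitN_apply, supp_cast, cast_rfl]
  simp only [mul_ite, ite_mul, mul_zero, zero_mul, mul_one, one_mul, Finset.sum_ite_eq,
    Finset.sum_ite_eq', Finset.sum_ite_irrel, Finset.sum_const_zero, Finset.mem_univ, if_true]
  refine Finset.sum_congr rfl fun C _ => ?_
  have h₁ (U : Finset (Idx l)) := sum_mergeCoeff_left q (a := a) (C := supp _ C) (V := supp _ v)
    (by simp only [card_supp_upw]) (fun A => splitCoeff q A (supp _ w) U)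
  have h₂ (B : BasisIdx l (upw b)) :=
    sum_mergeCoeff q (m := b + (c + a)) (B := supp _ B) (T := supp _ t)
      (by simp only [card_supp_upw]) (fun U => mergeCoeff q (supp _ C)
        (supp _ v \ supp _ C) (supp _ v) * splitCoeff q (supp _ v \ supp _ C) (supp _ w) U)
  simp only [h₁]
  simp only [mul_comm _ (mergeCoeff q (supp _ _) (supp _ t) _), h₂]
  simp only [mul_comm _ (splitCoeff q (supp _ C) _ _)]
  exact sum_splitCoeff q (b := b) (C := supp _ C) (S := supp _ s) (by simp only [card_supp_upw])
    (fun B => mergeCoeff q B (supp _ t) (B ∪ supp _ t) * (mergeCoeff q (supp _ C)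
      (supp _ v \ supp _ C) (supp _ v) * splitCoeff q (supp _ v \ supp _ C) (supp _ w)
        (B ∪ supp _ t)))

end Ladder

/-! ### Crossings at `q = 1` -/

section ClassicalCrossing

variable {d : ℕ} {l : Fin d → ℕ} {𝕜 : Type u} [Field 𝕜]

open BasisIdx

theorem qpow_neg_one_natCast (n : ℕ) : qpow (-1 : 𝕜ˣ) (n : ℤ) = (-1) ^ n := by simp [qpow]

theorem qpow_neg_one_neg_natCast (n : ℕ) : qpow (-1 : 𝕜ˣ) (-(n : ℤ)) = (-1) ^ n := by
  rw [← qpow_neg_one_natCast]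
  simp [qpow, ← inv_pow]

/-- The exponent of the sign with which `C` contributes to the entry of a ladder from `S ⊗ T` to
`V ⊗ W`, where `B` is the complement of `C` in `S` and `A` is the complement of `C` in `V`. -/
def ladderExp (T W C B A : Finset (Idx l)) : ℕ :=
  C.card * B.card + ltCount C B + ltCount T B + A.card * W.card + ltCount A W + ltCount A C

theorem ladderCoeff_one (S T V W C : Finset (Idx l)) :
    ladderCoeff (1 : 𝕜ˣ) S T V W C =
      if C ⊆ S ∧ C ⊆ V ∧ Disjoint (S \ C) T ∧ Disjoint (V \ C) W ∧ V \ C ∪ W = S \ C ∪ T then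
        (-1) ^ ladderExp T W C (S \ C) (V \ C) else 0 := by
  have h (X : Finset (Idx l)) : X = C ∪ X \ C ↔ C ⊆ X := by
    rw [eq_comm, Finset.union_sdiff_self_eq_union, Finset.union_eq_right]
  simp only [ladderCoeff, splitCoeff, mergeCoeff, h, Finset.disjoint_sdiff, true_and,
    qpow_neg_one_natCast, qpow_neg_one_neg_natCast, and_true]
  split_ifs <;> simp_all [ladderExp, pow_add]
  ring

/-- Moving an element `x` from `A` and `B` to `C` changes the sign. -/
theorem odd_ladderExp_add {T W C B A : Finset (Idx l)} {x : Idx l} (hC : x ∉ C) (hB : x ∉ B)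
    (hA : x ∉ A) (hW : x ∉ W) (hBT : Disjoint B T) (hAW : Disjoint A W) (h : B ∪ T = A ∪ W) :
    Odd (ladderExp T W C (insert x B) (insert x A) + C.card +
      (ladderExp T W (insert x C) B A + (insert x C).card)) := by
  have hi (X : Finset (Idx l)) : insert x X = {x} ∪ X := Finset.insert_eq x X
  have hd {X : Finset (Idx l)} (hX : x ∉ X) : Disjoint {x} X := Finset.disjoint_singleton_left.2 hX
  have e₁ := ltCount_add_ltCount (hd hC)
  have e₂ := ltCount_add_ltCount (hd hB)
  have e₃ := ltCount_add_ltCount (hd hW)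
  have e₄ : ltCount B {x} + ltCount T {x} = ltCount A {x} + ltCount W {x} := by
    rw [← ltCount_union_left hBT, h, ltCount_union_left hAW]
  simp only [Finset.card_singleton, one_mul] at e₁ e₂ e₃
  have e₅ : ltCount {x} {x} = 0 := by simp [ltCount]
  simp only [ladderExp, Finset.card_insert_of_notMem hC, Finset.card_insert_of_notMem hB,
    Finset.card_insert_of_notMem hA]
  simp only [hi, ltCount_union_left (hd hC), ltCount_union_left (hd hA),
    ltCount_union_right (hd hC), ltCount_union_right (hd hB), add_mul, mul_add, one_mul, mul_one]
  generalize C.card * B.card = m₁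
  generalize A.card * W.card = m₂
  rw [Nat.odd_iff]
  omega

/-- The sign with which a ladder swaps `S = C ∪ B` and `T = C ∪ A`, for `C = S ∩ T`, is
`(-1) ^ (|C| + |S| |T|)`. -/
theorem even_ladderExp_add {C B A : Finset (Idx l)} (hCB : Disjoint C B) (hCA : Disjoint C A) :
    Even (ladderExp (C ∪ A) (C ∪ B) C B A + C.card + (C ∪ B).card * (C ∪ A).card) := by
  simp only [ladderExp, ltCount_union_left hCA, ltCount_union_right hCB,
    Finset.card_union_of_disjoint hCB, Finset.card_union_of_disjoint hCA, add_mul, mul_add]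
  have h := Nat.even_mul_succ_self C.card
  rw [mul_add, mul_one, Nat.even_iff] at h
  rw [mul_comm A.card C.card, mul_comm A.card B.card, mul_comm B.card C.card, Nat.even_iff]
  omega

/-- The signed sum of all ladders is the swap up to sign: if some `x` lies in `S ∩ V` and not in
`T`, then the terms with `x ∈ C` cancel those with `x ∉ C`. -/
theorem sum_ladderCoeff_one {S T V W : Finset (Idx l)} (hV : V.card = T.card)
    (hW : W.card = S.card) :
    ∑ C, (-1) ^ C.card * ladderCoeff (1 : 𝕜ˣ) S T V W C =
      if V = T ∧ W = S then (-1) ^ (S.card * T.card) else 0 := by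
  simp only [ladderCoeff_one]
  by_cases hx : ∃ x, x ∈ S ∧ x ∈ V ∧ x ∉ T
  · obtain ⟨x, hS, hxV, hT⟩ := hx
    -- pair `C` with `insert x C`
    rw [if_neg (fun e : V = T ∧ W = S => hT (e.1 ▸ hxV)), ← Finset.powerset_univ,
      ← Finset.insert_erase (Finset.mem_univ x), Finset.sum_powerset_insert (by simp),
      ← Finset.sum_add_distrib]
    refine Finset.sum_eq_zero fun C hC => ?_
    have hxC : x ∉ C := fun h => by simpa using Finset.mem_powerset.1 hC h
    obtain ⟨B, hB⟩ : ∃ B, S \ insert x C = B := ⟨_, rfl⟩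
    obtain ⟨A, hA⟩ : ∃ A, V \ insert x C = A := ⟨_, rfl⟩
    have hxB : x ∉ B := by simp [← hB]
    have hxA : x ∉ A := by simp [← hA]
    have hB' : S \ C = insert x B := by
      rw [← hB, Finset.sdiff_insert, Finset.insert_erase (by simp [hS, hxC])]
    have hA' : V \ C = insert x A := by
      rw [← hA, Finset.sdiff_insert, Finset.insert_erase (by simp [hxV, hxC])]
    have hU : x ∉ W → (insert x A ∪ W = insert x B ∪ T ↔ A ∪ W = B ∪ T) := by
      intro hxW
      rw [Finset.insert_union, Finset.insert_union]
      refine ⟨fun e => ?_, fun e => by rw [e]⟩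
      rw [← Finset.erase_insert (s := A ∪ W) (a := x) (by simp [hxA, hxW]), e,
        Finset.erase_insert (by simp [hxB, hT])]
    have hxW (e : A ∪ W = B ∪ T) : x ∉ W := fun h => by
      have : x ∈ B ∪ T := e ▸ Finset.mem_union_right A h
      simp [hxB, hT] at this
    simp only [hB, hA, hB', hA', Finset.insert_subset_iff, hS, hxV, true_and,
      Finset.disjoint_insert_left, hT, not_false_eq_true]
    by_cases h : C ⊆ S ∧ C ⊆ V ∧ Disjoint B T ∧ Disjoint A W ∧ A ∪ W = B ∪ T
    · obtain ⟨h₁, h₂, h₃, h₄, h₅⟩ := h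
      have hW' := hxW h₅
      rw [if_pos ⟨h₁, h₂, h₃, ⟨hW', h₄⟩, (hU hW').2 h₅⟩, if_pos ⟨h₁, h₂, h₃, h₄, h₅⟩,
        ← pow_add, ← pow_add]
      have hodd := odd_ladderExp_add hxC hxB hxA hW' h₃ h₄ h₅.symm
      rw [add_comm C.card, add_comm (insert x C).card]
      rcases Nat.even_or_odd (ladderExp T W C (insert x B) (insert x A) + C.card) with he | he
      · rw [he.neg_one_pow, (by
          rcases Nat.even_or_odd (ladderExp T W (insert x C) B A + (insert x C).card) with h' | h'
          · exact absurd hodd (Nat.not_odd_iff_even.2 (he.add h'))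
          · exact h' :
          Odd (ladderExp T W (insert x C) B A + (insert x C).card)).neg_one_pow]
        ring
      · rw [he.neg_one_pow, (Nat.odd_add.1 hodd |>.1 he :
          Even (ladderExp T W (insert x C) B A + (insert x C).card)).neg_one_pow]
        ring
    · rw [if_neg (fun e => h ⟨e.1, e.2.1, e.2.2.1, e.2.2.2.1.2, (hU e.2.2.2.1.1).1 e.2.2.2.2⟩),
        if_neg h]
      ring
  · push Not at hx
    -- without such an `x`, a nonzero term must have `C = S ∩ T`
    rw [Finset.sum_eq_single (S ∩ T)]
    · by_cases h : V = T ∧ W = S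
      · obtain ⟨rfl, rfl⟩ := h
        have hB : W \ (W ∩ V) = W \ V := Finset.sdiff_inter_self_left W V
        have hA : V \ (W ∩ V) = V \ W := Finset.sdiff_inter_self_right V W
        rw [if_pos (⟨rfl, rfl⟩ : V = V ∧ W = W), hB, hA, if_pos]
        · have he := even_ladderExp_add (C := W ∩ V) (B := W \ V) (A := V \ W)
            (Finset.disjoint_sdiff_inter W V).symm
            (by rw [Finset.inter_comm]; exact (Finset.disjoint_sdiff_inter V W).symm)
          have h₁ : W ∩ V ∪ V \ W = V := by rw [Finset.inter_comm]; exact sup_inf_sdiff V W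
          have h₂ : W ∩ V ∪ W \ V = W := sup_inf_sdiff W V
          rw [h₂, h₁, add_comm (ladderExp _ _ _ _ _)] at he
          rw [← pow_add]
          exact neg_one_pow_congr (Nat.even_add.1 he)
        · exact ⟨Finset.inter_subset_left, Finset.inter_subset_right, Finset.sdiff_disjoint,
            Finset.sdiff_disjoint, by rw [Finset.sdiff_union_self_eq_union,
              Finset.sdiff_union_self_eq_union, Finset.union_comm]⟩
      · rw [if_neg h, if_neg, mul_zero]
        rintro ⟨-, -, -, -, hU⟩
        apply h
        have hVT : V ⊆ T := fun x hxV => by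
          by_contra hT
          have hS : x ∉ S := fun hS => hT (hx x hS hxV)
          have : x ∈ S \ (S ∩ T) ∪ T := hU ▸ Finset.mem_union_left W (by simp [hxV, hS])
          simp [hS, hT] at this
        have hSW : S ⊆ W := fun x hS => by
          by_contra hxW
          have : x ∈ V \ (S ∩ T) ∪ W := hU ▸ by simp [hS]
          simp only [Finset.mem_union, Finset.mem_sdiff, Finset.mem_inter, hxW, or_false] at this
          exact this.2 ⟨hS, hx x hS this.1⟩
        exact ⟨Finset.eq_of_subset_of_card_le hVT hV.ge,
          (Finset.eq_of_subset_of_card_le hSW hW.le).symm⟩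
    · intro C _ hC
      rw [if_neg, mul_zero]
      rintro ⟨hCS, hCV, hd, -⟩
      refine hC (Finset.ext fun x => ?_)
      have := Finset.disjoint_left.1 hd
      specialize @this x
      simp only [Finset.mem_sdiff, Finset.mem_inter] at this ⊢
      exact ⟨fun h => ⟨hCS h, hx x (hCS h) (hCV h)⟩,
        fun h => by_contra fun h' => this ⟨h.1, h'⟩ h.2⟩
    · simp

theorem evalP_sum (q : 𝕜ˣ) {K L : Word} (N : ℕ) (f : ℕ → PDiag 𝕜 K L) :
    evalP l q (PDiag.sum N f) = ∑ i ∈ Finset.range N, evalP l q (f i) := by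
  induction N with
  | zero => rfl
  | succ N ih => rw [Finset.sum_range_succ, ← ih]; rfl

theorem cast_append {K K' L L' : Word} (hK : K = K') (hL : L = L') (h : K ++ L = K' ++ L')
    (a : BasisIdx l K) (b : BasisIdx l L) :
    BasisIdx.cast h (append K a b) = append K' (BasisIdx.cast hK a) (BasisIdx.cast hL b) := by
  subst hK hL; rfl

theorem evalP_crossN_one (front : Bool) (k m : ℕ) :
    evalP l 1 (PDiag.crossN (1 : 𝕜ˣ) front k m) = rotMat (upw k) (upw m) (idMat l 𝕜 (upw k)) := by
  ext t s
  obtain ⟨v, w, rfl⟩ := exists_append (upw m) t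
  obtain ⟨s, t, rfl⟩ := exists_append (upw k) s
  have key := sum_ladderCoeff_one (𝕜 := 𝕜) (S := supp _ s) (T := supp _ t) (V := supp _ v)
    (W := supp _ w) (by simp only [card_supp_upw]) (by simp only [card_supp_upw])
  have hterm (c : ℕ) : evalP l (1 : 𝕜ˣ) (if h : c ≤ k ∧ c ≤ m then
      PDiag.smul (qpow (-1 : 𝕜ˣ) (if front then (c : ℤ) else -(c : ℤ)))
        ((PDiag.ladder c (k - c) (m - c)).cast
          (by rw [Nat.add_sub_cancel' h.1, Nat.add_sub_cancel' h.2])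
          (by rw [Nat.add_sub_cancel' h.1, Nat.add_sub_cancel' h.2]))
      else PDiag.zero _ _) (append (upw m) v w) (append (upw k) s t) =
      ∑ C : Finset (Idx l), if C.card = c then
        (-1) ^ C.card * ladderCoeff (1 : 𝕜ˣ) (supp _ s) (supp _ t) (supp _ v) (supp _ w) C
        else 0 := by
    by_cases h : c ≤ k ∧ c ≤ m
    · rw [dif_pos h]
      have hs : k = c + (k - c) := by omega
      have ht : m = c + (m - c) := by omega
      simp only [evalP, Matrix.smul_apply, evalP_cast, castMat_apply]
      rw [cast_append (congrArg upw hs) (congrArg upw ht),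
        cast_append (congrArg upw ht) (congrArg upw hs), evalP_ladder_apply, smul_eq_mul,
        Finset.mul_sum]
      refine Finset.sum_congr rfl fun C _ => ?_
      simp only [supp_cast, mul_ite, mul_zero]
      refine if_ctx_congr Iff.rfl (fun hC => ?_) fun _ => rfl
      rw [hC]
      cases front
      · simp [qpow_neg_one_neg_natCast]
      · simp [qpow_neg_one_natCast]
    · rw [dif_neg h]
      change (0 : 𝕜) = _
      symm
      refine Finset.sum_eq_zero fun C _ => ?_
      split_ifs with hC
      · rw [ladderCoeff_one, if_neg, mul_zero]
        rintro ⟨h₁, h₂, -⟩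
        refine h ⟨?_, ?_⟩
        · simpa [hC, card_supp_upw] using Finset.card_le_card h₁
        · simpa [hC, card_supp_upw] using Finset.card_le_card h₂
      · rfl
  simp only [PDiag.crossN, evalP, evalP_sum, Matrix.smul_apply, Matrix.sum_apply]
  rw [Finset.sum_congr rfl fun c _ => hterm c, Finset.sum_comm]
  have hC (C : Finset (Idx l)) : (∑ c ∈ Finset.range (k + 1), if C.card = c then
      (-1) ^ C.card * ladderCoeff (1 : 𝕜ˣ) (supp _ s) (supp _ t) (supp _ v) (supp _ w) C else 0) =
      (-1) ^ C.card * ladderCoeff (1 : 𝕜ˣ) (supp _ s) (supp _ t) (supp _ v) (supp _ w) C := by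
    rw [Finset.sum_ite_eq, ite_eq_left_iff]
    intro h
    rw [ladderCoeff_one, if_neg, mul_zero]
    rintro ⟨h₁, -⟩
    refine h (Finset.mem_range.2 (Nat.lt_succ_of_le ?_))
    simpa [card_supp_upw] using Finset.card_le_card h₁
  simp only [hC, key, card_supp_upw, smul_eq_mul, mul_ite, mul_zero, ← mul_pow, rotMat_apply,
    fst_append, snd_append, Matrix.one_apply, (supp_upw_injective _).eq_iff, ite_and]
  simp

theorem evalP_cross_one (front : Bool) (x y : Label) :
    evalP l 1 (PDiag.cross (1 : 𝕜ˣ) front x y) = rotMat [x] [y] (idMat l 𝕜 [x]) := by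
  have huu (front : Bool) (k m : ℕ+) : evalP l 1 (PDiag.crossUU (1 : 𝕜ˣ) front k m) =
      rotMat [.up k] [.up m] (idMat l 𝕜 [.up k]) := by
    rw [PDiag.crossUU, evalP_cast, evalP_crossN_one]
    have h {K L K' L' : Word} (hK : K = K') (hL : L = L') (h₁ : K ++ L = K' ++ L')
        (h₂ : L ++ K = L' ++ K') :
        castMat h₁ h₂ (rotMat K L (idMat l 𝕜 K)) = rotMat K' L' (idMat l 𝕜 K') := by
      subst hK hL; rfl
    exact h (upw_pnat k) (upw_pnat m) _ _
  have hL (k : ℕ+) (y : Label) (X : PDiag 𝕜 [y, .up k] [.up k, y])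
      (h : evalP l 1 X = rotMat [y] [.up k] (idMat l 𝕜 [y])) :
      evalP l 1 (PDiag.mateL k y X) = rotMat [.dn k] [y] (idMat l 𝕜 [.dn k]) := by
    rw [← mateL_swap, ← h]; rfl
  have hR (k : ℕ+) (y : Label) (X : PDiag 𝕜 [.up k, y] [y, .up k])
      (h : evalP l 1 X = rotMat [.up k] [y] (idMat l 𝕜 [.up k])) :
      evalP l 1 (PDiag.mateR y k X) = rotMat [y] [.dn k] (idMat l 𝕜 [y]) := by
    rw [← mateR_swap, ← h]; rfl
  cases x with
  | up k => cases y with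
    | up m => exact huu front k m
    | dn m => exact hR m (.up k) _ (huu _ _ _)
  | dn k => cases y with
    | up m => exact hL k (.up m) _ (huu _ _ _)
    | dn m => exact hL k (.dn m) _ (hL m (.up k) _ (huu _ _ _))

theorem evalP_pushFront_one (x : Label) : (L : Word) →
    evalP l 1 (PDiag.pushFront (1 : 𝕜ˣ) x L) = rotMat [x] L (idMat l 𝕜 [x])
  | [] => (rotMat_singleton_nil x).symm
  | y :: L => by
    rw [← rotMat_cons, ← evalP_pushFront_one x L, ← evalP_cross_one true x y]; rfl

theorem evalP_pushBack_one (x : Label) : (L : Word) →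
    evalP l 1 (PDiag.pushBack (1 : 𝕜ˣ) x L) = rotMat [x] L (idMat l 𝕜 [x])
  | [] => (rotMat_singleton_nil x).symm
  | y :: L => by
    rw [← rotMat_cons, ← evalP_pushBack_one x L, ← evalP_cross_one false x y]; rfl

theorem evalP_pullFront_one (x : Label) : (L : Word) →
    evalP l 1 (PDiag.pullFront (1 : 𝕜ˣ) x L) = rotMat L [x] (idMat l 𝕜 L)
  | [] => (rotMat_nil_singleton x).symm
  | y :: L => by
    rw [← rotMat_snoc, ← evalP_pullFront_one x L, ← evalP_cross_one false y x]; rfl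

theorem evalP_pullBack_one (x : Label) : (L : Word) →
    evalP l 1 (PDiag.pullBack (1 : 𝕜ˣ) x L) = rotMat L [x] (idMat l 𝕜 L)
  | [] => (rotMat_nil_singleton x).symm
  | y :: L => by
    rw [← rotMat_snoc, ← evalP_pullBack_one x L, ← evalP_cross_one true y x]; rfl

end ClassicalCrossing

/-! ### Levi crossings at `q = 1` -/

section Casts

variable {d : ℕ} {l : Fin d → ℕ} {𝕜 : Type u} [Field 𝕜]

open BasisIdx

theorem castMat_mul {K K' L L' M M' : Word} (hK : K = K') (hL hL' : L = L') (hM : M = M')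
    (f : Mat l 𝕜 K L) (g : Mat l 𝕜 L M) :
    castMat hL' hM g * castMat hK hL f = castMat hK hM (g * f) := by
  subst hK hL hM; rfl

theorem castMat_smul_one {K K' : Word} (h h' : K = K') (c : 𝕜) :
    castMat h h' (c • (1 : Mat l 𝕜 K K)) = c • (1 : Mat l 𝕜 K' K') := by
  subst h; rfl

theorem castMat_one {K K' : Word} (h h' : K = K') :
    castMat h h' (1 : Mat l 𝕜 K K) = (1 : Mat l 𝕜 K' K') := by
  subst h; rfl

theorem tensorMat_one_smul_one (c : 𝕜) (K L : Word) :
    tensorMat (idMat l 𝕜 K) (c • idMat l 𝕜 L) = c • (1 : Mat l 𝕜 (K ++ L) (K ++ L)) := by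
  rw [← tensorMat_one K L]
  ext t s
  simp only [tensorMat_apply, Matrix.smul_apply, smul_eq_mul]
  ring

end Casts

section LeviCrossing

variable {d : ℕ} {l : Fin d → ℕ} {𝕜 : Type u} [Field 𝕜] {q : 𝕜ˣ} {u : Fin d → 𝕜ˣ}

open BasisIdx

theorem qfac_one (q : 𝕜ˣ) : qfac q 1 = 1 := by simp [qfac, qint]

theorem qbinom_one_right (q : 𝕜ˣ) (a : ℕ) : qbinom q a 1 = qint q a := by
  rw [qbinom, qfac_one]
  rcases Nat.eq_zero_or_pos a with rfl | h
  · simp [qintZ, qint]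
  · simp [qintZ, Int.sign_eq_one_of_pos (Int.natCast_pos.2 h)]

theorem AnnularFunctor.evalP_mergeN_mul_splitN (F : AnnularFunctor l q u) (k : ℕ) :
    evalP l q (PDiag.mergeN 1 k) * evalP l q (PDiag.splitN 1 k) =
      qint q (1 + k) • (1 : Mat l 𝕜 (upw (1 + k)) (upw (1 + k))) := by
  by_cases hk : 0 < k
  · have h := F.evalP_eq_of_rel (.digon 1 ⟨k, hk⟩)
    rw [PDiag.mergeN, PDiag.splitN, dif_pos Nat.one_pos, dif_pos hk, dif_pos Nat.one_pos,
      dif_pos hk, evalP_cast, evalP_cast, castMat_mul]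
    have h' : evalP l q (.gen (.merge 1 ⟨k, hk⟩)) * evalP l q (.gen (.split 1 ⟨k, hk⟩)) =
      qint q (1 + k) • (1 : Mat l 𝕜 [.up (1 + ⟨k, hk⟩)] [.up (1 + ⟨k, hk⟩)]) := by
      refine h.trans ?_
      rw [← qbinom_one_right]
      rfl
    exact (congrArg (castMat _ _) h').trans (castMat_smul_one _ _ _)
  · obtain rfl : k = 0 := by omega
    rw [PDiag.mergeN, PDiag.splitN, dif_pos Nat.one_pos, dif_neg hk, dif_pos Nat.one_pos,
      dif_neg hk, evalP_cast, evalP_cast, castMat_mul]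
    have : qint q (1 + 0) = 1 := by simp [qint]
    rw [this, one_smul]
    simp only [evalP]
    rw [Matrix.one_mul, castMat_one]

/-- Exploding a strand of thickness `k` into thin strands and merging them again is multiplication
by `[k]!`. -/
theorem AnnularFunctor.evalP_implode_mul_explode (F : AnnularFunctor l q u) : (k : ℕ) →
    evalP l q (implode 𝕜 k) * evalP l q (explode 𝕜 k) =
      qfac q k • (1 : Mat l 𝕜 (upw k) (upw k))
  | 0 => by
    rw [implode, explode, evalP_cast, evalP_cast, castMat_mul]
    simp only [evalP, qfac, Finset.range_zero, Finset.prod_empty, one_smul]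
    rw [Matrix.one_mul, castMat_one]
  | k + 1 => by
    simp only [implode, explode, evalP, evalP_cast]
    rw [Matrix.mul_assoc, ← Matrix.mul_assoc (castMat _ _ (tensorMat _ _)), castMat_mul,
      tensorMat_mul, F.evalP_implode_mul_explode k, Matrix.one_mul, tensorMat_one_smul_one,
      castMat_smul_one, Matrix.smul_mul, Matrix.one_mul, Matrix.mul_smul, castMat_mul,
      F.evalP_mergeN_mul_splitN, castMat_smul_one, smul_smul, qfac, qfac,
      Finset.prod_range_succ, add_comm 1 k]

theorem elt_injective : Function.Injective (elt : {S : Finset (Idx l) // S.card = 1} → Idx l) := by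
  intro S T h
  rw [Subtype.ext_iff, elt_spec S, elt_spec T, h]

theorem leviCoeff_one (pos : Bool) (a b c e : Idx l) :
    leviCoeff (1 : 𝕜ˣ) pos a b c e = if c = b ∧ e = a then 1 else 0 := by
  unfold leviCoeff
  simp only [qpow_one_unit, sub_self, ite_self, add_zero]
  split_ifs <;> simp_all

theorem leviThin_one (pos : Bool) :
    leviThin l (1 : 𝕜ˣ) pos = rotMat [.up 1] [.up 1] (idMat l 𝕜 [.up 1]) := by
  ext t s
  obtain ⟨a, t, rfl⟩ := exists_cons t
  obtain ⟨b, t, rfl⟩ := exists_cons t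
  obtain ⟨c, s, rfl⟩ := exists_cons s
  obtain ⟨e, s, rfl⟩ := exists_cons s
  obtain rfl := eq_nil t
  obtain rfl := eq_nil s
  simp only [leviThin, Matrix.of_apply, leviCoeff_one, rotMat_apply, Matrix.one_apply, cons_fst,
    cons_snd, fst_cons, snd_cons, fst_nil, snd_nil, cons_inj, ← ite_and, and_true]
  refine if_congr (and_congr ?_ ?_) rfl rfl
  · exact elt_injective.eq_iff
  · exact elt_injective.eq_iff

theorem thinPast_one : (m : ℕ) → thinPast l (1 : 𝕜ˣ) m = rotMat [.up 1] (ones m) (idMat l 𝕜 [.up 1])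
  | 0 => (rotMat_singleton_nil _).symm
  | m + 1 => by
    rw [thinPast, thinPast_one m, leviThin_one]
    exact rotMat_cons _ _ _

theorem thinBack_one : (m : ℕ) →
    thinBack l (1 : 𝕜ˣ) m = rotMat (ones m) [.up 1] (idMat l 𝕜 (ones m))
  | 0 => (rotMat_nil_singleton _).symm
  | m + 1 => by
    rw [thinBack, thinBack_one m, leviThin_one]
    exact rotMat_snoc _ _ _

theorem qfac_one_unit_ne_zero [CharZero 𝕜] (k : ℕ) : qfac (1 : 𝕜ˣ) k ≠ 0 := by
  rw [qfac, Finset.prod_ne_zero_iff]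
  intro i _
  simpa [qint] using Nat.cast_add_one_ne_zero i

theorem rotMat_smul (X K : Word) {Y : Word} (c : 𝕜) (C : Mat l 𝕜 X Y) :
    rotMat X K (c • C) = c • rotMat X K C := by
  ext t s
  simp [rotMat_apply]

theorem AnnularFunctor.implode_mul_explode_cast (F : AnnularFunctor l q u) (k : ℕ+) :
    evalP l q ((implode 𝕜 k).cast rfl (upw_pnat k)) *
      evalP l q ((explode 𝕜 k).cast (upw_pnat k) rfl) =
      qfac q k • (1 : Mat l 𝕜 [.up k] [.up k]) := by
  rw [evalP_cast, evalP_cast, castMat_mul, F.evalP_implode_mul_explode, castMat_smul_one]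

/-- At `q = 1` the thin Levi crossings are swaps, so the implosion can be moved past them to meet
the explosion, and their composition `k!` is cancelled by the normalization. -/
theorem AnnularFunctor.leviUp_one [CharZero 𝕜] (F : AnnularFunctor l (1 : 𝕜ˣ) u) (k : ℕ+) :
    leviUp l (1 : 𝕜ˣ) k = rotMat [.up 1] [.up k] (idMat l 𝕜 [.up 1]) := by
  rw [leviUp, thinPast_one]
  have h := tensorMat_mul_rotMat' [.up 1] (idMat l 𝕜 [.up 1])
    (evalP l (1 : 𝕜ˣ) ((implode 𝕜 k).cast rfl (upw_pnat k)))
  simp only [compMat]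
  refine (congrArg (_ • ·) (congrArg (· * _) h)).trans ?_
  rw [Matrix.mul_assoc]
  refine (congrArg (fun M => _ • (_ * M)) (tensorMat_mul _ _ _ _)).trans ?_
  rw [F.implode_mul_explode_cast, Matrix.one_mul, tensorMat_one_smul_one, Matrix.mul_smul,
    smul_smul, inv_mul_cancel₀ (qfac_one_unit_ne_zero _), one_smul, Matrix.mul_one]

theorem AnnularFunctor.leviUpInv_one [CharZero 𝕜] (F : AnnularFunctor l (1 : 𝕜ˣ) u) (k : ℕ+) :
    leviUpInv l (1 : 𝕜ˣ) k = rotMat [.up k] [.up 1] (idMat l 𝕜 [.up k]) := by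
  rw [leviUpInv, thinBack_one]
  simp only [compMat]
  refine (congrArg (_ • ·) (congrArg (· * _) (tensorMat_mul_rotMat (ones k) [.up 1] _ _))).trans ?_
  refine (congrArg (_ • ·) (rotMat_mul_tensorMat [.up k] [.up 1] _ _)).trans ?_
  rw [Matrix.mul_one, F.implode_mul_explode_cast, rotMat_smul, smul_smul,
    inv_mul_cancel₀ (qfac_one_unit_ne_zero _), one_smul]

theorem AnnularFunctor.leviCross_one [CharZero 𝕜] (F : AnnularFunctor l (1 : 𝕜ˣ) u) (y : Label) :
    leviCross l (1 : 𝕜ˣ) y = rotMat [.up 1] [y] (idMat l 𝕜 [.up 1]) := by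
  cases y with
  | up k => exact F.leviUp_one k
  | dn k =>
    rw [leviCross, leviDn, F.leviUpInv_one]
    exact mateR_swap k (.up 1)

theorem AnnularFunctor.leviPast_one [CharZero 𝕜] (F : AnnularFunctor l (1 : 𝕜ˣ) u) : (K : Word) →
    leviPast l (1 : 𝕜ˣ) K = rotMat [.up 1] K (idMat l 𝕜 [.up 1])
  | [] => (rotMat_singleton_nil _).symm
  | y :: K => by
    rw [leviPast, F.leviPast_one K, F.leviCross_one]
    exact rotMat_cons _ _ _

theorem AnnularFunctor.coilMap_one [CharZero 𝕜] (F : AnnularFunctor l (1 : 𝕜ˣ) u) (K : Word) :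
    coilMap l (1 : 𝕜ˣ) u K = rotMat [.up 1] K (blockScale u) := by
  rw [coilMap, F.leviPast_one]
  exact (rotMat_mul_tensorMat [.up 1] K _ _).trans (by rw [Matrix.one_mul])

end LeviCrossing

/-! ### Coils at `q = 1` -/

namespace AnnularFunctor

variable {d : ℕ} {l : Fin d → ℕ} {𝕜 : Type u} [Field 𝕜] {u : Fin d → 𝕜ˣ}

open BasisIdx

/-- The coils of the strands of `X` around every word `K` are rotations `x ⊗ y ↦ y ⊗ D x`, with the
same map `D` for all `K`. -/
def CoilsRotate {q : 𝕜ˣ} (F : AnnularFunctor l q u) (X : Word) : Prop :=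
  ∃ D : Mat l 𝕜 X X, ∀ K, F.mat (ADiag.coils X K) = rotMat X K D

variable {q : 𝕜ˣ} (F : AnnularFunctor l q u)

theorem mat_coils_nil (K : Word) :
    F.mat (ADiag.coils [] K) = castMat rfl (List.append_nil K).symm (1 : Mat l 𝕜 K K) := by
  rw [ADiag.coils, mat_cast]
  exact congrArg (castMat _ _) (F.mat_wid K)

theorem mat_coils_singleton (x : Label) (K : Word) :
    F.mat (ADiag.coils [x] K) = F.mat (.coil x K) := by
  rw [ADiag.coils, mat_comp, mat_cast, mat_cast, mat_coils_nil]
  ext t s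
  simp only [Matrix.mul_apply, castMat_apply, Matrix.one_apply, BasisIdx.cast_cast,
    BasisIdx.cast_inj, ite_mul, one_mul, zero_mul, Finset.sum_ite_eq, Finset.mem_univ, if_true]
  rfl

variable {F}

theorem CoilsRotate.cons {x : Label} {X : Word} (hx : F.CoilsRotate [x]) (hX : F.CoilsRotate X) :
    F.CoilsRotate (x :: X) := by
  obtain ⟨C, hC⟩ := hx
  obtain ⟨D, hD⟩ := hX
  refine ⟨tensorMat C D, fun K => ?_⟩
  rw [ADiag.coils, mat_comp, mat_cast, mat_cast, hD, ← mat_coils_singleton, hC]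
  ext t s
  obtain ⟨t, b, rfl⟩ := exists_append K t
  obtain ⟨b, c, rfl⟩ := exists_append [x] b
  obtain ⟨b, z, rfl⟩ := exists_cons b
  obtain rfl := eq_nil z
  obtain ⟨e, s, rfl⟩ := exists_cons s
  obtain ⟨s, r, rfl⟩ := exists_append X s
  simp [Matrix.mul_apply, sum_append, castMat_apply, rotMat_apply, tensorMat_apply, ite_and,
    mul_comm]

variable (F) in
/-- Generating webs slide along coils. -/
theorem mat_slide {X Y : Word} (g : PGen X Y) (K : Word) :
    F.mat (ADiag.coils Y K) * tensorMat (evalGen l q g) (idMat l 𝕜 K) =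
      tensorMat (idMat l 𝕜 K) (evalGen l q g) * F.mat (ADiag.coils X K) := by
  have h := F.mat_eq_of_rel (.slide g K)
  rwa [mat_comp, mat_comp, mat_planar, mat_planar] at h

variable (F) in
/-- Planar webs move past the coil of the first strand. -/
theorem mat_far (x : Label) {K L : Word} (p : PDiag 𝕜 K L) :
    compMat (x :: K) (x :: L) (L ++ [x]) (tensorMat (idMat l 𝕜 [x]) (evalP l q p))
        (F.mat (.coil x L)) =
      compMat (x :: K) (K ++ [x]) (L ++ [x]) (F.mat (.coil x K))
        (tensorMat (evalP l q p) (idMat l 𝕜 [x])) := by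
  have h := F.mat_eq_of_rel (.far x p)
  rwa [mat_comp, mat_comp, mat_planar, mat_planar] at h

/-- The coil of a thin upward strand is the given coil map. -/
theorem coilsRotate_up_one [CharZero 𝕜] (F : AnnularFunctor l (1 : 𝕜ˣ) u) :
    F.CoilsRotate [.up 1] :=
  ⟨blockScale u, fun K => by rw [mat_coils_singleton, ← F.coilMap_one]; exact F.map_coil K⟩

/-- A strand of thickness `k + 1` is a direct summand of two strands of thickness `1` and `k`, so
its coil is determined by theirs. -/
theorem CoilsRotate.up_one_add [CharZero 𝕜] {F : AnnularFunctor l (1 : 𝕜ˣ) u} {k : ℕ+}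
    (hk : F.CoilsRotate [.up k]) : F.CoilsRotate [.up (1 + k)] := by
  obtain ⟨D, hD⟩ := F.coilsRotate_up_one.cons hk
  have hdigon : evalGen l (1 : 𝕜ˣ) (.merge 1 k) * evalGen l 1 (.split 1 k) =
      ((k + 1 : ℕ) : 𝕜) • (1 : Mat l 𝕜 [.up (1 + k)] [.up (1 + k)]) := by
    have h := F.evalP_eq_of_rel (.digon 1 k)
    refine h.trans ?_
    have : qbinom (1 : 𝕜ˣ) ((1 + k : ℕ+) : ℕ) ((1 : ℕ+) : ℕ) = ((k + 1 : ℕ) : 𝕜) := by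
      rw [PNat.one_coe, qbinom_one_right]
      simp [qint, add_comm]
    rw [this]
    rfl
  have hne : ((k + 1 : ℕ) : 𝕜) ≠ 0 := Nat.cast_ne_zero.2 (Nat.succ_ne_zero _)
  -- split, apply the rotation of the two strands, merge, and divide by the digon `k + 1`
  refine ⟨((k + 1 : ℕ) : 𝕜)⁻¹ •
    (evalGen l (1 : 𝕜ˣ) (.merge 1 k) * (D * evalGen l (1 : 𝕜ˣ) (.split 1 k))), fun K => ?_⟩
  have h := F.mat_slide (.split 1 k) K
  rw [hD, rotMat_mul_tensorMat] at h
  rw [rotMat_smul, ← tensorMat_mul_rotMat, h, ← Matrix.mul_assoc, tensorMat_mul, Matrix.one_mul]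
  erw [hdigon]
  rw [tensorMat_one_smul_one, Matrix.smul_mul, Matrix.one_mul, smul_smul,
    inv_mul_cancel₀ hne, one_smul]

theorem coilsRotate_up [CharZero 𝕜] (F : AnnularFunctor l (1 : 𝕜ˣ) u) (k : ℕ+) :
    F.CoilsRotate [.up k] := by
  induction k using PNat.recOn with
  | one => exact F.coilsRotate_up_one
  | succ k ih => rw [add_comm]; exact ih.up_one_add

/-- The inverse of the coil of a downward strand is obtained by bending the coil of the upward
strand, since a cap slides around the annulus. -/
theorem coilsRotate_dn [CharZero 𝕜] (F : AnnularFunctor l (1 : 𝕜ˣ) u) (k : ℕ+) :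
    F.CoilsRotate [.dn k] := by
  obtain ⟨C, hC⟩ := F.coilsRotate_up k
  have hC' (K : Word) : F.mat (.coil (.up k) K) = rotMat [.up k] K C := by
    rw [← mat_coils_singleton, hC]
  obtain ⟨B, hB⟩ : ∃ B : Mat l 𝕜 [.up k] [.up k], B * C = 1 := by
    have hC₀ : F.mat (.coil (.up k) []) = C := by
      rw [hC']
      ext t s
      exact rotMat_nil_right [.up k] C t s
    exact ⟨F.mat (.coilInv (.up k) []), hC₀ ▸ F.mat_coilInv_mul_mat_coil (.up k) []⟩
  -- the transpose of the inverse of `C`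
  let B' : Mat l 𝕜 [.dn k] [.dn k] := Matrix.of fun t s =>
    B (cons (x := .up k) s.1 nil) (cons (x := .up k) t.1 nil)
  refine ⟨B', fun K => ?_⟩
  rw [mat_coils_singleton]
  -- the bent coil of the upward strand, which turns out to be the inverse coil
  let G : Mat l 𝕜 (K ++ [.dn k]) (.dn k :: K) := Matrix.of fun t s =>
    if t.2 = fst K s then C (cons (x := .up k) (snd K s).1 nil) (cons (x := .up k) t.1 nil) else 0
  have hG : G * F.mat (.coil (.dn k) K) = 1 := by
    -- Create a cup to the right of the downward strand, let both strands of the pair `dn k, up k`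
    -- wind around the annulus and cap them off. Sliding the cap first gives a zigzag (`Z * P`); sliding the cup
    -- past the first coil gives the bent coil after the downward coil (`W * Q`).
    let P : Mat l 𝕜 (.dn k :: K) (.dn k :: .up k :: .dn k :: K) :=
      tensorMat (idMat l 𝕜 [.dn k]) (tensorMat (evalGen l 1 (.cupL k)) (idMat l 𝕜 K))
    let Q : Mat l 𝕜 (K ++ [.dn k]) (.up k :: .dn k :: (K ++ [.dn k])) :=
      tensorMat (tensorMat (evalGen l 1 (.cupL k)) (idMat l 𝕜 K)) (idMat l 𝕜 [.dn k])
    let X : Mat l 𝕜 (.dn k :: .up k :: .dn k :: K) (.up k :: .dn k :: (K ++ [.dn k])) :=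
      F.mat (.coil (.dn k) (.up k :: .dn k :: K))
    let W : Mat l 𝕜 (.up k :: .dn k :: (K ++ [.dn k])) (.dn k :: (K ++ [])) :=
      compMat _ (.dn k :: (K ++ [.dn k, .up k])) _
        (castMat rfl (List.append_assoc (.dn k :: K) [.dn k] [.up k])
          (rotMat [.up k] ((.dn k :: K) ++ [.dn k]) C))
        (tensorMat (idMat l 𝕜 (.dn k :: K)) (evalGen l 1 (.capL k)))
    let Z : Mat l 𝕜 (.dn k :: .up k :: .dn k :: K) (.dn k :: (K ++ [])) :=
      compMat _ (.dn k :: K) _ (tensorMat (evalGen l 1 (.capL k)) (idMat l 𝕜 (.dn k :: K)))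
        (castMat rfl (List.append_nil (.dn k :: K)).symm 1)
    have h₁ : Z = W * X := by
      have h := F.mat_slide (.capL k) (.dn k :: K)
      rw [mat_coils_nil, ADiag.coils, mat_comp, mat_cast, mat_cast, mat_coils_singleton, hC',
        ← Matrix.mul_assoc] at h
      exact h
    have h₂ : X * P = Q * F.mat (.coil (.dn k) K) :=
      F.mat_far (.dn k) (PDiag.tensor (PDiag.gen (.cupL k)) (PDiag.wid K))
    have h₃ : Z * P = W * Q * F.mat (.coil (.dn k) K) := by
      rw [h₁, Matrix.mul_assoc, h₂, Matrix.mul_assoc]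
    have hWQ (a t s) : (W * Q) (cons a (append K t nil)) s = G (cons a t) s := by
      obtain ⟨s, b, rfl⟩ := exists_append K s
      obtain ⟨b, z, rfl⟩ := exists_cons b
      obtain rfl := eq_nil z
      have hcast (h) (e : {S : Finset (Idx l) // S.card = (Label.dn k).thick}) (r : BasisIdx l K)
          (f : {S : Finset (Idx l) // S.card = (Label.dn k).thick})
          (g : {S : Finset (Idx l) // S.card = (Label.up k).thick}) :
          BasisIdx.cast h (cons e (append K r (cons f (cons g nil)))) =
            append (.dn k :: (K ++ [.dn k])) (cons e (append K r (cons f nil))) (cons g nil) :=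
        cast_append_assoc_symm (.dn k :: K) [.dn k] [.up k] h (cons e r) (cons f nil) (cons g nil)
      simp [W, Q, G, compMat, Matrix.mul_apply, sum_append, sum_cons, rotMat_apply, castMat_apply,
        tensorMat_apply, Matrix.one_apply, evalGen, ite_and, hcast, Finset.sum_ite_irrel]
      simp only [Subtype.ext_iff, sum_ite_eq_val (x := .up k) (y := .dn k) rfl,
        sum_ite_eq_val (x := .dn k) (y := .up k) rfl]
      rfl
    have hZP (a t s) : (Z * P) (cons a (append K t nil)) s =
        (1 : Mat l 𝕜 (.dn k :: K) (.dn k :: K)) (cons a t) s := by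
      obtain ⟨b, s, rfl⟩ := exists_cons s
      have hcast (h) : BasisIdx.cast h (cons a (append K t nil)) = cons a t :=
        cast_append_nil' (.dn k :: K) h (cons a t) nil
      simp [Z, P, compMat, Matrix.mul_apply, sum_cons, castMat_apply,
        tensorMat_apply, Matrix.one_apply, evalGen, ite_and, hcast]
      simp only [Subtype.ext_iff, sum_ite_eq_val (x := .dn k) (y := .up k) rfl]
      simp only [Finset.sum_ite_irrel, Finset.sum_const_zero,
        sum_ite_val_eq (x := .dn k) (y := .dn k) rfl, sum_ite_eq_val (x := .up k) (y := .dn k) rfl]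
    ext t s
    obtain ⟨a, t, rfl⟩ := exists_cons t
    rw [← hZP, h₃, Matrix.mul_apply, Matrix.mul_apply]
    exact Finset.sum_congr rfl fun m _ => by rw [hWQ]
  let R : Mat l 𝕜 (.dn k :: K) (K ++ [.dn k]) := rotMat [.dn k] K B'
  have hGR : G * R = 1 := by
    ext t s
    obtain ⟨a, t, rfl⟩ := exists_cons t
    obtain ⟨b, s, rfl⟩ := exists_cons s
    have h : ∑ S, C (cons (x := .up k) S nil) (cons (x := .up k) a nil) *
        B (cons (x := .up k) b nil) (cons (x := .up k) S nil) = if a = b then 1 else 0 := by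
      have h := congrFun (congrFun hB (cons (x := .up k) b nil)) (cons (x := .up k) a nil)
      rw [Matrix.mul_apply, sum_cons, Matrix.one_apply] at h
      refine Eq.trans ?_ (h.trans (if_congr ?_ rfl rfl))
      · simp [mul_comm]
      · exact (cons_inj (x := .up k) b a nil nil).trans
          ((and_iff_left rfl).trans eq_comm)
    change _ = (1 : Mat l 𝕜 (.dn k :: K) (.dn k :: K)) (cons a t) (cons b s)
    rw [Matrix.one_apply]
    simp [Matrix.mul_apply, sum_append, sum_cons, rotMat_apply, G, B', R, ite_and]
    refine (if_congr Iff.rfl h rfl).trans ?_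
    split_ifs <;> rfl
  have hD := F.mat_coil_mul_mat_coilInv (.dn k) K
  have hE : G = F.mat (.coilInv (.dn k) K) := by
    rw [← Matrix.mul_one G, ← hD, ← Matrix.mul_assoc, hG, Matrix.one_mul]
  rw [← hE] at hD
  rw [← Matrix.mul_one (F.mat (.coil (.dn k) K)), ← hGR, ← Matrix.mul_assoc, hD, Matrix.one_mul]

/-- At `q = 1` the coil of a strand `x` applies a map `D` to `x` and moves it past the other strands
by a swap. -/
theorem coil_eq_rotMat [CharZero 𝕜] (F : AnnularFunctor l (1 : 𝕜ˣ) u) (x : Label) :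
    ∃ D : Mat l 𝕜 [x] [x], ∀ K, F.mat (.coil x K) = rotMat [x] K D := by
  have h : F.CoilsRotate [x] := by
    cases x with
    | up k => exact F.coilsRotate_up k
    | dn k => exact F.coilsRotate_dn k
  obtain ⟨D, hD⟩ := h
  exact ⟨D, fun K => by rw [← mat_coils_singleton, hD]⟩

end AnnularFunctor

/-! ### Annular whiskering at `q = 1` -/

namespace AnnularFunctor

variable {d : ℕ} {l : Fin d → ℕ} {𝕜 : Type u} [Field 𝕜] [CharZero 𝕜] {u : Fin d → 𝕜ˣ}
  (F : AnnularFunctor l (1 : 𝕜ˣ) u)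

open BasisIdx

/-- At `q = 1` inverse coils are rotations in the opposite direction. -/
theorem coilInv_eq (x : Label) :
    ∃ D : Mat l 𝕜 [x] [x], ∀ K t s, F.mat (.coilInv x K) t s =
      if snd [x] t = fst K s then D (fst [x] t) (snd K s) else 0 := by
  obtain ⟨D, hD⟩ := F.coil_eq_rotMat x
  obtain ⟨E, hE⟩ : ∃ E : Mat l 𝕜 [x] [x], D * E = 1 := by
    have hD₀ : F.mat (.coil x []) = D := by
      rw [hD]
      ext t s
      exact rotMat_nil_right [x] D t s
    exact ⟨F.mat (.coilInv x []), hD₀ ▸ F.mat_coil_mul_mat_coilInv x []⟩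
  refine ⟨E, fun K t s => ?_⟩
  let N : Mat l 𝕜 (K ++ [x]) (x :: K) := tensorMat E (idMat l 𝕜 K) * rotMat K [x] (idMat l 𝕜 K)
  have h₁ : F.mat (.coil x K) * N = 1 := by
    rw [hD]
    refine (Matrix.mul_assoc _ _ _).symm.trans ?_
    refine (congrArg (· * _) (rotMat_mul_tensorMat [x] K D E)).trans ?_
    simp only [hE]
    exact rotMat_one_mul K [x]
  have h₂ : F.mat (.coilInv x K) = N := by
    rw [← Matrix.mul_one (F.mat (.coilInv x K)), ← h₁, ← Matrix.mul_assoc,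
      F.mat_coilInv_mul_mat_coil, Matrix.one_mul]
  rw [h₂]
  refine (Matrix.mul_apply.trans (sum_append [x] _)).trans ?_
  simp [rotMat_apply, tensorMat_apply, Matrix.one_apply]

/-- The crossings in the annular product undo the swap with `L` in a rotation. -/
theorem mat_whiskerRight (L : Word) {K K' : Word} (f : ADiag 𝕜 K K') :
    F.mat (ADiag.whiskerRight 1 L f) = tensorMat (F.mat f) (idMat l 𝕜 L) := by
  induction f with
  | planar p => rw [ADiag.whiskerRight, mat_planar, mat_planar]; rfl
  | coil x K =>
    obtain ⟨D, hD⟩ := F.coil_eq_rotMat x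
    rw [ADiag.whiskerRight, mat_comp, mat_planar, mat_cast, evalP_cast, hD, hD, evalP, evalP,
      evalP_pullFront_one]
    ext t s
    obtain ⟨t, r, rfl⟩ := exists_append (K ++ [x]) t
    obtain ⟨t, a, rfl⟩ := exists_append K t
    obtain ⟨b, s, rfl⟩ := exists_cons s
    obtain ⟨s, r', rfl⟩ := exists_append K s
    simp [Matrix.mul_apply, sum_append, rotMat_apply, castMat_apply, tensorMat_apply,
      Matrix.one_apply, ite_and]
    split_ifs <;> rfl
  | coilInv x K =>
    obtain ⟨D, hD⟩ := F.coilInv_eq x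
    rw [ADiag.whiskerRight, mat_comp, mat_planar, mat_cast, evalP_cast, evalP, evalP,
      evalP_pushFront_one]
    ext t s
    obtain ⟨s, r, rfl⟩ := exists_append (K ++ [x]) s
    obtain ⟨s, a, rfl⟩ := exists_append K s
    obtain ⟨b, t, rfl⟩ := exists_cons t
    obtain ⟨t, r', rfl⟩ := exists_append K t
    simp [hD, Matrix.mul_apply, sum_append, rotMat_apply, castMat_apply, tensorMat_apply,
      Matrix.one_apply, ite_and]
    split_ifs <;> rfl
  | comp f g hf hg =>
    rw [ADiag.whiskerRight, mat_comp, mat_comp, hf, hg, tensorMat_mul, Matrix.one_mul]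
  | zero K K' =>
    rw [ADiag.whiskerRight, mat_zero, mat_zero]
    ext t s
    simp [tensorMat_apply]
  | add f g hf hg =>
    rw [ADiag.whiskerRight, mat_add, mat_add, hf, hg]
    ext t s
    simp [tensorMat_apply, add_mul]
  | smul c f hf =>
    rw [ADiag.whiskerRight, mat_smul, mat_smul, hf]
    ext t s
    simp [tensorMat_apply, mul_assoc]

theorem mat_whiskerLeft (L : Word) {K K' : Word} (f : ADiag 𝕜 K K') :
    F.mat (ADiag.whiskerLeft 1 L f) = tensorMat (idMat l 𝕜 L) (F.mat f) := by
  induction f with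
  | planar p => rw [ADiag.whiskerLeft, mat_planar, mat_planar]; rfl
  | coil x K =>
    obtain ⟨D, hD⟩ := F.coil_eq_rotMat x
    rw [ADiag.whiskerLeft, mat_comp, mat_planar, mat_cast, evalP_cast, hD, hD, evalP, evalP,
      evalP_pullBack_one]
    ext t s
    obtain ⟨t, r, rfl⟩ := exists_append L t
    obtain ⟨r, a, rfl⟩ := exists_append K r
    obtain ⟨s, b, rfl⟩ := exists_append L s
    obtain ⟨b, r', rfl⟩ := exists_cons b
    simp [Matrix.mul_apply, sum_append, sum_cons, rotMat_apply, castMat_apply, tensorMat_apply,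
      Matrix.one_apply, ite_and]
    split_ifs <;> rfl
  | coilInv x K =>
    obtain ⟨D, hD⟩ := F.coilInv_eq x
    rw [ADiag.whiskerLeft, mat_comp, mat_planar, mat_cast, evalP_cast, evalP, evalP,
      evalP_pushBack_one]
    ext t s
    obtain ⟨s, r, rfl⟩ := exists_append L s
    obtain ⟨r, a, rfl⟩ := exists_append K r
    obtain ⟨t, b, rfl⟩ := exists_append L t
    obtain ⟨b, r', rfl⟩ := exists_cons b
    simp [hD, Matrix.mul_apply, sum_cons, rotMat_apply, castMat_apply, tensorMat_apply,
      Matrix.one_apply]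
  | comp f g hf hg =>
    rw [ADiag.whiskerLeft, mat_comp, mat_comp, hf, hg, tensorMat_mul, Matrix.one_mul]
  | zero K K' =>
    rw [ADiag.whiskerLeft, mat_zero, mat_zero]
    ext t s
    simp [tensorMat_apply]
  | add f g hf hg =>
    rw [ADiag.whiskerLeft, mat_add, mat_add, hf, hg]
    ext t s
    simp [tensorMat_apply, mul_add]
  | smul c f hf =>
    rw [ADiag.whiskerLeft, mat_smul, mat_smul, hf]
    ext t s
    simp [tensorMat_apply, mul_left_comm]

theorem isStrictMonoidal : F.IsStrictMonoidal := by
  intro K L K' L' f g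
  rw [ADiag.annTensor, mat_comp, mat_whiskerRight, mat_whiskerLeft, tensorMat_mul, Matrix.one_mul,
    Matrix.mul_one]

end AnnularFunctor

/-! ### Evaluations and coevaluations at `q = 1` -/

section Duality

variable {d : ℕ} {l : Fin d → ℕ} {𝕜 : Type u} [Field 𝕜]

open BasisIdx

theorem Label.thick_star (x : Label) : x.star.thick = x.thick := by cases x <;> rfl

theorem BasisIdx.dual_cons {x : Label} {K : Word} (a : {S : Finset (Idx l) // S.card = x.thick})
    (s : BasisIdx l K) :
    BasisIdx.dual (x :: K) (cons a s) =
      append (Word.dual K) (BasisIdx.dual K s) (cons ⟨a.1, a.2.trans x.thick_star.symm⟩ nil) := by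
  cases x <;> rfl

/-- When a basis element of `(x ⊗ K)* = K* ⊗ x*` is dual to one of `x ⊗ K`. -/
theorem BasisIdx.append_eq_dual_cons {x : Label} {K : Word} (p : BasisIdx l (Word.dual K))
    (a : {S : Finset (Idx l) // S.card = x.star.thick})
    (b : {S : Finset (Idx l) // S.card = x.thick}) (s : BasisIdx l K) :
    (append (Word.dual K) p (cons a nil) : BasisIdx l (Word.dual (x :: K))) =
        BasisIdx.dual (x :: K) (cons b s) ↔
      p = BasisIdx.dual K s ∧ a.1 = b.1 := by
  rw [dual_cons]
  refine (append_inj _ _ _ _ _).trans (and_congr Iff.rfl ?_)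
  rw [cons_inj, Subtype.ext_iff]
  exact and_iff_left rfl

theorem evalP_evL_one (x : Label) (t a b) :
    evalP l 1 (PDiag.evL 𝕜 x) t (cons a (cons b nil)) = if a.1 = b.1 then 1 else 0 := by
  cases x
  · rfl
  · simp only [PDiag.evL, evalP, evalGen, qpow_one_unit]; rfl

theorem evalP_evR_one (x : Label) (t a b) :
    evalP l 1 (PDiag.evR 𝕜 x) t (cons a (cons b nil)) = if a.1 = b.1 then 1 else 0 := by
  cases x
  · simp only [PDiag.evR, evalP, evalGen, qpow_one_unit]; rfl
  · rfl

theorem evalP_coevL_one (x : Label) (t a b) :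
    evalP l 1 (PDiag.coevL 𝕜 x) (cons a (cons b nil)) t = if a.1 = b.1 then 1 else 0 := by
  cases x
  · rfl
  · simp only [PDiag.coevL, evalP, evalGen, qpow_one_unit]; rfl

theorem evalP_coevR_one (x : Label) (t a b) :
    evalP l 1 (PDiag.coevR 𝕜 x) (cons a (cons b nil)) t = if a.1 = b.1 then 1 else 0 := by
  cases x
  · simp only [PDiag.coevR, evalP, evalGen, qpow_one_unit]; rfl
  · rfl

theorem leftEvMat_one_apply (K : Word) (t) (p : BasisIdx l (Word.dual K)) (s : BasisIdx l K) :
    leftEvMat l (1 : 𝕜ˣ) K t (append (Word.dual K) p s) =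
      if p = BasisIdx.dual K s then 1 else 0 := by
  simp [leftEvMat]

theorem rightEvMat_one_apply (K : Word) (t) (p : BasisIdx l (Word.dual K)) (s : BasisIdx l K) :
    rightEvMat l (1 : 𝕜ˣ) K t (append K s p) = if p = BasisIdx.dual K s then 1 else 0 := by
  simp [rightEvMat]

theorem leftCoevMat_one_apply (K : Word) (t) (p : BasisIdx l (Word.dual K)) (s : BasisIdx l K) :
    leftCoevMat l (1 : 𝕜ˣ) K (append K s p) t = if p = BasisIdx.dual K s then 1 else 0 := by
  simp [leftCoevMat]

theorem rightCoevMat_one_apply (K : Word) (t) (p : BasisIdx l (Word.dual K)) (s : BasisIdx l K) :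
    rightCoevMat l (1 : 𝕜ˣ) K (append (Word.dual K) p s) t =
      if p = BasisIdx.dual K s then 1 else 0 := by
  simp [rightCoevMat]

theorem ite_append_eq_dual_cons {x : Label} {K : Word} (p : BasisIdx l (Word.dual K))
    (a : {S : Finset (Idx l) // S.card = x.star.thick})
    (b : {S : Finset (Idx l) // S.card = x.thick}) (s : BasisIdx l K)
    {_ : Decidable ((append (Word.dual K) p (cons a nil) : BasisIdx l (Word.dual (x :: K))) =
        BasisIdx.dual (x :: K) (cons b s))} :
    (if (append (Word.dual K) p (cons a nil) : BasisIdx l (Word.dual (x :: K))) =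
        BasisIdx.dual (x :: K) (cons b s) then (1 : 𝕜) else 0) =
      if p = BasisIdx.dual K s then if a.1 = b.1 then 1 else 0 else 0 := by
  rw [← ite_and]
  exact if_congr (append_eq_dual_cons p a b s) rfl rfl

theorem evalP_leftEv_one (K : Word) : evalP l 1 (PDiag.leftEv 𝕜 K) = leftEvMat l 1 K := by
  induction K with
  | nil =>
    ext t s
    refine Eq.trans ?_ (leftEvMat_one_apply [] t nil nil).symm
    rfl
  | cons x K ih =>
    have h : evalP l 1 (PDiag.leftEv 𝕜 (x :: K)) =
        compMat ((Word.dual K ++ [x.star]) ++ x :: K) (Word.dual K ++ K) []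
          (castMat (List.append_assoc (Word.dual K) [x.star] (x :: K)).symm rfl
            (tensorMat (idMat l 𝕜 (Word.dual K))
              (tensorMat (evalP l 1 (PDiag.evL 𝕜 x)) (idMat l 𝕜 K))))
          (leftEvMat l 1 K) := by
      rw [← ih]
      exact congrArg (fun M => compMat _ (Word.dual K ++ K) [] M (evalP l 1 (PDiag.leftEv 𝕜 K)))
        (evalP_cast (l := l) 1 _ _ _)
    ext t s
    obtain ⟨p, s, rfl⟩ := exists_append (Word.dual (x :: K)) s
    obtain ⟨p, a, rfl⟩ := exists_append (Word.dual K) p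
    obtain ⟨a, z, rfl⟩ := exists_cons a
    obtain rfl := eq_nil z
    obtain ⟨b, s, rfl⟩ := exists_cons s
    rw [h]
    refine Eq.trans ?_ (leftEvMat_one_apply (x :: K) t _ _).symm
    refine Eq.trans ?_ (ite_append_eq_dual_cons p a b s).symm
    change compMat _ _ _ _ _ t (append (Word.dual K ++ [x.star])
      (append (Word.dual K) p (cons a nil)) (cons b s)) = _
    simp [compMat, leftEvMat_one_apply, Matrix.mul_apply, sum_append, castMat_apply,
      tensorMat_apply, evalP_evL_one, Matrix.one_apply]
    split_ifs <;> rfl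

theorem evalP_rightEv_one (K : Word) : evalP l 1 (PDiag.rightEv 𝕜 K) = rightEvMat l 1 K := by
  induction K with
  | nil =>
    ext t s
    refine Eq.trans ?_ (rightEvMat_one_apply [] t nil nil).symm
    rfl
  | cons x K ih =>
    have h : evalP l 1 (PDiag.rightEv 𝕜 (x :: K)) =
        compMat ((x :: K) ++ (Word.dual K ++ [x.star])) [x, x.star] []
          (castMat (congrArg (x :: ·) (List.append_assoc K (Word.dual K) [x.star])) rfl
            (tensorMat (idMat l 𝕜 [x]) (tensorMat (rightEvMat l 1 K) (idMat l 𝕜 [x.star]))))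
          (evalP l 1 (PDiag.evR 𝕜 x)) := by
      rw [← ih]
      exact congrArg (fun M => compMat _ [x, x.star] [] M (evalP l 1 (PDiag.evR 𝕜 x)))
        (evalP_cast (l := l) 1 _ _ _)
    ext t s
    obtain ⟨s, p, rfl⟩ := exists_append (x :: K) s
    obtain ⟨p, a, rfl⟩ := exists_append (Word.dual K) p
    obtain ⟨a, z, rfl⟩ := exists_cons a
    obtain rfl := eq_nil z
    obtain ⟨b, s, rfl⟩ := exists_cons s
    rw [h]
    refine Eq.trans ?_ (rightEvMat_one_apply (x :: K) t _ _).symm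
    refine Eq.trans ?_ (ite_append_eq_dual_cons p a b s).symm
    have hcast (h) : BasisIdx.cast h (cons b (append K s (append (Word.dual K) p (cons a nil)))) =
        cons b (append (K ++ Word.dual K) (append K s p) (cons a nil)) :=
      cast_append_assoc_symm (x :: K) (Word.dual K) [x.star] h (cons b s) p (cons a nil)
    change compMat _ _ _ _ _ t (append (x :: K) (cons b s)
      (append (Word.dual K) p (cons a nil))) = _
    simp [compMat, rightEvMat_one_apply, Matrix.mul_apply, sum_cons, castMat_apply,
      tensorMat_apply, evalP_evR_one, Matrix.one_apply, hcast]
    simp only [eq_comm]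

theorem evalP_leftCoev_one (K : Word) : evalP l 1 (PDiag.leftCoev 𝕜 K) = leftCoevMat l 1 K := by
  induction K with
  | nil =>
    ext s t
    refine Eq.trans ?_ (leftCoevMat_one_apply [] t nil nil).symm
    rfl
  | cons x K ih =>
    have h : evalP l 1 (PDiag.leftCoev 𝕜 (x :: K)) =
        compMat [] [x, x.star] ((x :: K) ++ (Word.dual K ++ [x.star]))
          (evalP l 1 (PDiag.coevL 𝕜 x))
          (castMat rfl (congrArg (x :: ·) (List.append_assoc K (Word.dual K) [x.star]))
            (tensorMat (idMat l 𝕜 [x])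
              (tensorMat (leftCoevMat l 1 K) (idMat l 𝕜 [x.star])))) := by
      rw [← ih]
      exact congrArg (fun M => compMat [] [x, x.star] _ (evalP l 1 (PDiag.coevL 𝕜 x)) M)
        (evalP_cast (l := l) 1 _ _ _)
    ext s t
    obtain ⟨s, p, rfl⟩ := exists_append (x :: K) s
    obtain ⟨p, a, rfl⟩ := exists_append (Word.dual K) p
    obtain ⟨a, z, rfl⟩ := exists_cons a
    obtain rfl := eq_nil z
    obtain ⟨b, s, rfl⟩ := exists_cons s
    rw [h]
    refine Eq.trans ?_ (leftCoevMat_one_apply (x :: K) t _ _).symm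
    refine Eq.trans ?_ (ite_append_eq_dual_cons p a b s).symm
    have hcast (h) : BasisIdx.cast h (cons b (append K s (append (Word.dual K) p (cons a nil)))) =
        cons b (append (K ++ Word.dual K) (append K s p) (cons a nil)) :=
      cast_append_assoc_symm (x :: K) (Word.dual K) [x.star] h (cons b s) p (cons a nil)
    change compMat _ _ _ _ _ (append (x :: K) (cons b s)
      (append (Word.dual K) p (cons a nil))) t = _
    simp [compMat, leftCoevMat_one_apply, Matrix.mul_apply, sum_cons, castMat_apply,
      tensorMat_apply, evalP_coevL_one, Matrix.one_apply, hcast]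
    simp only [eq_comm]

theorem evalP_rightCoev_one (K : Word) : evalP l 1 (PDiag.rightCoev 𝕜 K) = rightCoevMat l 1 K := by
  induction K with
  | nil =>
    ext s t
    refine Eq.trans ?_ (rightCoevMat_one_apply [] t nil nil).symm
    rfl
  | cons x K ih =>
    have h : evalP l 1 (PDiag.rightCoev 𝕜 (x :: K)) =
        compMat [] (Word.dual K ++ K) ((Word.dual K ++ [x.star]) ++ x :: K)
          (rightCoevMat l 1 K)
          (castMat rfl (List.append_assoc (Word.dual K) [x.star] (x :: K)).symm
            (tensorMat (idMat l 𝕜 (Word.dual K))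
              (tensorMat (evalP l 1 (PDiag.coevR 𝕜 x)) (idMat l 𝕜 K)))) := by
      rw [← ih]
      exact congrArg (fun M => compMat [] (Word.dual K ++ K) _ (evalP l 1 (PDiag.rightCoev 𝕜 K)) M)
        (evalP_cast (l := l) 1 _ _ _)
    ext s t
    obtain ⟨p, s, rfl⟩ := exists_append (Word.dual (x :: K)) s
    obtain ⟨p, a, rfl⟩ := exists_append (Word.dual K) p
    obtain ⟨a, z, rfl⟩ := exists_cons a
    obtain rfl := eq_nil z
    obtain ⟨b, s, rfl⟩ := exists_cons s
    rw [h]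
    refine Eq.trans ?_ (rightCoevMat_one_apply (x :: K) t _ _).symm
    refine Eq.trans ?_ (ite_append_eq_dual_cons p a b s).symm
    change compMat _ _ _ _ _ (append (Word.dual K ++ [x.star])
      (append (Word.dual K) p (cons a nil)) (cons b s)) t = _
    simp [compMat, rightCoevMat_one_apply, Matrix.mul_apply, sum_append, castMat_apply,
      tensorMat_apply, evalP_coevR_one, Matrix.one_apply]
    split_ifs <;> rfl

namespace AnnularFunctor

theorem isPivotal [CharZero 𝕜] {u : Fin d → 𝕜ˣ} (F : AnnularFunctor l (1 : 𝕜ˣ) u) :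
    F.IsPivotal where
  monoidal := F.isStrictMonoidal
  leftEv K := by rw [mat_planar, evalP_leftEv_one]
  rightEv K := by rw [mat_planar, evalP_rightEv_one]
  leftCoev K := by rw [mat_planar, evalP_leftCoev_one]
  rightCoev K := by rw [mat_planar, evalP_rightCoev_one]

end AnnularFunctor

end Duality

/-! ### Thin crossings and coils -/

section Thin

variable {d : ℕ} {l : Fin d → ℕ} {𝕜 : Type u} [Field 𝕜] (q : 𝕜ˣ) {u : Fin d → 𝕜ˣ}

open BasisIdx

/-- The basis vector `v_a` of the vector representation, as a one-element subset. -/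
def thin (a : Idx l) : {S : Finset (Idx l) // S.card = (Label.up 1).thick} :=
  ⟨{a}, Finset.card_singleton a⟩

/-- The basis vector `v_a ⊗ v_b` of the tensor square of the vector representation. -/
def thinPair (a b : Idx l) : BasisIdx l [.up 1, .up 1] := cons (thin a) (cons (thin b) nil)

@[simp] theorem thin_inj {a b : Idx l} : thin a = thin b ↔ a = b := by
  rw [Subtype.ext_iff]; exact Finset.singleton_inj

@[simp] theorem thinPair_inj {a b c e : Idx l} : thinPair a b = thinPair c e ↔ a = c ∧ b = e := by
  simp [thinPair]

@[simp] theorem elt_thin (a : Idx l) : elt (thin a) = a :=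
  (Finset.singleton_injective (elt_spec (thin a))).symm

theorem exists_thin (S : {S : Finset (Idx l) // S.card = (Label.up 1).thick}) : ∃ a, S = thin a :=
  ⟨elt S, Subtype.ext (elt_spec S)⟩

theorem exists_thinPair (s : BasisIdx l [.up 1, .up 1]) : ∃ a b, s = thinPair a b := by
  obtain ⟨S, s, rfl⟩ := exists_cons s
  obtain ⟨T, s, rfl⟩ := exists_cons s
  obtain ⟨a, rfl⟩ := exists_thin S
  obtain ⟨b, rfl⟩ := exists_thin T
  exact ⟨a, b, rfl⟩

theorem ladderCoeff_eq_zero {S T V W C : Finset (Idx l)} (h : ¬ C ⊆ S) :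
    ladderCoeff q S T V W C = 0 := by
  rw [ladderCoeff, splitCoeff_eq_zero q fun e => h (Finset.subset_union_left.trans e.2.ge),
    zero_mul]

theorem evalP_crossN_one_one (front : Bool) (s t v w : BasisIdx l (upw 1)) :
    evalP l q (PDiag.crossN q front 1 1) (append (upw 1) v w) (append (upw 1) s t) =
      -(ladderCoeff q (supp _ s) (supp _ t) (supp _ v) (supp _ w) ∅ +
        qpow (-q) (if front then 1 else -1) *
          ladderCoeff q (supp _ s) (supp _ t) (supp _ v) (supp _ w) (supp _ s)) := by
  have h₀ : (∑ C : Finset (Idx l), if C.card = 0 then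
      ladderCoeff q (supp _ s) (supp _ t) (supp _ v) (supp _ w) C else 0) =
      ladderCoeff q (supp _ s) (supp _ t) (supp _ v) (supp _ w) ∅ := by
    simp [Finset.card_eq_zero]
  have h₁ : (∑ C : Finset (Idx l), if C.card = 1 then
      ladderCoeff q (supp _ s) (supp _ t) (supp _ v) (supp _ w) C else 0) =
      ladderCoeff q (supp _ s) (supp _ t) (supp _ v) (supp _ w) (supp _ s) := by
    rw [Finset.sum_eq_single (supp _ s)]
    · rw [if_pos (card_supp_upw 1 s)]
    · intro C _ hC
      split_ifs with h
      · refine ladderCoeff_eq_zero q fun h' => hC ?_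
        exact Finset.eq_of_subset_of_card_le h' (by rw [card_supp_upw, h])
      · rfl
    · simp
  have e₀ := evalP_ladder_apply q 0 1 1 s t v w
  have e₁ := evalP_ladder_apply q 1 0 0 s t v w
  rw [h₀] at e₀
  rw [h₁] at e₁
  rw [← e₀, ← e₁]
  simp only [PDiag.crossN, evalP, evalP_sum, Matrix.smul_apply, Finset.sum_range_succ,
    Finset.sum_range_zero, zero_add]
  cases front <;> simp [evalP, evalP_cast] <;> rfl

/-- The thin crossing has two ladders: with `C = ∅`, and with `C` the first subset. -/
theorem evalP_crossUU_thin (front : Bool) (a b c e : Idx l) :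
    evalP l q (PDiag.crossUU q front 1 1) (thinPair c e) (thinPair a b) =
      -(ladderCoeff q {a} {b} {c} {e} ∅ +
        qpow (-q) (if front then 1 else -1) * ladderCoeff q {a} {b} {c} {e} {a}) := by
  have h (a : Idx l) : supp (upw 1) (cons (thin a) nil) = {a} := Finset.union_empty _
  rw [← h a, ← h b, ← h c, ← h e]
  exact evalP_crossN_one_one q front (cons (thin a) nil) (cons (thin b) nil) (cons (thin c) nil)
    (cons (thin e) nil)

theorem ltCount_singleton (a b : Idx l) : ltCount {a} {b} = if a < b then 1 else 0 := by
  rw [ltCount, Finset.singleton_product_singleton, Finset.filter_singleton]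
  split_ifs <;> rfl

/-- The thin crossing multiplies `v_a ⊗ v_a` by `q`: only the ladder with rungs of thickness `0`
contributes. -/
theorem evalP_crossUU_diag (a : Idx l) (t : BasisIdx l [.up 1, .up 1]) :
    evalP l q (PDiag.crossUU q true 1 1) t (thinPair a a) =
      if t = thinPair a a then (q : 𝕜) else 0 := by
  obtain ⟨c, e, rfl⟩ := exists_thinPair t
  rw [evalP_crossUU_thin]
  by_cases h : c = a
  · subst h
    by_cases h' : e = c
    · subst h'
      simp [ladderCoeff, mergeCoeff, splitCoeff, qpow]
    · simp [ladderCoeff, mergeCoeff, splitCoeff, h', Ne.symm h']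
  · simp only [ladderCoeff, mergeCoeff, splitCoeff, thinPair_inj, h, false_and, if_false]
    simp
    intro _ _ h'
    have hac : a ∈ ({c} : Finset (Idx l)) := h' ▸ Finset.mem_insert_self a {c}
    exact absurd (Finset.mem_singleton.1 hac).symm h

/-- The diagonal term by which the thin crossing differs from the swap. -/
theorem evalP_crossUU_false {a b : Idx l} (h : a < b) :
    evalP l q (PDiag.crossUU q false 1 1) (thinPair a b) (thinPair a b) =
      qpow q (-1) - qpow q 1 := by
  rw [evalP_crossUU_thin]
  simp [ladderCoeff, mergeCoeff, splitCoeff, qpow, ltCount_singleton, h, h.ne, h.not_gt,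
    sub_eq_add_neg]

theorem tensorMat_one_nil {x y z w : Label} (M : Mat l 𝕜 [x, y] [z, w]) :
    tensorMat M (idMat l 𝕜 []) = M := by
  ext t s
  exact mul_one _

/-- A thin strand is its own explosion, so the Levi crossing with it is the thin Levi crossing. -/
theorem leviUp_one_right : leviUp l q 1 = leviThin l q true := by
  have h₁ : evalP l q ((explode 𝕜 ((1 : ℕ+) : ℕ)).cast (upw_pnat 1) rfl) =
      compMat [.up 1] [.up 1] [.up 1] (idMat l 𝕜 [.up 1])
        (tensorMat (idMat l 𝕜 [.up 1]) (idMat l 𝕜 [])) := rfl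
  have h₂ : evalP l q ((implode 𝕜 ((1 : ℕ+) : ℕ)).cast rfl (upw_pnat 1)) =
      compMat [.up 1] [.up 1] [.up 1] (tensorMat (idMat l 𝕜 [.up 1]) (idMat l 𝕜 []))
        (idMat l 𝕜 [.up 1]) := rfl
  have h₃ : thinPast l q ((1 : ℕ+) : ℕ) = compMat [.up 1, .up 1] [.up 1, .up 1] [.up 1, .up 1]
      (tensorMat (leviThin l q true) (idMat l 𝕜 []))
      (tensorMat (idMat l 𝕜 [.up 1]) (idMat l 𝕜 [.up 1])) := rfl
  have h₄ : compMat [.up 1] [.up 1] [.up 1] (idMat l 𝕜 [.up 1])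
        (tensorMat (idMat l 𝕜 [.up 1]) (idMat l 𝕜 [])) = 1 := by
    rw [tensorMat_one]; exact Matrix.one_mul _
  have h₅ : compMat [.up 1] [.up 1] [.up 1] (tensorMat (idMat l 𝕜 [.up 1]) (idMat l 𝕜 []))
        (idMat l 𝕜 [.up 1]) = 1 := by
    rw [tensorMat_one]; exact Matrix.one_mul _
  have h₆ : compMat [.up 1, .up 1] [.up 1, .up 1] [.up 1, .up 1] (leviThin l q true)
      (tensorMat (idMat l 𝕜 [.up 1]) (idMat l 𝕜 [.up 1])) = leviThin l q true := by
    rw [tensorMat_one]; exact Matrix.one_mul _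
  have hq : qfac q ((1 : ℕ+) : ℕ) = 1 := qfac_one q
  rw [leviUp, h₁, h₂, h₃, h₄, h₅, tensorMat_one_nil, h₆, hq, inv_one, one_smul]
  change compMat [.up 1, .up 1] [.up 1, .up 1] [.up 1, .up 1]
    (tensorMat (idMat l 𝕜 [.up 1]) (idMat l 𝕜 [.up 1]))
    (compMat [.up 1, .up 1] [.up 1, .up 1] [.up 1, .up 1] (leviThin l q true)
      (tensorMat (idMat l 𝕜 [.up 1]) (idMat l 𝕜 [.up 1]))) = _
  rw [h₆, tensorMat_one]
  exact Matrix.mul_one _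

theorem coilMap_thin (u : Fin d → 𝕜ˣ) (a b c e : Idx l) :
    coilMap l q u [.up 1] (thinPair c e) (thinPair a b) =
      leviCoeff q true a b c e * u a.block := by
  have h₁ : coilMap l q u [.up 1] = compMat [.up 1, .up 1] [.up 1, .up 1] [.up 1, .up 1]
      (tensorMat (blockScale u) (idMat l 𝕜 [.up 1]))
      (compMat [.up 1, .up 1] [.up 1, .up 1] [.up 1, .up 1]
        (tensorMat (leviUp l q 1) (idMat l 𝕜 []))
        (tensorMat (idMat l 𝕜 [.up 1]) (idMat l 𝕜 [.up 1]))) := rfl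
  rw [h₁, leviUp_one_right, tensorMat_one_nil, tensorMat_one, compMat, compMat]
  have h₂ : tensorMat (blockScale u) (idMat l 𝕜 [.up 1]) =
      Matrix.diagonal fun s : BasisIdx l [.up 1, .up 1] => (u (elt s.1).block : 𝕜) := by
    ext t s
    obtain ⟨a, b, rfl⟩ := exists_thinPair t
    obtain ⟨c, e, rfl⟩ := exists_thinPair s
    simp [thinPair, tensorMat_apply, blockScale, Matrix.diagonal_apply, Matrix.one_apply]
    split_ifs <;> simp_all
  rw [h₂, Matrix.one_mul]
  refine (Matrix.mul_diagonal _ _ _ _).trans ?_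
  simp [leviThin, thinPair]

theorem leviCoeff_self (a c e : Idx l) :
    leviCoeff q true a a c e = if c = a ∧ e = a then (q : 𝕜) else 0 := by
  simp [leviCoeff, qpow]

theorem leviCoeff_of_block_ne {a b : Idx l} (h : a.block ≠ b.block) (pos : Bool) (c e : Idx l) :
    leviCoeff q pos a b c e = if c = b ∧ e = a then 1 else 0 := if_neg h

/-- If a matrix is conjugate to a diagonal matrix and has a basis vector as an eigenvector, then
the eigenvalue is one of the diagonal entries. -/
theorem exists_eq_of_mul_eq_mul_diagonal {n : Type*} [Fintype n] [DecidableEq n]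
    {A : Matrix n n 𝕜} {D : n → 𝕜} (M : (Matrix n n 𝕜)ˣ) (h : A * M.1 = M.1 * Matrix.diagonal D)
    {i : n} {c : 𝕜} (hA : ∀ t, A t i = if t = i then c else 0) : ∃ t, D t = c := by
  have h' : (M⁻¹).1 * A = Matrix.diagonal D * (M⁻¹).1 := by
    rw [Units.inv_mul_eq_iff_eq_mul, ← mul_assoc, ← h, mul_assoc, Units.mul_inv, mul_one]
  obtain ⟨t, ht⟩ : ∃ t, (M⁻¹).1 t i ≠ 0 := by
    by_contra! h₀
    have := congrFun (congrFun M.mul_inv i) i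
    rw [Matrix.mul_apply] at this
    simp [h₀] at this
  refine ⟨t, ?_⟩
  have h₂ := congrFun (congrFun h' t) i
  rw [Matrix.mul_apply, Matrix.diagonal_mul] at h₂
  simp only [hA, mul_ite, mul_zero, Finset.sum_ite_eq', Finset.mem_univ, if_true] at h₂
  rw [mul_comm] at h₂
  exact (mul_right_cancel₀ ht h₂).symm

namespace AnnularFunctor

variable {q} (F : AnnularFunctor l q u)

theorem mat_coil_up_one_nil : F.mat (.coil (.up 1) []) = blockScale u := by
  have h : coilMap l q u [] = compMat [.up 1] [.up 1] [.up 1]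
      (tensorMat (blockScale u) (idMat l 𝕜 [])) (idMat l 𝕜 [.up 1]) := rfl
  refine (F.map_coil []).trans ?_
  have h₁ : tensorMat (blockScale u) (idMat l 𝕜 []) = blockScale u := by
    ext t s
    exact mul_one _
  rw [h, h₁]
  exact Matrix.one_mul _

/-- The coil behind a thin strand first passes behind this strand through a `gl_n`-crossing and then
winds around the annulus through a Levi crossing. -/
theorem mat_wid_annTensor_coil :
    F.mat (ADiag.annTensor q (ADiag.wid [.up 1]) (ADiag.coil (.up 1) [])) =
      compMat [.up 1, .up 1] [.up 1, .up 1] [.up 1, .up 1]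
        (evalP l q (PDiag.crossUU q true 1 1)) (coilMap l q u [.up 1]) := by
  have h₁ : evalP l q (((PDiag.pullBack q (.up 1) [.up 1]).tensor (PDiag.wid [])).cast
      (List.append_assoc [.up 1] [.up 1] []) rfl) =
      tensorMat (compMat [.up 1, .up 1] [.up 1, .up 1] [.up 1, .up 1]
        (tensorMat (idMat l 𝕜 [.up 1]) (idMat l 𝕜 [.up 1]))
        (tensorMat (evalP l q (PDiag.crossUU q true 1 1)) (idMat l 𝕜 []))) (idMat l 𝕜 []) := rfl
  have h₂ : F.mat (ADiag.whiskerRight q [.up 1] (ADiag.wid [.up 1])) =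
      tensorMat (idMat l 𝕜 [.up 1]) (idMat l 𝕜 [.up 1]) := F.mat_planar _
  have h₃ : F.mat (ADiag.whiskerLeft q [.up 1] (ADiag.coil (.up 1) [])) =
      compMat [.up 1, .up 1] [.up 1, .up 1] [.up 1, .up 1]
        (evalP l q (((PDiag.pullBack q (.up 1) [.up 1]).tensor (PDiag.wid [])).cast
          (List.append_assoc [Label.up 1] [Label.up 1] []) rfl)) (coilMap l q u [.up 1]) :=
    (F.mat_comp _ _).trans (congrArg₂
      (compMat [Label.up 1, Label.up 1] [Label.up 1, Label.up 1] [Label.up 1, Label.up 1])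
      (F.mat_planar _) (F.map_coil [.up 1]))
  rw [h₁, tensorMat_one_nil, tensorMat_one_nil, tensorMat_one] at h₃
  rw [tensorMat_one] at h₂
  refine (F.mat_comp _ _).trans ?_
  refine (congrArg₂ (compMat [Label.up 1, Label.up 1] [Label.up 1, Label.up 1]
    [Label.up 1, Label.up 1]) h₂ h₃).trans ?_
  refine (Matrix.mul_one _).trans ?_
  exact congrArg (fun M => compMat [.up 1, .up 1] [.up 1, .up 1] [.up 1, .up 1] M
    (coilMap l q u [.up 1])) (Matrix.mul_one _)

/-- The coil in front of a thin strand first winds around the annulus through a Levi crossing and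
then passes in front of this strand through a `gl_n`-crossing. -/
theorem mat_coil_annTensor_wid :
    F.mat (ADiag.annTensor q (ADiag.coil (.up 1) []) (ADiag.wid [.up 1])) =
      compMat [.up 1, .up 1] [.up 1, .up 1] [.up 1, .up 1] (coilMap l q u [.up 1])
        (evalP l q (PDiag.crossUU q false 1 1)) := by
  have h₁ : evalP l q (((PDiag.wid []).tensor (PDiag.pullFront q (.up 1) [.up 1])).cast rfl
      (List.append_assoc [] [.up 1] [.up 1]).symm) =
      tensorMat (idMat l 𝕜 []) (compMat [.up 1, .up 1] [.up 1, .up 1] [.up 1, .up 1]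
        (tensorMat (idMat l 𝕜 [.up 1]) (idMat l 𝕜 [.up 1]))
        (tensorMat (evalP l q (PDiag.crossUU q false 1 1)) (idMat l 𝕜 []))) := rfl
  have h₂ : F.mat (ADiag.whiskerLeft q [.up 1] (ADiag.wid [.up 1])) =
      tensorMat (idMat l 𝕜 [.up 1]) (idMat l 𝕜 [.up 1]) := F.mat_planar _
  have h₃ (M : Mat l 𝕜 [.up 1, .up 1] [.up 1, .up 1]) : tensorMat (idMat l 𝕜 []) M = M := by
    ext t s
    exact one_mul _
  have h₄ : F.mat (ADiag.whiskerRight q [.up 1] (ADiag.coil (.up 1) [])) =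
      compMat [.up 1, .up 1] [.up 1, .up 1] [.up 1, .up 1] (coilMap l q u [.up 1])
        (evalP l q (((PDiag.wid []).tensor (PDiag.pullFront q (.up 1) [.up 1])).cast rfl
          (List.append_assoc [] [Label.up 1] [Label.up 1]).symm)) :=
    (F.mat_comp _ _).trans (congrArg₂
      (compMat [Label.up 1, Label.up 1] [Label.up 1, Label.up 1] [Label.up 1, Label.up 1])
      (F.map_coil [.up 1]) (F.mat_planar _))
  rw [h₁, tensorMat_one_nil, tensorMat_one, h₃] at h₄
  rw [tensorMat_one] at h₂
  refine (F.mat_comp _ _).trans ?_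
  refine (congrArg₂ (compMat [Label.up 1, Label.up 1] [Label.up 1, Label.up 1]
    [Label.up 1, Label.up 1]) h₄ h₂).trans ?_
  refine (Matrix.one_mul _).trans ?_
  exact congrArg (compMat [.up 1, .up 1] [.up 1, .up 1] [.up 1, .up 1] (coilMap l q u [.up 1]))
    (Matrix.mul_one _)

/-! ### Failure of monoidality -/

/-- `v_a ⊗ v_a` is an eigenvector of the image of the coil behind a thin strand, since the
`gl_n`-crossing and the Levi crossing both multiply it by `q`. -/
theorem mat_wid_annTensor_coil_diag (a : Idx l) (t : BasisIdx l [.up 1, .up 1]) :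
    F.mat (ADiag.annTensor q (ADiag.wid [.up 1]) (ADiag.coil (.up 1) [])) t (thinPair a a) =
      if t = thinPair a a then (q : 𝕜) ^ 2 * u a.block else 0 := by
  obtain ⟨c, e, rfl⟩ := exists_thinPair t
  rw [mat_wid_annTensor_coil, compMat, Matrix.mul_apply]
  simp only [evalP_crossUU_diag, mul_ite, mul_zero, Finset.sum_ite_eq', Finset.mem_univ, if_true,
    coilMap_thin, leviCoeff_self, thinPair_inj, ite_mul, zero_mul]
  split_ifs
  · ring
  · rfl

theorem tensorMat_wid_coil :
    tensorMat (F.mat (ADiag.wid [.up 1])) (F.mat (ADiag.coil (.up 1) [])) =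
      Matrix.diagonal fun s : BasisIdx l [.up 1, .up 1] => (u (elt s.2.1).block : 𝕜) := by
  rw [mat_wid, mat_coil_up_one_nil]
  ext t s
  obtain ⟨a, b, rfl⟩ := exists_thinPair t
  obtain ⟨c, e, rfl⟩ := exists_thinPair s
  simp [thinPair, tensorMat_apply, blockScale, Matrix.diagonal_apply, Matrix.one_apply]
  split_ifs <;> simp_all

theorem mat_wid_annTensor_coil_ne (hq : ∀ m : ℕ, 0 < m → q ^ m ≠ 1) (a : Idx l) :
    F.mat (ADiag.annTensor q (ADiag.wid [.up 1]) (ADiag.coil (.up 1) [])) ≠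
      tensorMat (F.mat (ADiag.wid [.up 1])) (F.mat (ADiag.coil (.up 1) [])) := by
  intro h
  have h' := congrFun (congrFun h (thinPair a a)) (thinPair a a)
  rw [mat_wid_annTensor_coil_diag, if_pos rfl, tensorMat_wid_coil] at h'
  replace h' := h'.trans (Matrix.diagonal_apply_eq _ _)
  have h₂ : (q : 𝕜) ^ 2 * u a.block = u a.block := by simpa [thinPair] using h'
  refine hq 2 two_pos (Units.ext ?_)
  simpa using h₂

/-- The eigenvalues of the image of the coil behind a thin strand and of the tensor product of the
images differ: the former contain `q ^ 2 * u i` for all nonempty blocks `i`, the latter are the `u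
i`, and these finitely many numbers are not stable under multiplication by `q ^ 2`. -/
theorem not_hasTensorIsos (hq : ∀ m : ℕ, 0 < m → q ^ m ≠ 1) (a : Idx l) : ¬ F.HasTensorIsos := by
  rintro ⟨J, hJ⟩
  have h := hJ (ADiag.wid [.up 1]) (ADiag.coil (.up 1) [])
  rw [tensorMat_wid_coil] at h
  have hstep (a : Idx l) : ∃ b : Idx l, (u b.block : 𝕜) = (q : 𝕜) ^ 2 * u a.block := by
    obtain ⟨t, ht⟩ := exists_eq_of_mul_eq_mul_diagonal (J [.up 1] [.up 1]) h
      (F.mat_wid_annTensor_coil_diag a)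
    exact ⟨elt t.2.1, ht⟩
  have hpow (m : ℕ) : ∃ b : Idx l, (u b.block : 𝕜) = ((q : 𝕜) ^ 2) ^ m * u a.block := by
    induction m with
    | zero => exact ⟨a, by simp⟩
    | succ m ih =>
      obtain ⟨b, hb⟩ := ih
      obtain ⟨c, hc⟩ := hstep b
      exact ⟨c, by rw [hc, hb, pow_succ]; ring⟩
  choose b hb using hpow
  -- two powers of `q ^ 2` give the same index, as there are finitely many
  obtain ⟨m, k, hmk, hbmk⟩ := Finite.exists_ne_map_eq_of_infinite b
  have hinj : Function.Injective fun m : ℕ => q ^ m := by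
    rw [injective_pow_iff_not_isOfFinOrder, isOfFinOrder_iff_pow_eq_one]
    rintro ⟨m, hm, h⟩
    exact hq m hm h
  refine hmk (Nat.mul_left_cancel two_pos (hinj (Units.ext ?_)))
  have h₃ := hb m
  rw [hbmk, hb k] at h₃
  simpa [← pow_mul] using (mul_right_cancel₀ (u a.block).ne_zero h₃).symm

/-- For `a < b` in different blocks, the Levi crossing is the swap, while the `gl_n`-crossing sends
`v_b ⊗ v_a` to `v_a ⊗ v_b` plus a nonzero multiple of `v_b ⊗ v_a` or vice versa. -/
theorem mat_coil_annTensor_wid_ne (hq : ∀ m : ℕ, 0 < m → q ^ m ≠ 1) {a b : Idx l} (hab : a < b)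
    (h : a.block ≠ b.block) :
    F.mat (ADiag.annTensor q (ADiag.coil (.up 1) []) (ADiag.wid [.up 1])) ≠
      tensorMat (F.mat (ADiag.coil (.up 1) [])) (F.mat (ADiag.wid [.up 1])) := by
  intro h₀
  have h' := congrFun (congrFun h₀ (thinPair a b)) (thinPair b a)
  rw [mat_coil_annTensor_wid, compMat, Matrix.mul_apply, Finset.sum_eq_single (thinPair a b)] at h'
  · rw [evalP_crossUU_false q hab, coilMap_thin, leviCoeff_of_block_ne q h.symm, if_pos ⟨rfl, rfl⟩,
      one_mul, tensorMat_apply, mat_wid] at h'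
    have h₁ : (1 : Mat l 𝕜 [.up 1] [.up 1]) (cons (thin b) nil) (cons (thin a) nil) = 0 :=
      Matrix.one_apply_ne (by simpa using hab.ne')
    have h₂ : qpow q (-1) = qpow q 1 := by
      refine sub_eq_zero.1 (mul_right_cancel₀ (u b.block).ne_zero ?_)
      rw [h', zero_mul]
      exact mul_eq_zero_of_right _ h₁
    refine hq 2 two_pos ?_
    have hz : q⁻¹ = q := by simpa using (Units.ext h₂ : q ^ (-1 : ℤ) = q ^ (1 : ℤ))
    rw [pow_two]
    nth_rewrite 1 [← hz]
    exact inv_mul_cancel q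
  · intro s _ hs
    obtain ⟨c, e, rfl⟩ := exists_thinPair s
    rw [coilMap_thin, leviCoeff_of_block_ne q h.symm, if_neg, zero_mul, mul_zero]
    simpa using hs
  · simp

end AnnularFunctor

end Thin

end AnnularWebs

theorem lemmaL {𝕜 : Type*} [Field 𝕜] {d : ℕ} (l : Fin d → ℕ) (u : Fin d → 𝕜ˣ) :
    (CharZero 𝕜 → ∀ F : AnnularWebs.AnnularFunctor l (1 : 𝕜ˣ) u, F.IsPivotal) ∧
    (∀ q : 𝕜ˣ, (∀ m : ℕ, 0 < m → q ^ m ≠ 1) → 0 < ∑ i, l i →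
      ∀ F : AnnularWebs.AnnularFunctor l q u,
        ¬ F.IsStrictMonoidal ∧ ¬ F.HasTensorIsos ∧ ¬ F.IsPivotal ∧
        F.mat (AnnularWebs.ADiag.annTensor q
            (AnnularWebs.ADiag.wid [AnnularWebs.Label.up 1])
            (AnnularWebs.ADiag.coil (AnnularWebs.Label.up 1) [])) ≠
          AnnularWebs.tensorMat
            (F.mat (AnnularWebs.ADiag.wid [AnnularWebs.Label.up 1]))
            (F.mat (AnnularWebs.ADiag.coil (AnnularWebs.Label.up 1) [])) ∧
        ((∃ i j : Fin d, i ≠ j ∧ 0 < l i ∧ 0 < l j) →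
          F.mat (AnnularWebs.ADiag.annTensor q
              (AnnularWebs.ADiag.coil (AnnularWebs.Label.up 1) [])
              (AnnularWebs.ADiag.wid [AnnularWebs.Label.up 1])) ≠
            AnnularWebs.tensorMat
              (F.mat (AnnularWebs.ADiag.coil (AnnularWebs.Label.up 1) []))
              (F.mat (AnnularWebs.ADiag.wid [AnnularWebs.Label.up 1])))) := by
  refine ⟨fun _ F => F.isPivotal, fun q hq hn F => ?_⟩
  obtain ⟨i, -, hi⟩ := Finset.exists_ne_zero_of_sum_ne_zero hn.ne'
  have a : AnnularWebs.Idx l := AnnularWebs.Idx.mk i ⟨0, Nat.pos_of_ne_zero hi⟩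
  have h := F.mat_wid_annTensor_coil_ne hq a
  have h' : ¬ F.IsStrictMonoidal := fun h₀ => h (h₀ _ _)
  refine ⟨h', F.not_hasTensorIsos hq a, fun h₀ => h' h₀.monoidal, h, ?_⟩
  rintro ⟨i, j, hij, hi, hj⟩
  obtain hlt | hlt := lt_or_gt_of_ne hij
  · exact F.mat_coil_annTensor_wid_ne hq (a := AnnularWebs.Idx.mk i ⟨0, hi⟩)
      (b := AnnularWebs.Idx.mk j ⟨0, hj⟩) (Sigma.Lex.left _ _ hlt) hij
  · exact F.mat_coil_annTensor_wid_ne hq (a := AnnularWebs.Idx.mk j ⟨0, hj⟩)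
      (b := AnnularWebs.Idx.mk i ⟨0, hi⟩) (Sigma.Lex.left _ _ hlt) hij.symm
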